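/- Let $X$ be a compact connected (Hausdorff) complex manifold of dimension $k$. A holomorphic correspondence $F$ on $X$ is a formal sum $\Gamma=\sum_{j=1}^{N} m_j\Gamma_j$ ($N\ge 1$) with positive integers $m_j$ and distinct irreducible complex subvarieties $\Gamma_j\subseteq X\times X$ of dimension $k$ such that both projections $\pi_1,\pi_2\colon X\times X\to X$ map each $\Gamma_j$ onto $X$, and such that all the sets $\{w:(z,w)\in\Gamma_j\}$ and $\{w:(w,z)\in\Gamma_j\}$, $z\in X$, are finite. Put $|\Gamma|=\bigcup_j\Gamma_j$ and $F^{\dagger}(A)=\pi_1(\pi_2^{-1}(A)\cap|\Gamma|)$ for $A\subseteq X$. For $\phi\colon X\to\mathbb R$ and $z\in X$ let $$\sideset{}{'}\sum_{w\in F^\dagger(z)}\phi(w)=\sum_{j=1}^N m_j\sum_{w:(w,z)\in\Gamma_j}\nu_j(w,z)\,\phi(w),$$ where $\nu_j(w,z)$ is the local degree of $\pi_2|_{\Gamma_j}$ at $(w,z)$. The topological degree $d$ of $F$ is the number of points of $F^\dagger(z)$, counted with multiplicity, for generic $z$. A Borel probability measure $\mu$ on $X$ is $F^*$-invariant if $\int_X\sum'_{w\in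 F^\dagger(z)}\phi(w)\,d\mu(z)=d\int_X\phi\,d\mu$ for all $\phi\in\mathcal C(X,\mathbb R)$. Let $(U_F\phi)(z)=\frac1d\sum'_{w\in F^\dagger(z)}\phi(w)$. $F$ is weakly mixing with respect to $\mu$ if for all $\phi\in\mathcal C(X,\mathbb R)$ and $\psi\in L^1(\mu)$ $$\lim_{n\to\infty}\frac1n\sum_{j=0}^{n-1}\left|\int_X (U_F^{j}\phi)\,\psi\,d\mu-\int_X\phi\,d\mu\int_X\psi\,d\mu\right|=0 .$$ $F$ is ergodic with respect to $\mu$ if $\mu(B)\in\{0,1\}$ for every Borel set $B$ that is almost invariant, i.e. for which there is a Borel set $B'\subseteq B$ with $\mu(B')=\mu(B)$ and $F^\dagger(B')\subseteq B$. The product correspondence $F^{\times}=F\times F$ on $X\times X$ is $\sum_{i,j}m_im_j\,S^{-1}(\Gamma_i\times\Gamma_j)$, where $S(z_1,z_2,z_3,z_4)=(z_1,z_3,z_2,z_4)$; ergodicity and weak mixing of $F^\times$ with respect to $\mu\times\mu$ are defined in the same way. Theorem. Let $F$ be a holomorphic correspondence on $X$ and let $\mu$ be an $F^*$-invariant Borel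 probability measure on $X$. Then the following are equivalent: (1) $F$ is weakly mixing with respect to $\mu$; (2) $F^{\times}$ is ergodic with respect to $\mu\times\mu$; (3) $F^{\times}$ is weakly mixing with respect to $\mu\times\mu$. -/

import Mathlib

open Set Filter Topology MeasureTheory
open scoped Manifold ContDiff

noncomputable section

section AnalyticSets

variable {E : Type*} [NormedAddCommGroup E] [NormedSpace ℂ E] {H : Type*} [TopologicalSpace H]
  (I : ModelWithCorners ℂ E H) {M : Type*} [TopologicalSpace M] [ChartedSpace H M]

/-- `A` is a (closed) complex analytic subset of the complex manifold `M`: every point of `M` has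
an open neighbourhood in which `A` is the common zero set of finitely many holomorphic
functions. -/
def IsAnalyticSubset (A : Set M) : Prop :=
  ∀ p : M, ∃ U : Set M, IsOpen U ∧ p ∈ U ∧ ∃ (n : ℕ) (f : Fin n → M → ℂ),
    (∀ i, ContMDiffOn I 𝓘(ℂ, ℂ) ω (f i) U) ∧ ∀ q ∈ U, q ∈ A ↔ ∀ i, f i q = 0

/-- `A` is an irreducible analytic subset: it is nonempty, analytic, and not the union of two
analytic subsets both different from `A`. -/
def IsIrreducibleAnalyticSubset (A : Set M) : Prop :=
  A.Nonempty ∧ IsAnalyticSubset I A ∧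
    ∀ A₁ A₂ : Set M, IsAnalyticSubset I A₁ → IsAnalyticSubset I A₂ → A = A₁ ∪ A₂ →
      A = A₁ ∨ A = A₂

/-- `p` is a regular point of `A` of dimension `l`: near `p`, the set `A` is a complex submanifold
of dimension `l`, that is, some holomorphic chart around `p` maps `A` onto the trace of an
`l`-dimensional complex linear subspace. -/
def IsRegularPointOfDim (A : Set M) (l : ℕ) (p : M) : Prop :=
  p ∈ A ∧ ∃ e ∈ IsManifold.maximalAtlas I ω M, p ∈ e.source ∧
    ∃ L : Submodule ℂ E, Module.finrank ℂ L = l ∧ ∀ q ∈ e.source, q ∈ A ↔ I (e q) ∈ L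

/-- The dimension of `A` at `p` is `l`: it is the upper limit, as regular points of `A` tend to
`p`, of the dimension of `A` at those regular points. -/
def HasDimAt (A : Set M) (l : ℕ) (p : M) : Prop :=
  (∃ᶠ q in 𝓝 p, IsRegularPointOfDim I A l q) ∧
    ∀ l' : ℕ, (∃ᶠ q in 𝓝 p, IsRegularPointOfDim I A l' q) → l' ≤ l

/-- `A` is an irreducible complex subvariety of dimension `l`. (An irreducible analytic set has the
same dimension at all of its points.) -/
structure IsIrreducibleSubvariety (A : Set M) (l : ℕ) : Prop where
  irreducible : IsIrreducibleAnalyticSubset I A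
  hasDim : ∀ p ∈ A, HasDimAt I A l p

end AnalyticSets

/-- Formal sums `∑ j, m j • Γ j` of distinct subsets `Γ j` of `X × X` with positive integer
multiplicities `m j`: the `Γ j` are the elements of the support, `m j` is the value at `Γ j`. -/
abbrev FormalCorr (X : Type*) : Type _ := Set (X × X) →₀ ℕ

namespace FormalCorr

variable {X : Type*}

/-- `Γ = ∑ j, m j • Γ j` is a holomorphic correspondence on the complex manifold `X`. -/
structure IsHolomorphic {E : Type*} [NormedAddCommGroup E] [NormedSpace ℂ E] {H : Type*}
    [TopologicalSpace H] (I : ModelWithCorners ℂ E H) [TopologicalSpace X] [ChartedSpace H X]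
    (F : FormalCorr X) : Prop where
  /-- There is at least one summand. -/
  ne_zero : F ≠ 0
  irreducible : ∀ A ∈ F.support,
    IsIrreducibleSubvariety (I.prod I) A (Module.finrank ℂ E)
  surj_fst : ∀ A ∈ F.support, Prod.fst '' A = univ
  surj_snd : ∀ A ∈ F.support, Prod.snd '' A = univ
  finite_image : ∀ A ∈ F.support, ∀ z : X, {w : X | (z, w) ∈ A}.Finite
  finite_preimage : ∀ A ∈ F.support, ∀ z : X, {w : X | (w, z) ∈ A}.Finite

/-- The set `|Γ|`, the union of the `Γ j`. -/
def carrier (F : FormalCorr X) : Set (X × X) := ⋃ A ∈ F.support, A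

/-- The preimage `F†(B) = π₁ (π₂⁻¹ B ∩ |Γ|)`. -/
def preimage (F : FormalCorr X) (B : Set X) : Set X :=
  Prod.fst '' (Prod.snd ⁻¹' B ∩ F.carrier)

/-- The multiplicity of `w` as a preimage of `z` under `A ⊆ X × X`, i.e. the local degree at
`(w, z)` of the second projection restricted to `A`: the largest number of points of the fibres of
`A` over points `z'` arbitrarily near `z` that lie near `w`. It is `0` if `A` is closed and
`(w, z) ∉ A`. -/
def multiplicity [TopologicalSpace X] (A : Set (X × X)) (w z : X) : ℕ :=
  (⨅ U ∈ 𝓝 w, limsup (fun z' : X => {w' : X | w' ∈ U ∧ (w', z') ∈ A}.encard) (𝓝 z)).toNat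

/-- The sum of `φ w` over all `w ∈ F†(z)`, the points `w` repeated according to multiplicity. -/
def preimageSum [TopologicalSpace X] (F : FormalCorr X) (φ : X → ℝ) (z : X) : ℝ :=
  F.sum fun A m => (m : ℝ) * ∑ᶠ w : X, (multiplicity A w z : ℝ) * φ w

/-- The number of points of `F†(z)` counted with multiplicity. -/
def preimageCount [TopologicalSpace X] (F : FormalCorr X) (z : X) : ℕ :=
  F.sum fun A m => m * ∑ᶠ w : X, multiplicity A w z

/-- The topological degree of `F`: the number of points (counted with multiplicity) of `F†(z)` for
generic `z`, i.e. for all `z` in some dense open set. -/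
def topDegree [TopologicalSpace X] (F : FormalCorr X) : ℕ :=
  sInf {d : ℕ | ∃ V : Set X, IsOpen V ∧ Dense V ∧ ∀ z ∈ V, F.preimageCount z = d}

/-- `μ` is `F^*`-invariant: `F^* μ = d μ`, as functionals on continuous functions. -/
def IsInvariant [TopologicalSpace X] [MeasurableSpace X] (F : FormalCorr X) (μ : Measure X) :
    Prop :=
  ∀ φ : C(X, ℝ), ∫ z, F.preimageSum φ z ∂μ = (F.topDegree : ℝ) * ∫ z, φ z ∂μ

/-- The Koopman operator `U_F`. -/
def koopman [TopologicalSpace X] (F : FormalCorr X) (φ : X → ℝ) : X → ℝ :=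
  fun z => (1 / (F.topDegree : ℝ)) * F.preimageSum φ z

/-- The correlation `I_n^F(φ, ψ)`, the integral of `(U_F^n φ) ψ`. -/
def correlation [TopologicalSpace X] [MeasurableSpace X] (F : FormalCorr X) (μ : Measure X)
    (n : ℕ) (φ ψ : X → ℝ) : ℝ :=
  ∫ z, (F.koopman^[n] φ) z * ψ z ∂μ

/-- `F` is weakly mixing with respect to `μ`. -/
def IsWeaklyMixing [TopologicalSpace X] [MeasurableSpace X] (F : FormalCorr X) (μ : Measure X) :
    Prop :=
  ∀ (φ : C(X, ℝ)) (ψ : X → ℝ), Integrable ψ μ →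
    Tendsto (fun n : ℕ => (1 / (n : ℝ)) * ∑ j ∈ Finset.range n,
      |F.correlation μ j φ ψ - (∫ z, φ z ∂μ) * ∫ z, ψ z ∂μ|) atTop (𝓝 0)

/-- The measurable set `B` is almost invariant with respect to `F` and `μ`. -/
def IsAlmostInvariant [MeasurableSpace X] (F : FormalCorr X) (μ : Measure X) (B : Set X) : Prop :=
  MeasurableSet B ∧ ∃ B' : Set X, MeasurableSet B' ∧ B' ⊆ B ∧ μ B = μ B' ∧ F.preimage B' ⊆ B

/-- `F` is ergodic with respect to `μ`. -/
def IsErgodic [MeasurableSpace X] (F : FormalCorr X) (μ : Measure X) : Prop :=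
  ∀ B : Set X, F.IsAlmostInvariant μ B → μ B = 0 ∨ μ B = 1

/-- `S⁻¹(A₁ × A₂)`, where `S (z₁, z₂, z₃, z₄) = (z₁, z₃, z₂, z₄)`. -/
def prodSet {Y : Type*} (A₁ : Set (X × X)) (A₂ : Set (Y × Y)) : Set ((X × Y) × (X × Y)) :=
  {p | (p.1.1, p.2.1) ∈ A₁ ∧ (p.1.2, p.2.2) ∈ A₂}

/-- The product correspondence `∑ i, ∑ j, m i * n j • S⁻¹(Γ¹ i × Γ² j)`. -/
def product {Y : Type*} (F₁ : FormalCorr X) (F₂ : FormalCorr Y) : FormalCorr (X × Y) :=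
  F₁.sum fun A₁ m => F₂.sum fun A₂ n => Finsupp.single (prodSet A₁ A₂) (m * n)

end FormalCorr

end

/-! The theorem is Hilbert space theory once `koopman` is known to act almost everywhere as a Markov
operator. If `κ` is a Markov kernel with `κ z` equal to the normalised counting measure on the
preimages of `z` for almost every `z`, then invariance of `μ` gives a contraction `T` of `L²(μ)`
with `T 1 = 1` and `∫ T f = ∫ f` (`markovOp`). Weak mixing says that `⟪T ^ j f, g⟫ - ⟪1, f⟫ ⟪1, g⟫`
is Cesàro null in absolute value for all `f`, `g` (`Represents.Mixing`). By boundedness this need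
only be tested on total sets of continuous functions. The product correspondence is represented by
`κ ∥ₖ κ`.

Mixing passes to the product because correlations of tensors multiply and tensors are total. Mixing
implies ergodicity because the indicator of an almost invariant set is fixed by `T`, whence `ν(B) =
ν(B)²`. Ergodicity of the product implies mixing of `F`: fixed vectors of the product operator are
constants, so the mean ergodic theorem, applied to `φ₀ ⊗ φ₀` and `ψ ⊗ ψ` with `∫ φ₀ = 0`, makes the
Cesàro means of the squared correlations tend to zero, and Cauchy–Schwarz removes the square.

The geometric half produces the kernel. Its main input is `exists_local_structure`: over a dense
connected open part of a small ball, each `Γ j` is locally a graph over the second factor.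
Elimination by symmetric functions of zeros gives an equation for each coordinate of the fibre.
Hankel determinants of power sums cut out a proper analytic set off which the roots are holomorphic
branches, and the dimension hypothesis makes whole branches lie in `Γ j`. Hence each `Γ j` is a
branched cover with a constant number of sheets (`exists_isBranchedCover`).

Equality of the sum of local degrees with the number of sheets is not proved at branch points. The
inequality `topDegree ≤ preimageCount` holds everywhere, and invariance tested on the constant 1
forces equality almost everywhere (`ae_preimageCount_eq`). On that set `preimageSum` is continuous,
which gives measurability of the kernel. -/

/-! ### Holomorphic functions of several variables. -/

section HolAt

variable {V W : Type*} [NormedAddCommGroup V] [NormedSpace ℂ V]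
  [NormedAddCommGroup W] [NormedSpace ℂ W]

/-- `f` is holomorphic near `p`: it is complex differentiable at all points of a neighbourhood. -/
def HolAt (f : V → ℂ) (p : V) : Prop := ∀ᶠ q in 𝓝 p, DifferentiableAt ℂ f q

theorem HolAt.differentiableAt {f : V → ℂ} {p : V} (h : HolAt f p) : DifferentiableAt ℂ f p :=
  Eventually.self_of_nhds h

theorem HolAt.continuousAt {f : V → ℂ} {p : V} (h : HolAt f p) : ContinuousAt f p :=
  h.differentiableAt.continuousAt

theorem HolAt.eventually {f : V → ℂ} {p : V} (h : HolAt f p) : ∀ᶠ q in 𝓝 p, HolAt f q :=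
  eventually_eventually_nhds.2 h

theorem holAt_const (c : ℂ) (p : V) : HolAt (fun _ => c) p :=
  Eventually.of_forall fun _ => differentiableAt_const c

theorem HolAt.congr {f g : V → ℂ} {p : V} (h : HolAt f p) (hfg : f =ᶠ[𝓝 p] g) : HolAt g p := by
  filter_upwards [h, hfg.eventually_nhds] with q hq hq'
  exact hq.congr_of_eventuallyEq (EventuallyEq.symm hq')

theorem HolAt.mul {f g : V → ℂ} {p : V} (hf : HolAt f p) (hg : HolAt g p) :
    HolAt (fun q => f q * g q) p := by
  filter_upwards [hf, hg] with q h1 h2 using h1.mul h2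

theorem HolAt.pow {f : V → ℂ} {p : V} (hf : HolAt f p) (n : ℕ) :
    HolAt (fun q => f q ^ n) p := by
  filter_upwards [hf] with q h1 using h1.pow n

theorem HolAt.inv {f : V → ℂ} {p : V} (hf : HolAt f p) (h0 : f p ≠ 0) :
    HolAt (fun q => (f q)⁻¹) p := by
  filter_upwards [hf, hf.continuousAt.eventually_ne h0] with q h1 h2 using h1.inv h2

theorem HolAt.div {f g : V → ℂ} {p : V} (hf : HolAt f p) (hg : HolAt g p) (h0 : g p ≠ 0) :
    HolAt (fun q => f q / g q) p := by
  simpa only [div_eq_mul_inv] using hf.mul (hg.inv h0)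

theorem HolAt.sum {ι : Type*} {s : Finset ι} {f : ι → V → ℂ} {p : V}
    (hf : ∀ i ∈ s, HolAt (f i) p) : HolAt (fun q => ∑ i ∈ s, f i q) p := by
  filter_upwards [(s.eventually_all).2 hf] with q h1
  exact DifferentiableAt.fun_sum h1

theorem HolAt.prod {ι : Type*} [DecidableEq ι] {s : Finset ι} {f : ι → V → ℂ} {p : V}
    (hf : ∀ i ∈ s, HolAt (f i) p) : HolAt (fun q => ∏ i ∈ s, f i q) p := by
  induction s using Finset.induction_on with
  | empty => simpa using holAt_const 1 p
  | insert a s ha ih =>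
    simp only [Finset.prod_insert ha]
    exact (hf a (by simp)).mul (ih fun i hi => hf i (by simp [hi]))

theorem HolAt.comp {f : W → ℂ} {g : V → W} {p : V} (hf : HolAt f (g p))
    (hg : ∀ᶠ q in 𝓝 p, DifferentiableAt ℂ g q) : HolAt (fun q => f (g q)) p := by
  filter_upwards [hg, hg.self_of_nhds.continuousAt.eventually hf] with q h1 h2
  exact h2.comp q h1

theorem HolAt.comp_differentiable {f : W → ℂ} {g : V → W} {p : V} (hf : HolAt f (g p))
    (hg : Differentiable ℂ g) : HolAt (fun q => f (g q)) p :=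
  hf.comp (Eventually.of_forall fun q => hg q)

/-- As `q` tends to `p`, the restrictions of `f` to the parallel lines `q + ζ • v` converge locally
uniformly, so by Weierstrass their derivatives at `0` converge. In finite dimension continuity in
each direction `v` is enough. -/
theorem HolAt.continuousAt_fderiv [FiniteDimensional ℂ V] {f : V → ℂ} {p : V} (h : HolAt f p) :
    ContinuousAt (fderiv ℂ f) p := by
  rw [continuousAt_clm_apply]
  intro v
  obtain ⟨ε, hε, hball⟩ := Metric.eventually_nhds_iff_ball.1 h
  obtain ⟨r, hr, hrv⟩ : ∃ r : ℝ, 0 < r ∧ r * ‖v‖ < ε / 2 := by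
    refine ⟨ε / 2 / (‖v‖ + 1), by positivity, ?_⟩
    rw [div_mul_eq_mul_div, div_lt_iff₀ (by positivity)]
    nlinarith [norm_nonneg v]
  have hmem : ∀ q ∈ Metric.ball p (ε / 2), ∀ ζ ∈ Metric.ball (0 : ℂ) r,
      q + ζ • v ∈ Metric.ball p ε := by
    intro q hq ζ hζ
    rw [mem_ball_iff_norm] at *
    calc ‖q + ζ • v - p‖ = ‖(q - p) + ζ • v‖ := by congr 1; abel
      _ ≤ ‖q - p‖ + ‖ζ‖ * ‖v‖ := by rw [← norm_smul]; exact norm_add_le _ _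
      _ < ε / 2 + ε / 2 := by
        refine add_lt_add_of_lt_of_le hq (le_trans ?_ hrv.le)
        rw [sub_zero] at hζ
        gcongr
      _ = ε := by ring
  have hd : ∀ q ∈ Metric.ball p (ε / 2), ∀ ζ ∈ Metric.ball (0 : ℂ) r,
      HasDerivAt (fun ζ : ℂ => f (q + ζ • v)) (fderiv ℂ f (q + ζ • v) v) ζ := by
    intro q hq ζ hζ
    have h1 : HasDerivAt (fun ζ : ℂ => q + ζ • v) v ζ := by
      simpa using ((hasDerivAt_id ζ).smul_const v).const_add q
    exact (hball _ (hmem q hq ζ hζ)).hasFDerivAt.comp_hasDerivAt ζ h1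
  have hu : TendstoLocallyUniformlyOn (fun q (ζ : ℂ) => f (q + ζ • v)) (fun ζ => f (p + ζ • v))
      (𝓝 p) (Metric.ball 0 r) := by
    rw [tendstoLocallyUniformlyOn_iff_forall_tendsto]
    intro ζ hζ
    have hc : ContinuousAt f (p + ζ • v) :=
      (hball _ (hmem p (Metric.mem_ball_self (by positivity)) ζ hζ)).continuousAt
    have h1 : Tendsto (fun y : V × ℂ => f (p + y.2 • v)) (𝓝 p ×ˢ 𝓝[Metric.ball 0 r] ζ)
        (𝓝 (f (p + ζ • v))) := by
      refine hc.tendsto.comp ?_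
      have : Continuous fun y : V × ℂ => p + y.2 • v := by fun_prop
      refine (this.tendsto (p, ζ)).mono_left ?_
      rw [nhds_prod_eq]
      exact Filter.prod_mono le_rfl nhdsWithin_le_nhds
    have h2 : Tendsto (fun y : V × ℂ => f (y.1 + y.2 • v)) (𝓝 p ×ˢ 𝓝[Metric.ball 0 r] ζ)
        (𝓝 (f (p + ζ • v))) := by
      refine hc.tendsto.comp ?_
      have : Continuous fun y : V × ℂ => y.1 + y.2 • v := by fun_prop
      refine (this.tendsto (p, ζ)).mono_left ?_
      rw [nhds_prod_eq]
      exact Filter.prod_mono le_rfl nhdsWithin_le_nhds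
    exact ((h1.prodMk_nhds h2)).mono_right (nhds_le_uniformity _)
  have hev : ∀ᶠ q in 𝓝 p, q ∈ Metric.ball p (ε / 2) := Metric.ball_mem_nhds p (by positivity)
  have h0 : (0 : ℂ) ∈ Metric.ball (0 : ℂ) r := Metric.mem_ball_self hr
  have key := (hu.deriv (by
    filter_upwards [hev] with q hq ζ hζ
    exact (hd q hq ζ hζ).differentiableAt.differentiableWithinAt) Metric.isOpen_ball).tendsto_at h0
  have e1 : deriv (fun ζ : ℂ => f (p + ζ • v)) 0 = fderiv ℂ f p v := by
    simpa using (hd p (Metric.mem_ball_self (by positivity)) 0 h0).deriv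
  rw [e1] at key
  refine key.congr' ?_
  filter_upwards [hev] with q hq
  simpa using (hd q hq 0 h0).deriv

/-- Differentiation under the integral sign; the dominating constant comes from continuity of the
derivative and compactness of the circle. -/
theorem HolAt.circleIntegral [FiniteDimensional ℂ V] {F : V × ℂ → ℂ} {y₀ : V} {c : ℂ} {r : ℝ}
    (hr : 0 ≤ r) (hF : ∀ τ ∈ Metric.sphere c r, HolAt F (y₀, τ)) :
    HolAt (fun y => ∮ τ in C(c, r), F (y, τ)) y₀ := by
  have hK : IsCompact (Metric.sphere c r) := isCompact_sphere c r
  have hnear : ∀ᶠ y in 𝓝 y₀, ∀ τ ∈ Metric.sphere c r, HolAt F (y, τ) :=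
    hK.eventually_forall_of_forall_eventually fun τ hτ => (hF τ hτ).eventually
  -- The hypothesis on the circle is open in `y`, so differentiability at a single point suffices.
  suffices H : ∀ y₀ : V, (∀ τ ∈ Metric.sphere c r, HolAt F (y₀, τ)) →
      DifferentiableAt ℂ (fun y => ∮ τ in C(c, r), F (y, τ)) y₀ by
    filter_upwards [hnear] with y hy using H y hy
  clear hnear hF y₀
  intro y₀ hF
  have hcont : ContinuousOn (fun τ => ‖fderiv ℂ F (y₀, τ)‖) (Metric.sphere c r) := fun τ hτ =>
    (ContinuousAt.comp (f := fun τ => (y₀, τ)) (g := fun q => ‖fderiv ℂ F q‖)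
      (hF τ hτ).continuousAt_fderiv.norm (by fun_prop)).continuousWithinAt
  obtain ⟨C, hC⟩ := (hK.bddAbove_image hcont)
  have hbd : ∀ τ ∈ Metric.sphere c r, ‖fderiv ℂ F (y₀, τ)‖ < C + 1 := fun τ hτ =>
    lt_of_le_of_lt (hC (mem_image_of_mem _ hτ)) (lt_add_one C)
  have hev : ∀ᶠ y in 𝓝 y₀, ∀ τ ∈ Metric.sphere c r,
      DifferentiableAt ℂ F (y, τ) ∧ ‖fderiv ℂ F (y, τ)‖ < C + 1 := by
    refine hK.eventually_forall_of_forall_eventually fun τ hτ => ?_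
    exact (hF τ hτ).and ((hF τ hτ).continuousAt_fderiv.norm.eventually_lt_const (hbd τ hτ))
  have hcd : Continuous fun θ : ℝ => deriv (circleMap c r) θ := by
    simp only [deriv_circleMap]
    exact (continuous_circleMap 0 r).mul continuous_const
  have hm : ∀ θ : ℝ, circleMap c r θ ∈ Metric.sphere c r := circleMap_mem_sphere c hr
  have hpart : ∀ y, ∀ τ, DifferentiableAt ℂ F (y, τ) → HasFDerivAt (fun y => F (y, τ))
      ((fderiv ℂ F (y, τ)).comp (ContinuousLinearMap.inl ℂ V ℂ)) y := fun y τ h =>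
    HasFDerivAt.comp (f := fun y => (y, τ)) y h.hasFDerivAt (hasFDerivAt_prodMk_left y τ)
  have hcirc : ∀ y, (∀ τ ∈ Metric.sphere c r, DifferentiableAt ℂ F (y, τ)) →
      Continuous fun θ : ℝ => deriv (circleMap c r) θ • F (y, circleMap c r θ) := by
    intro y hy
    refine hcd.smul ?_
    refine continuous_iff_continuousAt.2 fun θ => ?_
    exact ContinuousAt.comp (f := fun θ => (y, circleMap c r θ)) (hy _ (hm θ)).continuousAt
      ((continuous_const.prodMk (continuous_circleMap c r)).continuousAt)
  refine (intervalIntegral.hasFDerivAt_integral_of_dominated_of_fderiv_le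
    (F := fun y θ => deriv (circleMap c r) θ • F (y, circleMap c r θ))
    (F' := fun y θ => deriv (circleMap c r) θ •
      ((fderiv ℂ F (y, circleMap c r θ)).comp (ContinuousLinearMap.inl ℂ V ℂ)))
    (bound := fun _ => r * (C + 1)) hev ?_ ?_ ?_ ?_ ?_ ?_).differentiableAt
  · filter_upwards [hev] with y hy
    exact (hcirc y fun τ hτ => (hy τ hτ).1).aestronglyMeasurable
  · exact (hcirc y₀ fun τ hτ => (hF τ hτ).differentiableAt).intervalIntegrable _ _
  · refine Continuous.aestronglyMeasurable ?_
    refine hcd.smul ?_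
    refine Continuous.clm_comp ?_ continuous_const
    refine continuous_iff_continuousAt.2 fun θ => ?_
    exact ContinuousAt.comp (f := fun θ => (y₀, circleMap c r θ)) (hF _ (hm θ)).continuousAt_fderiv
      ((continuous_const.prodMk (continuous_circleMap c r)).continuousAt)
  · refine Eventually.of_forall fun θ _ y hy => ?_
    rw [norm_smul]
    refine mul_le_mul (by simp [abs_of_nonneg hr]) ?_ (norm_nonneg _) hr
    refine (ContinuousLinearMap.opNorm_comp_le _ _).trans ?_
    refine (mul_le_mul (hy _ (hm θ)).2.le (ContinuousLinearMap.norm_inl_le_one ℂ V ℂ)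
      (norm_nonneg _) ((norm_nonneg _).trans (hy _ (hm θ)).2.le)).trans ?_
    simp
  · exact intervalIntegrable_const
  · refine Eventually.of_forall fun θ _ y hy => ?_
    exact (hpart _ _ (hy _ (hm θ)).1).fun_const_smul _

/-- Cauchy's formula expresses the directional derivative as a circle integral of `f` along the line
in direction `v`, which is holomorphic in the base point. -/
theorem HolAt.fderiv_apply [FiniteDimensional ℂ V] {f : V → ℂ} {p : V} (h : HolAt f p) (v : V) :
    HolAt (fun q => fderiv ℂ f q v) p := by
  obtain ⟨ε, hε, hball⟩ := Metric.eventually_nhds_iff_ball.1 h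
  -- The factor 2 leaves an open disc around the closed disc of radius `r`, as Cauchy's formula
  -- requires.
  obtain ⟨r, hr, hrv⟩ : ∃ r : ℝ, 0 < r ∧ 2 * r * ‖v‖ < ε / 2 := by
    refine ⟨ε / 4 / (‖v‖ + 1), by positivity, ?_⟩
    rw [mul_div_assoc', div_mul_eq_mul_div, div_lt_iff₀ (by positivity)]
    nlinarith [norm_nonneg v]
  have hmem : ∀ q ∈ Metric.ball p (ε / 2), ∀ ζ ∈ Metric.ball (0 : ℂ) (2 * r),
      q + ζ • v ∈ Metric.ball p ε := by
    intro q hq ζ hζ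
    rw [mem_ball_iff_norm] at *
    calc ‖q + ζ • v - p‖ = ‖(q - p) + ζ • v‖ := by congr 1; abel
      _ ≤ ‖q - p‖ + ‖ζ‖ * ‖v‖ := by rw [← norm_smul]; exact norm_add_le _ _
      _ < ε / 2 + ε / 2 := by
        refine add_lt_add_of_lt_of_le hq (le_trans ?_ hrv.le)
        rw [sub_zero] at hζ
        gcongr
      _ = ε := by ring
  have hd : ∀ q ∈ Metric.ball p (ε / 2), ∀ ζ ∈ Metric.ball (0 : ℂ) (2 * r),
      HasDerivAt (fun ζ : ℂ => f (q + ζ • v)) (fderiv ℂ f (q + ζ • v) v) ζ := by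
    intro q hq ζ hζ
    have h1 : HasDerivAt (fun ζ : ℂ => q + ζ • v) v ζ := by
      simpa using ((hasDerivAt_id ζ).smul_const v).const_add q
    exact (hball _ (hmem q hq ζ hζ)).hasFDerivAt.comp_hasDerivAt ζ h1
  have hsub : Metric.closedBall (0 : ℂ) r ⊆ Metric.ball 0 (2 * r) :=
    Metric.closedBall_subset_ball (by linarith)
  have hI : HolAt (fun q => (2 * Real.pi * Complex.I : ℂ)⁻¹ *
      ∮ τ in C((0 : ℂ), r), ((τ - 0) ^ 2)⁻¹ * f (q + τ • v)) p := by
    refine (holAt_const _ _).mul (HolAt.circleIntegral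
      (F := fun x => ((x.2 - 0) ^ 2)⁻¹ * f (x.1 + x.2 • v)) hr.le fun τ hτ => ?_)
    have hτ0 : τ ≠ 0 := by
      rintro rfl
      simp at hτ
      exact hr.ne hτ
    refine HolAt.mul ?_ ?_
    · refine HolAt.inv (Eventually.of_forall fun q => by fun_prop) ?_
      simpa using hτ0
    · have hin : p + τ • v ∈ Metric.ball p ε :=
        hmem p (Metric.mem_ball_self (by positivity)) τ (hsub (Metric.sphere_subset_closedBall hτ))
      refine HolAt.comp_differentiable (f := f) (g := fun x : V × ℂ => x.1 + x.2 • v) ?_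
        (by fun_prop)
      exact Filter.eventually_of_mem (Metric.isOpen_ball.mem_nhds hin) hball
  refine hI.congr ?_
  have hev : ∀ᶠ q in 𝓝 p, q ∈ Metric.ball p (ε / 2) := Metric.ball_mem_nhds p (by positivity)
  filter_upwards [hev] with q hq
  have h2 := Complex.two_pi_I_inv_smul_circleIntegral_sub_sq_inv_smul_of_differentiable
    (f := fun ζ : ℂ => f (q + ζ • v)) Metric.isOpen_ball hsub
    (fun ζ hζ => (hd q hq ζ hζ).differentiableAt.differentiableWithinAt) (Metric.mem_ball_self hr)
  simp only [smul_eq_mul] at h2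
  rw [h2]
  simpa using (hd q hq 0 (Metric.mem_ball_self (by positivity))).deriv

end HolAt

/-! ### The argument principle on a disc. -/

section ArgumentPrinciple

open Metric

theorem finite_zeros_of_analyticOnNhd_closedBall {c : ℂ} {r : ℝ} (hr : 0 < r) {f : ℂ → ℂ}
    (hf : AnalyticOnNhd ℂ f (closedBall c r)) (h0 : ∀ t ∈ sphere c r, f t ≠ 0) :
    {t ∈ closedBall c r | f t = 0}.Finite := by
  by_contra hinf
  obtain ⟨x, hx, hacc⟩ := Set.Infinite.exists_accPt_of_subset_isCompact (K := closedBall c r)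
    hinf (isCompact_closedBall c r) (fun t ht => ht.1)
  have hfr : ∃ᶠ z in 𝓝[≠] x, f z = 0 :=
    (accPt_iff_frequently_nhdsNE.1 hacc).mono fun z hz => hz.2
  have := hf.eqOn_zero_of_preconnected_of_frequently_eq_zero
    (convex_closedBall c r).isPreconnected hx hfr
  have hm : c + r ∈ sphere c r := by simp [abs_of_pos hr]
  exact h0 _ hm (this (sphere_subset_closedBall hm))

/-- **Argument principle** on a disc, with weights: the zeros, listed with multiplicity, compute
the integrals of `G * f' / f` for all holomorphic `G`. -/
theorem exists_multiset_zeros {c : ℂ} {r : ℝ} (hr : 0 < r) {f : ℂ → ℂ}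
    (hf : AnalyticOnNhd ℂ f (closedBall c r)) (h0 : ∀ t ∈ sphere c r, f t ≠ 0) :
    ∃ S : Multiset ℂ, (∀ t, t ∈ S ↔ t ∈ closedBall c r ∧ f t = 0) ∧
      ∀ G : ℂ → ℂ, AnalyticOnNhd ℂ G (closedBall c r) →
        (∮ t in C(c, r), G t * (deriv f t / f t)) =
          (2 * Real.pi * Complex.I) * (S.map G).sum := by
  -- Induction on the number of distinct zeros: dividing by `(z - a) ^ m`, with `m` the order of the
  -- zero `a`, removes exactly `a`.
  induction hn : {t ∈ closedBall c r | f t = 0}.ncard using Nat.strong_induction_on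
    generalizing f with
  | _ n ih =>
  have hfin := finite_zeros_of_analyticOnNhd_closedBall hr hf h0
  rcases {t ∈ closedBall c r | f t = 0}.eq_empty_or_nonempty with hemp | ⟨a, ha⟩
  · refine ⟨0, fun t => ?_, fun G hG => ?_⟩
    · have := Set.eq_empty_iff_forall_notMem.1 hemp t
      simpa using this
    · have hd : DifferentiableOn ℂ (fun t => G t * (deriv f t / f t)) (closedBall c r) := by
        intro t ht
        have hne : f t ≠ 0 := fun h => Set.eq_empty_iff_forall_notMem.1 hemp t ⟨ht, h⟩
        exact ((hG t ht).differentiableAt.mul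
          ((hf t ht).deriv.differentiableAt.div (hf t ht).differentiableAt hne)).differentiableWithinAt
      rw [Complex.circleIntegral_eq_zero_of_differentiable_on_off_countable hr.le countable_empty
        hd.continuousOn]
      · simp
      · intro z hz
        exact (hd z (ball_subset_closedBall hz.1)).differentiableAt
          (closedBall_mem_nhds_of_mem hz.1)
  · obtain ⟨haK, hfa⟩ := ha
    have haB : a ∈ ball c r := by
      refine lt_of_le_of_ne haK fun h => h0 a h hfa
    have hnz : ¬ ∀ᶠ z in 𝓝 a, f z = 0 := by
      intro h
      have := hf.eqOn_zero_of_preconnected_of_eventuallyEq_zero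
        (convex_closedBall c r).isPreconnected haK h
      have hm : c + r ∈ sphere c r := by simp [abs_of_pos hr]
      exact h0 _ hm (this (sphere_subset_closedBall hm))
    obtain ⟨m, g, hga, hg0, hgf⟩ := ((hf a haK).exists_eventuallyEq_pow_smul_nonzero_iff).2 hnz
    have hm0 : m ≠ 0 := by
      rintro rfl
      have := hgf.self_of_nhds
      simp [hfa] at this
      exact hg0 this.symm
    classical
    set h : ℂ → ℂ := fun z => if z = a then g a else f z / (z - a) ^ m with hh
    have hfh : ∀ z, f z = (z - a) ^ m * h z := by
      intro z
      by_cases hz : z = a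
      · simp [hz, hfa, hm0]
      · have : (z - a) ^ m ≠ 0 := pow_ne_zero _ (sub_ne_zero.2 hz)
        simp only [hh, hz, if_false]
        field_simp
    have hha : AnalyticAt ℂ h a := by
      refine hga.congr ?_
      filter_upwards [hgf] with z hz
      by_cases hza : z = a
      · simp [hh, hza]
      · have : (z - a) ^ m ≠ 0 := pow_ne_zero _ (sub_ne_zero.2 hza)
        simp only [hh, hza, if_false, hz, smul_eq_mul]
        field_simp
    have hhan : AnalyticOnNhd ℂ h (closedBall c r) := by
      intro t ht
      by_cases hta : t = a
      · rwa [hta]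
      · have h1 : AnalyticAt ℂ (fun z => f z / (z - a) ^ m) t :=
          (hf t ht).div ((analyticAt_id.sub analyticAt_const).pow m)
            (pow_ne_zero _ (sub_ne_zero.2 hta))
        refine h1.congr ?_
        filter_upwards [isOpen_ne.mem_nhds hta] with z hz
        simp only [hh]
        rw [if_neg hz]
    have hz_iff : ∀ z, h z = 0 ↔ z ≠ a ∧ f z = 0 := by
      intro z
      by_cases hza : z = a
      · simp [hh, hza, hg0]
      · have : (z - a) ^ m ≠ 0 := pow_ne_zero _ (sub_ne_zero.2 hza)
        simp [hh, hza, sub_eq_zero]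
    have hh0 : ∀ t ∈ sphere c r, h t ≠ 0 := fun t ht h' => h0 t ht ((hz_iff t).1 h').2
    have hlt : {t ∈ closedBall c r | h t = 0}.ncard < n := by
      rw [← hn]
      refine Set.ncard_lt_ncard ⟨fun t ht => ⟨ht.1, ((hz_iff t).1 ht.2).2⟩, fun hsub => ?_⟩ hfin
      exact ((hz_iff a).1 (hsub ⟨haK, hfa⟩).2).1 rfl
    obtain ⟨S, hS, hSG⟩ := ih _ hlt hhan hh0 rfl
    refine ⟨Multiset.replicate m a + S, fun t => ?_, fun G hG => ?_⟩
    · rw [Multiset.mem_add, Multiset.mem_replicate, hS, hz_iff]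
      constructor
      · rintro (⟨-, rfl⟩ | ⟨h1, -, h2⟩)
        · exact ⟨haK, hfa⟩
        · exact ⟨h1, h2⟩
      · rintro ⟨h1, h2⟩
        by_cases hta : t = a
        · exact Or.inl ⟨hm0, hta⟩
        · exact Or.inr ⟨h1, hta, h2⟩
    · have hGc : ContinuousOn G (closedBall c r) := fun t ht => (hG t ht).continuousAt.continuousWithinAt
      have hne : ∀ t ∈ sphere c r, t - a ≠ 0 := by
        intro t ht h'
        rw [sub_eq_zero] at h'
        exact h0 t ht (h' ▸ hfa)
      -- The logarithmic derivative is additive: the first term contributes `m * G a` by Cauchy's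
      -- formula, the second is the induction hypothesis for `h`.
      have hsplit : ∀ t ∈ sphere c r, G t * (deriv f t / f t) =
          (t - a)⁻¹ * (m * G t) + G t * (deriv h t / h t) := by
        intro t ht
        have h1 := hne t ht
        have h2 := hh0 t ht
        have hder : deriv f t = m * (t - a) ^ (m - 1) * h t + (t - a) ^ m * deriv h t := by
          have e : f = fun z => (z - a) ^ m * h z := funext hfh
          have hd1 : HasDerivAt (fun z : ℂ => (z - a) ^ m) (m * (t - a) ^ (m - 1)) t := by
            simpa using ((hasDerivAt_id t).sub_const a).fun_pow m
          have hd2 := (hhan t (sphere_subset_closedBall ht)).differentiableAt.hasDerivAt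
          rw [e]
          exact (hd1.mul hd2).deriv
        rw [hder, hfh t]
        obtain ⟨k, rfl⟩ := Nat.exists_eq_succ_of_ne_zero hm0
        simp only [Nat.succ_eq_add_one, Nat.add_sub_cancel, pow_succ]
        have h3 := pow_ne_zero k h1
        field_simp
      rw [circleIntegral.integral_congr hr.le hsplit, circleIntegral.integral_add, hSG G hG]
      · have hci := Complex.circleIntegral_sub_inv_smul_of_differentiable_on_off_countable
          (f := fun t => (m : ℂ) * G t) countable_empty haB (continuousOn_const.mul hGc)
          (fun x hx => ((hG x (ball_subset_closedBall hx.1)).differentiableAt.const_mul _))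
        simp only [smul_eq_mul] at hci
        rw [hci]
        simp [Multiset.map_replicate, Multiset.sum_replicate]
        ring
      · refine ContinuousOn.circleIntegrable hr.le ?_
        exact ((continuousOn_id.sub continuousOn_const).inv₀ hne).mul
          (continuousOn_const.mul (hGc.mono sphere_subset_closedBall))
      · refine ContinuousOn.circleIntegrable hr.le fun t ht => ?_
        have ht' := sphere_subset_closedBall ht
        exact ((hG t ht').continuousAt.mul ((hhan t ht').deriv.continuousAt.div
          (hhan t ht').continuousAt (hh0 t ht))).continuousWithinAt

end ArgumentPrinciple

/-! ### Zeros depending on parameters. -/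

section ParametricZeros

open Metric

variable {P : Type*} [NormedAddCommGroup P] [NormedSpace ℂ P]

theorem HolAt.hasDerivAt_snd {f : P × ℂ → ℂ} {y : P} {t : ℂ} (h : DifferentiableAt ℂ f (y, t)) :
    HasDerivAt (fun s => f (y, s)) (fderiv ℂ f (y, t) (0, 1)) t := by
  have h1 : HasDerivAt (fun s : ℂ => (y, s)) ((0 : P), (1 : ℂ)) t :=
    (hasDerivAt_const t y).prodMk (hasDerivAt_id t)
  exact h.hasFDerivAt.comp_hasDerivAt t h1

theorem HolAt.analyticAt_snd {f : P × ℂ → ℂ} {y : P} {t : ℂ} (h : HolAt f (y, t)) :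
    AnalyticAt ℂ (fun s => f (y, s)) t := by
  rw [Complex.analyticAt_iff_eventually_differentiableAt]
  have hc : ContinuousAt (fun s : ℂ => (y, s)) t := by fun_prop
  filter_upwards [hc.eventually h] with s hs
  exact (HolAt.hasDerivAt_snd hs).differentiableAt

/-- The zeros of a holomorphic function of one variable depending holomorphically on a parameter:
their number is locally constant, and the sums over the zeros of holomorphic functions are
holomorphic in the parameter. -/
theorem exists_zeros_family [FiniteDimensional ℂ P] {f : P × ℂ → ℂ} {y₀ : P} {c : ℂ} {r : ℝ}
    (hr : 0 < r)
    (hf : ∀ t ∈ closedBall c r, HolAt f (y₀, t)) (h0 : ∀ t ∈ sphere c r, f (y₀, t) ≠ 0) :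
    ∃ S : P → Multiset ℂ,
      (∀ᶠ y in 𝓝 y₀, ∀ t, t ∈ S y ↔ t ∈ closedBall c r ∧ f (y, t) = 0) ∧
      (∀ᶠ y in 𝓝 y₀, ∀ t ∈ S y, t ∈ ball c r) ∧
      (∀ᶠ y in 𝓝 y₀, (S y).card = (S y₀).card) ∧
      ∀ h : P × ℂ → ℂ, (∀ t ∈ closedBall c r, HolAt h (y₀, t)) →
        HolAt (fun y => ((S y).map fun a => h (y, a)).sum) y₀ := by
  classical
  have hK := isCompact_closedBall c r
  have hKs := isCompact_sphere c r
  have ev1 : ∀ᶠ y in 𝓝 y₀, ∀ t ∈ closedBall c r, HolAt f (y, t) :=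
    hK.eventually_forall_of_forall_eventually fun t ht => (hf t ht).eventually
  have ev2 : ∀ᶠ y in 𝓝 y₀, ∀ t ∈ sphere c r, f (y, t) ≠ 0 :=
    hKs.eventually_forall_of_forall_eventually fun t ht =>
      (hf t (sphere_subset_closedBall ht)).continuousAt.eventually_ne (h0 t ht)
  -- `S` must be defined for every `y`; where the hypotheses fail the value is `0`, which is
  -- harmless because all conclusions are local at `y₀`.
  have hex : ∀ y, ∃ S : Multiset ℂ, (∀ t ∈ closedBall c r, HolAt f (y, t)) →
      (∀ t ∈ sphere c r, f (y, t) ≠ 0) → (∀ t, t ∈ S ↔ t ∈ closedBall c r ∧ f (y, t) = 0) ∧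
      ∀ G : ℂ → ℂ, AnalyticOnNhd ℂ G (closedBall c r) →
        (∮ t in C(c, r), G t * (deriv (fun s => f (y, s)) t / f (y, t))) =
          (2 * Real.pi * Complex.I) * (S.map G).sum := by
    intro y
    by_cases h : (∀ t ∈ closedBall c r, HolAt f (y, t)) ∧ ∀ t ∈ sphere c r, f (y, t) ≠ 0
    · obtain ⟨S, hS⟩ := exists_multiset_zeros hr (f := fun s => f (y, s))
        (fun t ht => (h.1 t ht).analyticAt_snd) h.2
      exact ⟨S, fun _ _ => hS⟩
    · exact ⟨0, fun h1 h2 => absurd ⟨h1, h2⟩ h⟩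
  choose S hS using hex
  have key : ∀ h : P × ℂ → ℂ, (∀ t ∈ closedBall c r, HolAt h (y₀, t)) →
      HolAt (fun y => ((S y).map fun a => h (y, a)).sum) y₀ := by
    intro h hh
    have ev3 : ∀ᶠ y in 𝓝 y₀, ∀ t ∈ closedBall c r, HolAt h (y, t) :=
      hK.eventually_forall_of_forall_eventually fun t ht => (hh t ht).eventually
    have hI : HolAt (fun y => (2 * Real.pi * Complex.I : ℂ)⁻¹ *
        ∮ t in C(c, r), h (y, t) * (fderiv ℂ f (y, t) (0, 1) / f (y, t))) y₀ := by
      refine (holAt_const _ _).mul (HolAt.circleIntegral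
        (F := fun q => h q * (fderiv ℂ f q (0, 1) / f q)) hr.le fun t ht => ?_)
      have ht' := sphere_subset_closedBall ht
      exact (hh t ht').mul (((hf t ht').fderiv_apply _).div (hf t ht') (h0 t ht))
    refine hI.congr ?_
    filter_upwards [ev1, ev2, ev3] with y h1 h2 h3
    have e := (hS y h1 h2).2 (fun a => h (y, a)) fun t ht => (h3 t ht).analyticAt_snd
    have e2 : (∮ t in C(c, r), h (y, t) * (fderiv ℂ f (y, t) (0, 1) / f (y, t))) =
        ∮ t in C(c, r), h (y, t) * (deriv (fun s => f (y, s)) t / f (y, t)) := by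
      refine circleIntegral.integral_congr hr.le fun t ht => ?_
      rw [(HolAt.hasDerivAt_snd (h1 t (sphere_subset_closedBall ht)).differentiableAt).deriv]
    rw [e2, e, ← mul_assoc, inv_mul_cancel₀ Complex.two_pi_I_ne_zero, one_mul]
  refine ⟨S, ?_, ?_, ?_, key⟩
  · filter_upwards [ev1, ev2] with y h1 h2 using (hS y h1 h2).1
  · filter_upwards [ev1, ev2] with y h1 h2 t ht
    obtain ⟨h3, h4⟩ := ((hS y h1 h2).1 t).1 ht
    exact lt_of_le_of_ne h3 fun h => h2 t h h4
  -- The number of zeros is the weighted sum for `h = 1`, hence continuous, and integers at distance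
  -- less than 1 agree.
  · have hc := (key (fun _ => 1) fun t _ => holAt_const _ _).continuousAt
    simp only [Multiset.map_const', Multiset.sum_replicate, nsmul_eq_mul, mul_one] at hc
    filter_upwards [Metric.continuousAt_iff'.1 hc 1 one_pos] with y hy
    rw [Complex.dist_eq] at hy
    have : |((S y).card : ℤ) - (S y₀).card| < 1 := by
      have h2 : ‖(((((S y).card : ℤ) - (S y₀).card : ℤ)) : ℂ)‖ < 1 := by push_cast; exact hy
      rw [Complex.norm_intCast] at h2
      exact_mod_cast h2
    have := Int.abs_lt_one_iff.1 this
    omega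

/-- Products over the zeros of a holomorphic function are holomorphic in the parameter, by Newton's
identities. -/
theorem holAt_multiset_prod {S : P → Multiset ℂ} {y₀ : P} {h : P × ℂ → ℂ}
    (hcard : ∀ᶠ y in 𝓝 y₀, (S y).card = (S y₀).card)
    (hsum : ∀ j : ℕ, HolAt (fun y => ((S y).map fun a => h (y, a) ^ j).sum) y₀) :
    HolAt (fun y => ((S y).map fun a => h (y, a)).prod) y₀ := by
  classical
  obtain ⟨s, hs⟩ : ∃ s, s = (S y₀).card := ⟨_, rfl⟩
  rw [← hs] at hcard
  -- The enumeration `v y` has no regularity in `y`; only its symmetric functions are used.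
  have hex : ∀ y, ∃ v : Fin s → ℂ, (S y).card = s →
      (S y).map (fun a => h (y, a)) = (Finset.univ : Finset (Fin s)).val.map v := by
    intro y
    by_cases hy : (S y).card = s
    · obtain ⟨l, hl⟩ := Quot.exists_rep ((S y).map fun a => h (y, a))
      have hl' : (l : Multiset ℂ) = (S y).map fun a => h (y, a) := hl
      have hlen : l.length = s := by
        rw [← hy, ← Multiset.coe_card, hl', Multiset.card_map]
      subst hlen
      refine ⟨l.get, fun _ => ?_⟩
      rw [← hl', Fin.univ_val_map, List.ofFn_get]
    · exact ⟨0, fun h' => absurd h' hy⟩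
  choose v hv using hex
  have hps : ∀ j, HolAt (fun y => MvPolynomial.aeval (v y) (MvPolynomial.psum (Fin s) ℂ j)) y₀ := by
    intro j
    refine (hsum j).congr ?_
    filter_upwards [hcard] with y hy
    have e : (S y).map (fun a => h (y, a) ^ j) = ((S y).map fun a => h (y, a)).map (· ^ j) := by
      rw [Multiset.map_map]; rfl
    rw [e, hv y hy, Multiset.map_map]
    simp only [MvPolynomial.psum, map_sum, map_pow, MvPolynomial.aeval_X]
    rfl
  have hes : ∀ j, HolAt (fun y => MvPolynomial.aeval (v y) (MvPolynomial.esymm (Fin s) ℂ j)) y₀ := by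
    intro j
    induction j using Nat.strong_induction_on with
    | _ j ih =>
    rcases Nat.eq_zero_or_pos j with rfl | hj
    · simpa using holAt_const 1 y₀
    · have hN : ∀ y, MvPolynomial.aeval (v y) (MvPolynomial.esymm (Fin s) ℂ j) =
          (j : ℂ)⁻¹ * ((-1) ^ (j + 1) * ∑ a ∈ Finset.HasAntidiagonal.antidiagonal j with a.1 < j, (-1) ^ a.1 *
            MvPolynomial.aeval (v y) (MvPolynomial.esymm (Fin s) ℂ a.1) *
            MvPolynomial.aeval (v y) (MvPolynomial.psum (Fin s) ℂ a.2)) := by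
        intro y
        have := congrArg (MvPolynomial.aeval (v y)) (MvPolynomial.mul_esymm_eq_sum (Fin s) ℂ j)
        simp only [map_mul, map_natCast, map_pow, map_neg, map_one, map_sum] at this
        rw [← this, ← mul_assoc, inv_mul_cancel₀ (by exact_mod_cast hj.ne'), one_mul]
      simp only [hN]
      refine (holAt_const _ _).mul ((holAt_const _ _).mul (HolAt.sum fun a ha => ?_))
      exact ((holAt_const _ _).mul (ih a.1 (Finset.mem_filter.1 ha).2)).mul (hps a.2)
  refine (hes s).congr ?_
  filter_upwards [hcard] with y hy
  rw [hv y hy]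
  have : Finset.powersetCard s (Finset.univ : Finset (Fin s)) = {Finset.univ} := by
    simpa using Finset.powersetCard_self (Finset.univ : Finset (Fin s))
  simp only [MvPolynomial.esymm, this, Finset.sum_singleton, map_prod, MvPolynomial.aeval_X]
  rfl

end ParametricZeros

/-! ### Elimination and the local finite mapping theorem. -/

section Elimination

open Metric

variable {P : Type*} [NormedAddCommGroup P] [NormedSpace ℂ P]

theorem exists_isolating_radius {n : ℕ} {f : Fin n → P × ℂ → ℂ} {y₀ : P} {t₀ : ℂ}
    (hf : ∀ i, HolAt (f i) (y₀, t₀)) {i₀ : Fin n} (hnz : ¬ ∀ᶠ t in 𝓝 t₀, f i₀ (y₀, t) = 0) :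
    ∃ r > 0, (∀ t ∈ closedBall t₀ r, ∀ i, HolAt (f i) (y₀, t)) ∧
      ∀ t ∈ closedBall t₀ r, t ≠ t₀ → f i₀ (y₀, t) ≠ 0 := by
  have hc : ContinuousAt (fun s : ℂ => (y₀, s)) t₀ := by fun_prop
  have h1 : ∀ᶠ t in 𝓝 t₀, ∀ i, HolAt (f i) (y₀, t) :=
    eventually_all.2 fun i => hc.eventually (hf i).eventually
  have h2 : ∀ᶠ t in 𝓝 t₀, t ≠ t₀ → f i₀ (y₀, t) ≠ 0 := by
    rcases (hf i₀).analyticAt_snd.eventually_eq_zero_or_eventually_ne_zero with h | h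
    · exact absurd h hnz
    · exact eventually_nhdsWithin_iff.1 h
  obtain ⟨ε, hε, hball⟩ := Metric.eventually_nhds_iff_ball.1 (h1.and h2)
  refine ⟨ε / 2, by positivity, fun t ht => (hball t ?_).1, fun t ht => (hball t ?_).2⟩ <;>
  exact closedBall_subset_ball (by linarith) ht

-- As a polynomial in `c` the product has degree at most `S.card * n`, so vanishing at `S.card * n +
-- 1` integers makes it zero. Then one factor is the zero polynomial, and its coefficients are the
-- `v i a`.
open Polynomial in
theorem exists_forall_eq_zero_of_prod_eq_zero {n : ℕ} {S : Multiset ℂ} {v : Fin n → ℂ → ℂ}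
    (h : ∀ c : Fin (S.card * n + 1), (S.map fun a => ∑ i : Fin n, ((c : ℕ) : ℂ) ^ (i : ℕ) * v i a).prod = 0) :
    ∃ a ∈ S, ∀ i, v i a = 0 := by
  classical
  set q : ℂ → ℂ[X] := fun a => ∑ i : Fin n, C (v i a) * X ^ (i : ℕ)
  have hq : ∀ a, (q a).natDegree ≤ n := fun a =>
    natDegree_sum_le_of_forall_le _ _ fun i _ =>
      (natDegree_C_mul_X_pow_le _ _).trans i.2.le
  set Q : ℂ[X] := (S.map q).prod
  have hQ : Q.natDegree < Fintype.card (Fin (S.card * n + 1)) := by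
    rw [Fintype.card_fin, Nat.lt_succ_iff]
    refine (natDegree_multiset_prod_le _).trans ?_
    rw [Multiset.map_map]
    refine (Multiset.sum_le_card_nsmul _ n fun x hx => ?_).trans (by simp)
    obtain ⟨a, -, rfl⟩ := Multiset.mem_map.1 hx
    exact hq a
  have hev : ∀ c : Fin (S.card * n + 1), Q.eval ((c : ℕ) : ℂ) = 0 := by
    intro c
    rw [← h c, ← coe_evalRingHom, map_multiset_prod, Multiset.map_map]
    congr 1
    refine Multiset.map_congr rfl fun a _ => ?_
    simp only [q, Function.comp, coe_evalRingHom, eval_finsetSum, eval_mul, eval_C, eval_pow,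
      eval_X, mul_comm]
  have hQ0 : Q = 0 := eq_zero_of_natDegree_lt_card_of_eval_eq_zero Q
    (fun a b hab => Fin.ext (by exact_mod_cast hab)) hev hQ
  obtain ⟨a, ha, ha0⟩ := Multiset.mem_map.1 (Multiset.prod_eq_zero_iff.1 hQ0)
  refine ⟨a, ha, fun i => ?_⟩
  have := congrArg (fun p => p.coeff (i : ℕ)) ha0
  simp only [q, finsetSum_coeff, coeff_C_mul, coeff_X_pow, coeff_zero] at this
  rw [Finset.sum_eq_single i] at this
  · simpa using this
  · intro b _ hb
    have : (i : ℕ) ≠ b := fun h => hb (Fin.ext h.symm)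
    simp [this]
  · simp

variable [FiniteDimensional ℂ P]

/-- Elimination of one variable: the projection of an analytic germ along a variable in which it
is isolated is an analytic germ. -/
theorem eliminate_one {n : ℕ} {f : Fin n → P × ℂ → ℂ} {y₀ : P} {t₀ : ℂ}
    (hf : ∀ i, HolAt (f i) (y₀, t₀))
    (hiso : ∀ᶠ t in 𝓝 t₀, (∀ i, f i (y₀, t) = 0) → t = t₀) :
    ∃ (m : ℕ) (g : Fin m → P → ℂ), (∀ c, HolAt (g c) y₀) ∧
      (∃ T ∈ 𝓝 t₀, ∀ᶠ y in 𝓝 y₀, ∀ t ∈ T, (∀ i, f i (y, t) = 0) → ∀ c, g c y = 0) ∧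
      ∀ T ∈ 𝓝 t₀, ∀ᶠ y in 𝓝 y₀, (∀ c, g c y = 0) → ∃ t ∈ T, ∀ i, f i (y, t) = 0 := by
  -- If all the `f i` vanished near `t₀` on the slice over `y₀`, then `t₀` would not be isolated.
  obtain ⟨i₀, hi₀⟩ : ∃ i₀, ¬ ∀ᶠ t in 𝓝 t₀, f i₀ (y₀, t) = 0 := by
    by_contra! h
    have h1 : ∀ᶠ t in 𝓝[≠] t₀, t = t₀ := by
      refine Filter.Eventually.filter_mono nhdsWithin_le_nhds ?_
      filter_upwards [hiso, eventually_all.2 h] with t h2 h3 using h2 h3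
    obtain ⟨t, ht, ht'⟩ := (h1.and self_mem_nhdsWithin).exists
    exact ht' ht
  obtain ⟨r, hr, hhol, hne⟩ := exists_isolating_radius hf hi₀
  obtain ⟨S, hS1, hS2, hS3, hS4⟩ := exists_zeros_family hr (fun t ht => hhol t ht i₀)
    (fun t ht => hne t (sphere_subset_closedBall ht) (by
      rintro rfl
      simp at ht
      exact hr.ne ht))
  set s := (S y₀).card with hs
  set H : ℕ → P × ℂ → ℂ := fun c q => ∑ i : Fin n, (c : ℂ) ^ (i : ℕ) * f i q with hH
  have hHhol : ∀ c, ∀ t ∈ closedBall t₀ r, HolAt (H c) (y₀, t) := fun c t ht =>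
    HolAt.sum fun i _ => (holAt_const _ _).mul (hhol t ht i)
  -- The equations are resultants: products over the zeros of `f i₀` of the combinations `∑ i, c ^ i
  -- * f i`. There are enough values of `c` for all of them to vanish only at a common zero.
  refine ⟨s * n + 1, fun c y => ((S y).map fun a => H c (y, a)).prod, fun c => ?_, ?_, ?_⟩
  · exact holAt_multiset_prod hS3 fun j => hS4 (fun q => H c q ^ j) fun t ht => (hHhol c t ht).pow j
  · refine ⟨closedBall t₀ r, closedBall_mem_nhds _ hr, ?_⟩
    filter_upwards [hS1] with y hy t ht hft c
    refine Multiset.prod_eq_zero (Multiset.mem_map.2 ⟨t, (hy t).2 ⟨ht, hft i₀⟩, ?_⟩)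
    simp [hH, hft]
  · intro T hT
    have hsub : ∀ᶠ y in 𝓝 y₀, ∀ t ∈ closedBall t₀ r, f i₀ (y, t) = 0 → t ∈ T := by
      refine (isCompact_closedBall t₀ r).eventually_forall_of_forall_eventually fun t ht => ?_
      by_cases htt : t = t₀
      · subst htt
        have : ∀ᶠ q : P × ℂ in 𝓝 (y₀, t), q.2 ∈ T := continuousAt_snd.eventually hT
        filter_upwards [this] with q hq _ using hq
      · filter_upwards [(hhol t ht i₀).continuousAt.eventually_ne (hne t ht htt)] with q hq h
        exact absurd h hq
    filter_upwards [hS1, hS3, hsub] with y h1 h2 h3 h4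
    have h4' : ∀ c : Fin ((S y).card * n + 1),
        ((S y).map fun a => ∑ i : Fin n, ((c : ℕ) : ℂ) ^ (i : ℕ) * f i (y, a)).prod = 0 := by
      rw [h2]
      exact h4
    obtain ⟨a, ha, ha'⟩ := exists_forall_eq_zero_of_prod_eq_zero (v := fun i a => f i (y, a)) h4'
    exact ⟨a, h3 a ((h1 a).1 ha).1 (ha' i₀), ha'⟩

/-- Local finite mapping theorem: the projection of an analytic germ with isolated fibre is an
analytic germ. -/
theorem exists_equations_of_projection {k n : ℕ} {f : Fin n → P × (Fin k → ℂ) → ℂ} {y₀ : P}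
    {w₀ : Fin k → ℂ} (hf : ∀ i, HolAt (f i) (y₀, w₀))
    (hiso : ∀ᶠ w in 𝓝 w₀, (∀ i, f i (y₀, w) = 0) → w = w₀) :
    ∃ (m : ℕ) (g : Fin m → P → ℂ), (∀ c, HolAt (g c) y₀) ∧
      (∃ U ∈ 𝓝 w₀, ∀ᶠ y in 𝓝 y₀, ∀ w ∈ U, (∀ i, f i (y, w) = 0) → ∀ c, g c y = 0) ∧
      ∀ U ∈ 𝓝 w₀, ∀ᶠ y in 𝓝 y₀, (∀ c, g c y = 0) → ∃ w ∈ U, ∀ i, f i (y, w) = 0 := by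
  induction k generalizing n with
  | zero =>
    refine ⟨n, fun i y => f i (y, w₀), fun i => ?_, ⟨univ, univ_mem, ?_⟩, ?_⟩
    · exact HolAt.comp_differentiable (g := fun y : P => (y, w₀)) (hf i) (by fun_prop)
    · refine Eventually.of_forall fun y w _ h c => ?_
      rw [Subsingleton.elim w₀ w]
      exact h c
    · exact fun U hU => Eventually.of_forall fun y h => ⟨w₀, mem_of_mem_nhds hU, h⟩
  | succ k ih =>
    have hcons : Differentiable ℂ fun x : (P × (Fin k → ℂ)) × ℂ =>
        (x.1.1, (Fin.cons x.2 x.1.2 : Fin (k + 1) → ℂ)) := by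
      refine Differentiable.prodMk (by fun_prop) ?_
      refine differentiable_pi.2 fun i => ?_
      refine Fin.cases ?_ (fun j => ?_) i
      · simp only [Fin.cons_zero]; fun_prop
      · simp only [Fin.cons_succ]; fun_prop
    have hcw : (Fin.cons (w₀ 0) (Fin.tail w₀) : Fin (k + 1) → ℂ) = w₀ := Fin.cons_self_tail w₀
    have hcont : Continuous fun x : ℂ × (Fin k → ℂ) => (Fin.cons x.1 x.2 : Fin (k + 1) → ℂ) := by
      refine continuous_pi fun i => ?_
      refine Fin.cases ?_ (fun j => ?_) i
      · simp only [Fin.cons_zero]; fun_prop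
      · simp only [Fin.cons_succ]; fun_prop
    have hnbhd : ∀ U ∈ 𝓝 w₀, ∃ T ∈ 𝓝 (w₀ 0), ∃ U' ∈ 𝓝 (Fin.tail w₀), ∀ t ∈ T, ∀ w' ∈ U',
        (Fin.cons t w' : Fin (k + 1) → ℂ) ∈ U := by
      intro U hU
      have : ∀ᶠ x in 𝓝 (w₀ 0, Fin.tail w₀), (Fin.cons x.1 x.2 : Fin (k + 1) → ℂ) ∈ U := by
        refine hcont.continuousAt.eventually ?_
        simp only [hcw]
        exact hU
      rw [nhds_prod_eq] at this
      obtain ⟨T, hT, U', hU', h⟩ := Filter.mem_prod_iff.1 this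
      exact ⟨T, hT, U', hU', fun t ht w' hw' => h (Set.mk_mem_prod ht hw')⟩
    have hFhol : ∀ i, HolAt (fun x : (P × (Fin k → ℂ)) × ℂ =>
        f i (x.1.1, (Fin.cons x.2 x.1.2 : Fin (k + 1) → ℂ))) ((y₀, Fin.tail w₀), w₀ 0) := by
      intro i
      refine HolAt.comp_differentiable (f := f i) ?_ hcons
      simp only [hcw]
      exact hf i
    -- The coordinate `w 0` is eliminated, with the remaining coordinates treated as parameters.
    obtain ⟨m, h, hh, ⟨T₁, hT₁, hc₁⟩, hc₂⟩ := eliminate_one hFhol (by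
      obtain ⟨T, hT, U', hU', hTU⟩ := hnbhd _ hiso
      filter_upwards [hT] with t ht h
      have := hTU t ht _ (mem_of_mem_nhds hU') h
      simpa using congrFun this 0)
    obtain ⟨T₀, hT₀, U₀, hU₀, hTU₀⟩ := hnbhd _ hiso
    -- The fibre of the projected germ is still isolated: a zero of `h` over `y₀` near the tail of
    -- `w₀` lifts to a zero of `f` near `w₀`, which must be `w₀`.
    obtain ⟨l, g, hg, ⟨U₁, hU₁, hd₁⟩, hd₂⟩ := ih hh (by
      have hc : ContinuousAt (fun w' : Fin k → ℂ => (y₀, w')) (Fin.tail w₀) := by fun_prop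
      filter_upwards [hc.eventually (hc₂ T₀ hT₀), hU₀] with w' h1 h2 h3
      obtain ⟨t, ht, ht'⟩ := h1 h3
      have := hTU₀ t ht w' h2 ht'
      rw [← hcw] at this
      exact (Fin.cons_injective2 this).2)
    refine ⟨l, g, hg, ?_, ?_⟩
    · rw [nhds_prod_eq] at hc₁
      obtain ⟨Y, hY, W, hW, hYW⟩ := Filter.mem_prod_iff.1 hc₁
      refine ⟨{w | w 0 ∈ T₁ ∧ Fin.tail w ∈ W ∩ U₁}, ?_, ?_⟩
      · have hc0 : ContinuousAt (fun w : Fin (k + 1) → ℂ => w 0) w₀ :=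
          (continuous_apply 0).continuousAt
        have hct : ContinuousAt (fun w : Fin (k + 1) → ℂ => Fin.tail w) w₀ :=
          (continuous_pi fun i => continuous_apply _).continuousAt
        exact (hc0.eventually hT₁).and (hct.eventually (inter_mem hW hU₁))
      · filter_upwards [hY, hd₁] with y h1 h2 w hw hfw
        refine h2 _ hw.2.2 (hYW (Set.mk_mem_prod h1 hw.2.1) (w 0) hw.1 ?_)
        intro i
        simpa using hfw i
    · intro U hU
      obtain ⟨T, hT, U', hU', hTU⟩ := hnbhd U hU
      have h2 := hc₂ T hT
      rw [nhds_prod_eq] at h2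
      obtain ⟨Y, hY, W, hW, hYW⟩ := Filter.mem_prod_iff.1 h2
      filter_upwards [hY, hd₂ _ (inter_mem hU' hW)] with y h3 h4 h5
      obtain ⟨w', hw', hw''⟩ := h4 h5
      obtain ⟨t, ht, ht'⟩ := hYW (Set.mk_mem_prod h3 hw'.2) hw''
      exact ⟨_, hTU t ht w' hw'.1, ht'⟩

/-- Each coordinate of a point of an analytic germ with isolated fibre satisfies a nontrivial
holomorphic equation over the base. -/
theorem exists_coordinate_equation {k n : ℕ} {f : Fin n → P × (Fin k → ℂ) → ℂ} {z₀ : P}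
    {w₀ : Fin k → ℂ} (hf : ∀ i, HolAt (f i) (z₀, w₀))
    (hiso : ∀ᶠ w in 𝓝 w₀, (∀ i, f i (z₀, w) = 0) → w = w₀) (j : Fin k) :
    ∃ g : P × ℂ → ℂ, HolAt g (z₀, w₀ j) ∧ (¬ ∀ᶠ t in 𝓝 (w₀ j), g (z₀, t) = 0) ∧
      ∃ U ∈ 𝓝 w₀, ∀ᶠ z in 𝓝 z₀, ∀ w ∈ U, (∀ i, f i (z, w) = 0) → g (z, w j) = 0 := by
  -- A new parameter `t` and the equation `w j = t` turn the coordinate into part of the base of the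
  -- projection.
  set F : Fin (n + 1) → (P × ℂ) × (Fin k → ℂ) → ℂ :=
    Fin.cons (fun x => x.2 j - x.1.2) (fun i x => f i (x.1.1, x.2)) with hF
  have hF0 : ∀ x, F 0 x = x.2 j - x.1.2 := fun x => rfl
  have hFs : ∀ i x, F (Fin.succ i) x = f i (x.1.1, x.2) := fun i x => rfl
  obtain ⟨m, g, hg, ⟨U, hU, h1⟩, h2⟩ := exists_equations_of_projection (f := F)
    (y₀ := (z₀, w₀ j)) (w₀ := w₀) (by
      refine Fin.cases ?_ fun i => ?_
      · exact Eventually.of_forall fun q => by simp only [hF, Fin.cons_zero]; fun_prop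
      · exact HolAt.comp_differentiable (f := f i)
          (g := fun x : (P × ℂ) × (Fin k → ℂ) => (x.1.1, x.2)) (hf i) (by fun_prop)) (by
      filter_upwards [hiso] with w hw h
      exact hw fun i => h i.succ)
  have hc : ContinuousAt (fun t : ℂ => (z₀, t)) (w₀ j) := by fun_prop
  -- If every `g c` vanished along the slice, every `t` near `w₀ j` would be the `j`-th coordinate
  -- of a point of the isolated fibre.
  obtain ⟨c, hcn⟩ : ∃ c, ¬ ∀ᶠ t in 𝓝 (w₀ j), g c (z₀, t) = 0 := by
    by_contra! h
    have h3 : ∀ᶠ t in 𝓝[≠] (w₀ j), t = w₀ j := by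
      refine Filter.Eventually.filter_mono nhdsWithin_le_nhds ?_
      filter_upwards [hc.eventually (h2 _ hiso), eventually_all.2 h] with t h4 h5
      obtain ⟨w, hw, hw'⟩ := h4 h5
      have e : w = w₀ := hw fun i => hw' i.succ
      have := hw' 0
      rw [hF0, e] at this
      exact (sub_eq_zero.1 this).symm
    obtain ⟨t, ht, ht'⟩ := (h3.and self_mem_nhdsWithin).exists
    exact ht' ht
  refine ⟨g c, hg c, hcn, ?_⟩
  rw [nhds_prod_eq] at h1
  obtain ⟨Z, hZ, T, hT, hZT⟩ := Filter.mem_prod_iff.1 h1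
  have hcj : ContinuousAt (fun w : Fin k → ℂ => w j) w₀ := (continuous_apply j).continuousAt
  refine ⟨U ∩ {w | w j ∈ T}, inter_mem hU (hcj.eventually hT), ?_⟩
  filter_upwards [hZ] with z hz w hw hfw
  refine hZT (Set.mk_mem_prod hz hw.2) w hw.1 ?_ c
  refine Fin.cases ?_ fun i => ?_
  · rw [hF0]; simp
  · exact hfw i

end Elimination

/-! ### Hankel determinants detecting the number of distinct roots. -/

section Hankel

/-- The Hankel matrix of the power sums of a multiset. -/
def powerSumHankel (S : Multiset ℂ) (m : ℕ) : Matrix (Fin m) (Fin m) ℂ :=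
  Matrix.of fun a b => (S.map fun t => t ^ ((a : ℕ) + b)).sum

/-- This is `Vᵀ D V` with `V` the Vandermonde matrix of the distinct elements and `D` their
multiplicities. The determinant therefore vanishes if there are fewer than `m` distinct elements and
not if there are exactly `m`. -/
theorem powerSumHankel_eq [DecidableEq ℂ] (S : Multiset ℂ) (m : ℕ) {n : ℕ}
    (e : Fin n ≃ S.toFinset) :
    powerSumHankel S m =
      (Matrix.of fun (i : Fin n) (a : Fin m) => (S.count (e i : ℂ) : ℂ) * (e i : ℂ) ^ (a : ℕ)).transpose *
        Matrix.of fun (i : Fin n) (b : Fin m) => (e i : ℂ) ^ (b : ℕ) := by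
  ext a b
  rw [Matrix.mul_apply, powerSumHankel, Matrix.of_apply, Finset.sum_multiset_map_count,
    ← Finset.sum_coe_sort, ← e.sum_comp]
  refine Finset.sum_congr rfl fun i _ => ?_
  simp [pow_add]
  ring

theorem det_powerSumHankel_eq_zero [DecidableEq ℂ] {S : Multiset ℂ} {m : ℕ}
    (h : S.toFinset.card < m) : (powerSumHankel S m).det = 0 := by
  set e := S.toFinset.equivFin.symm
  rw [powerSumHankel_eq S m e]
  by_contra hne
  have h1 := Matrix.rank_of_isUnit _ ((Matrix.isUnit_iff_isUnit_det _).2 (isUnit_iff_ne_zero.2 hne))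
  have h2 := Matrix.rank_mul_le_right
    (Matrix.of fun (i : Fin S.toFinset.card) (a : Fin m) =>
      (S.count (e i : ℂ) : ℂ) * (e i : ℂ) ^ (a : ℕ)).transpose
    (Matrix.of fun (i : Fin S.toFinset.card) (b : Fin m) => (e i : ℂ) ^ (b : ℕ))
  have h3 := Matrix.rank_le_height
    (Matrix.of fun (i : Fin S.toFinset.card) (b : Fin m) => (e i : ℂ) ^ (b : ℕ))
  rw [h1, Fintype.card_fin] at h2
  omega

theorem det_powerSumHankel_ne_zero [DecidableEq ℂ] {S : Multiset ℂ} {m : ℕ}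
    (h : S.toFinset.card = m) : (powerSumHankel S m).det ≠ 0 := by
  subst h
  set e := S.toFinset.equivFin.symm with he
  rw [powerSumHankel_eq S _ e, Matrix.det_mul, Matrix.det_transpose]
  have hv : Matrix.det (Matrix.of fun (i : Fin S.toFinset.card) (b : Fin S.toFinset.card) =>
      (e i : ℂ) ^ (b : ℕ)) ≠ 0 := by
    have := (Matrix.det_vandermonde_ne_zero_iff (v := fun i => (e i : ℂ))).2
      (fun a b hab => e.injective (Subtype.ext hab))
    exact this
  refine mul_ne_zero ?_ hv
  have e1 : (Matrix.of fun (i : Fin S.toFinset.card) (a : Fin S.toFinset.card) =>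
      (S.count (e i : ℂ) : ℂ) * (e i : ℂ) ^ (a : ℕ)) =
      Matrix.diagonal (fun i => (S.count (e i : ℂ) : ℂ)) *
        Matrix.of fun (i : Fin S.toFinset.card) (b : Fin S.toFinset.card) => (e i : ℂ) ^ (b : ℕ) := by
    ext i a
    simp [Matrix.diagonal_mul]
  rw [e1, Matrix.det_mul, Matrix.det_diagonal]
  refine mul_ne_zero (Finset.prod_ne_zero_iff.2 fun i _ => ?_) hv
  have : (e i : ℂ) ∈ S := Multiset.mem_toFinset.1 (e i).2
  exact_mod_cast (Multiset.count_pos.2 this).ne'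

end Hankel

/-! ### The identity theorem in several variables. -/

section Identity

variable {V : Type*} [NormedAddCommGroup V] [NormedSpace ℂ V]

/-- Restriction of a holomorphic function on a convex open set to a complex line. -/
theorem analyticOnNhd_line {f : V → ℂ} {B : Set V} (hB : IsOpen B)
    (hf : ∀ q ∈ B, DifferentiableAt ℂ f q) (p v : V) :
    AnalyticOnNhd ℂ (fun ζ : ℂ => f (p + ζ • v)) {ζ | p + ζ • v ∈ B} := by
  have hc : Continuous fun ζ : ℂ => p + ζ • v := by fun_prop
  refine DifferentiableOn.analyticOnNhd (fun ζ hζ => ?_) (hB.preimage hc)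
  have hd : DifferentiableAt ℂ (fun ζ : ℂ => p + ζ • v) ζ := by fun_prop
  exact ((hf _ hζ).comp ζ hd).differentiableWithinAt

theorem convex_line_preimage {B : Set V} [NormedSpace ℝ V] [IsScalarTower ℝ ℂ V]
    (hB : Convex ℝ B) (p v : V) : Convex ℝ {ζ : ℂ | p + ζ • v ∈ B} := by
  intro x hx y hy a b ha hb hab
  have := hB hx hy ha hb hab
  have e : p + (a • x + b • y) • v = a • (p + x • v) + b • (p + y • v) := by
    rw [add_smul, smul_assoc, smul_assoc, smul_add, smul_add]
    have : p = a • p + b • p := by rw [← add_smul, hab, one_smul]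
    nth_rw 1 [this]
    abel
  simp only [mem_ofPred_eq, e]
  exact this

/-- Identity theorem on convex open sets. -/
theorem eqOn_zero_of_eventually_zero {f : V → ℂ} {p : V} {ε : ℝ}
    (hf : ∀ q ∈ Metric.ball p ε, DifferentiableAt ℂ f q) {q : V} (hq : q ∈ Metric.ball p ε)
    (h0 : ∀ᶠ x in 𝓝 q, f x = 0) : ∀ x ∈ Metric.ball p ε, f x = 0 := by
  intro x hx
  let _ : NormedSpace ℝ V := NormedSpace.restrictScalars ℝ ℂ V
  have hconv : Convex ℝ (Metric.ball p ε) := convex_ball p ε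
  have hpre := (convex_line_preimage hconv q (x - q)).isPreconnected
  have hc : ContinuousAt (fun ζ : ℂ => q + ζ • (x - q)) 0 := by fun_prop
  have hz : ∀ᶠ ζ in 𝓝 (0 : ℂ), f (q + ζ • (x - q)) = 0 := hc.eventually (by simpa using h0)
  have h := (analyticOnNhd_line Metric.isOpen_ball hf q (x - q)).eqOn_zero_of_preconnected_of_eventuallyEq_zero
    hpre (z₀ := 0) (by simpa using hq) hz
  have := h (x := 1) (by simpa using hx)
  simpa using this

/-- Germs form a domain: near a point where `f` does not vanish, `g` would vanish, and the identity
theorem spreads this over the ball. -/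
theorem HolAt.not_eventually_mul_eq_zero {f g : V → ℂ} {p : V} (hf : HolAt f p) (hg : HolAt g p)
    (hf0 : ¬ ∀ᶠ q in 𝓝 p, f q = 0) (hg0 : ¬ ∀ᶠ q in 𝓝 p, g q = 0) :
    ¬ ∀ᶠ q in 𝓝 p, f q * g q = 0 := by
  intro h
  obtain ⟨ε, hε, hb⟩ := Metric.eventually_nhds_iff_ball.1 ((h.and hf).and hg)
  obtain ⟨q, hq, hqf⟩ : ∃ q ∈ Metric.ball p ε, f q ≠ 0 := by
    by_contra! hall
    exact hf0 (Metric.eventually_nhds_iff_ball.2 ⟨ε, hε, hall⟩)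
  refine hg0 (Metric.eventually_nhds_iff_ball.2 ⟨ε, hε,
    eqOn_zero_of_eventually_zero (fun x hx => (hb x hx).2) hq ?_⟩)
  filter_upwards [(hb q hq).1.2.continuousAt.eventually_ne hqf,
    Metric.isOpen_ball.mem_nhds hq] with x h1 h2
  exact (mul_eq_zero.1 (hb x h2).1.1).resolve_left h1

theorem HolAt.not_eventually_prod_eq_zero {ι : Type*} [DecidableEq ι] {s : Finset ι}
    {f : ι → V → ℂ} {p : V} (hf : ∀ i ∈ s, HolAt (f i) p)
    (hf0 : ∀ i ∈ s, ¬ ∀ᶠ q in 𝓝 p, f i q = 0) : ¬ ∀ᶠ q in 𝓝 p, ∏ i ∈ s, f i q = 0 := by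
  induction s using Finset.induction_on with
  | empty => simpa using NeBot.ne'
  | insert a s ha ih =>
    simp only [Finset.prod_insert ha]
    exact (hf a (by simp)).not_eventually_mul_eq_zero
      (HolAt.prod fun i hi => hf i (by simp [hi])) (hf0 a (by simp))
      (ih (fun i hi => hf i (by simp [hi])) fun i hi => hf0 i (by simp [hi]))

end Identity

/-! ### Holomorphic branches away from a discriminant locus. -/

section Branches

open Metric

variable {P : Type*} [NormedAddCommGroup P] [NormedSpace ℂ P] [FiniteDimensional ℂ P]

/-- Away from a proper analytic subset of the base, the zeros of a holomorphic function of one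
variable depending on parameters are locally holomorphic functions of the parameters. -/
theorem exists_branch_locus_one {g : P × ℂ → ℂ} {z₀ : P} {t₀ : ℂ} (hg : HolAt g (z₀, t₀))
    (hnz : ¬ ∀ᶠ t in 𝓝 t₀, g (z₀, t) = 0) :
    ∃ r > 0, ∃ (M : ℕ) (δ : P → ℂ), HolAt δ z₀ ∧ (¬ ∀ᶠ z in 𝓝 z₀, δ z = 0) ∧
      ∀ᶠ z in 𝓝 z₀, (∃ R : Finset ℂ, R.card ≤ M ∧ ∀ t ∈ ball t₀ r, g (z, t) = 0 → t ∈ R) ∧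
        (δ z ≠ 0 → ∀ t₁ ∈ ball t₀ r, g (z, t₁) = 0 → ∃ h : P → ℂ, HolAt h z ∧ h z = t₁ ∧
          ∀ᶠ q in 𝓝 (z, t₁), g q = 0 → q.2 = h q.1) := by
  classical
  obtain ⟨r, hr, hhol, hne⟩ := exists_isolating_radius (f := fun _ : Fin 1 => g) (fun _ => hg)
    (i₀ := 0) hnz
  replace hhol : ∀ t ∈ closedBall t₀ r, HolAt g (z₀, t) := fun t ht => hhol t ht 0
  have hne' : ∀ t ∈ sphere t₀ r, g (z₀, t) ≠ 0 := fun t ht =>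
    hne t (sphere_subset_closedBall ht) (by
      rintro rfl
      simp at ht
      exact hr.ne ht)
  obtain ⟨S, hS1, hS2, hS3, hS4⟩ := exists_zeros_family hr hhol hne'
  have hhol' : ∀ᶠ z in 𝓝 z₀, ∀ t ∈ closedBall t₀ r, HolAt g (z, t) :=
    (isCompact_closedBall t₀ r).eventually_forall_of_forall_eventually
      fun t ht => (hhol t ht).eventually
  set s := (S z₀).card
  set D : P → ℕ := fun z => (S z).toFinset.card with hD
  have hDs : ∀ᶠ z in 𝓝 z₀, D z ≤ s := by
    filter_upwards [hS3] with z hz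
    rw [← hz]
    exact Multiset.toFinset_card_le _
  -- `m` is the generic number of distinct zeros: it bounds their number near `z₀` and is attained
  -- arbitrarily close to `z₀`.
  set m := Nat.findGreatest (fun m => ∃ᶠ z in 𝓝 z₀, m ≤ D z) s with hm
  have hm1 : ∃ᶠ z in 𝓝 z₀, m ≤ D z :=
    Nat.findGreatest_spec (P := fun m => ∃ᶠ z in 𝓝 z₀, m ≤ D z) (Nat.zero_le s)
      (Eventually.of_forall fun z => Nat.zero_le _).frequently
  have hm2 : ∀ᶠ z in 𝓝 z₀, D z ≤ m := by
    rcases (Nat.findGreatest_le (P := fun m => ∃ᶠ z in 𝓝 z₀, m ≤ D z) s).lt_or_eq with h | h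
    · have := Nat.findGreatest_is_greatest (P := fun m => ∃ᶠ z in 𝓝 z₀, m ≤ D z)
        (Nat.lt_succ_self _) h
      rw [not_frequently] at this
      filter_upwards [this] with z hz
      omega
    · filter_upwards [hDs] with z hz
      rw [hm, h]
      exact hz
  have hδhol : HolAt (fun z => (powerSumHankel (S z) m).det) z₀ := by
    simp only [Matrix.det_apply', powerSumHankel, Matrix.of_apply]
    refine HolAt.sum fun σ _ => (holAt_const _ _).mul (HolAt.prod fun i _ => ?_)
    exact hS4 (fun q => q.2 ^ ((σ i : ℕ) + i)) fun t ht =>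
      Eventually.of_forall fun q => by fun_prop
  refine ⟨r, hr, s, fun z => (powerSumHankel (S z) m).det, hδhol, ?_, ?_⟩
  · intro h
    obtain ⟨z, ⟨h1, h2⟩, h3⟩ := ((hm1.and_eventually hm2).and_eventually h).exists
    exact det_powerSumHankel_ne_zero (le_antisymm h2 h1) h3
  filter_upwards [hS1.eventually_nhds, hS2, hDs, hm2.eventually_nhds, hhol',
    hδhol.eventually] with z h1 h2 h3 h4 h5 h6
  refine ⟨⟨(S z).toFinset, h3, fun t ht hgt =>
    Multiset.mem_toFinset.2 ((h1.self_of_nhds t).2 ⟨ball_subset_closedBall ht, hgt⟩)⟩, ?_⟩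
  intro hδ t₁ ht₁ hgt₁
  -- Where the determinant is nonzero there are at least `m` distinct zeros, hence exactly `m`, and
  -- this persists nearby.
  have hDm : ∀ᶠ x in 𝓝 z, D x = m := by
    filter_upwards [h4, h6.continuousAt.eventually_ne hδ] with x hx1 hx2
    exact le_antisymm hx1 (not_lt.1 fun h => hx2 (det_powerSumHankel_eq_zero h))
  have hmemR : ∀ t, t ∈ (S z).toFinset ↔ t ∈ closedBall t₀ r ∧ g (z, t) = 0 := fun t => by
    rw [Multiset.mem_toFinset, h1.self_of_nhds t]
  have hRball : ∀ a ∈ (S z).toFinset, a ∈ ball t₀ r := fun a ha => h2 a (Multiset.mem_toFinset.1 ha)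
  obtain ⟨ρ, hρ, hρ1, hρ2⟩ : ∃ ρ > 0, (∀ a ∈ (S z).toFinset, closedBall a ρ ⊆ ball t₀ r) ∧
      ∀ a ∈ (S z).toFinset, ∀ b ∈ (S z).toFinset, a ≠ b → Disjoint (closedBall a ρ) (closedBall b ρ) := by
    have e1 : ∀ᶠ ρ in 𝓝[>] (0 : ℝ), ∀ a ∈ (S z).toFinset, closedBall a ρ ⊆ ball t₀ r := by
      refine (Finset.eventually_all _).2 fun a ha => ?_
      have hpos : 0 < r - dist a t₀ := sub_pos.2 (hRball a ha)
      filter_upwards [Ioo_mem_nhdsGT hpos] with ρ hρ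
      refine closedBall_subset_ball' ?_
      linarith [hρ.2]
    have e2 : ∀ᶠ ρ in 𝓝[>] (0 : ℝ), ∀ a ∈ (S z).toFinset, ∀ b ∈ (S z).toFinset, a ≠ b →
        Disjoint (closedBall a ρ) (closedBall b ρ) := by
      refine (Finset.eventually_all _).2 fun a ha => (Finset.eventually_all _).2 fun b hb => ?_
      by_cases hab : a = b
      · exact Eventually.of_forall fun _ h => absurd hab h
      · have hpos : 0 < dist a b / 2 := half_pos (dist_pos.2 hab)
        filter_upwards [Ioo_mem_nhdsGT hpos] with ρ hρ _
        refine closedBall_disjoint_closedBall ?_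
        linarith [hρ.2]
    obtain ⟨ρ, ⟨h1, h2⟩, h3⟩ := ((e1.and e2).and self_mem_nhdsWithin).exists
    exact ⟨ρ, h3, h1, h2⟩
  have hfam := fun a (ha : a ∈ (S z).toFinset) => exists_zeros_family (f := g) (y₀ := z) hρ
    (fun t ht => h5 t (ball_subset_closedBall (hρ1 a ha ht))) (by
      intro t ht h0
      have htR : t ∈ (S z).toFinset :=
        (hmemR t).2 ⟨ball_subset_closedBall (hρ1 a ha (sphere_subset_closedBall ht)), h0⟩
      have hta : a ≠ t := by
        rintro rfl
        simp at ht
        exact hρ.ne ht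
      exact Set.disjoint_left.1 (hρ2 a ha t htR hta) (sphere_subset_closedBall ht)
        (mem_closedBall_self hρ.le))
  have hroot : ∀ᶠ x in 𝓝 z, ∀ a ∈ (S z).toFinset, ∃ t ∈ closedBall a ρ, g (x, t) = 0 := by
    refine (Finset.eventually_all _).2 fun a ha => ?_
    obtain ⟨Sa, ha1, -, ha3, -⟩ := hfam a ha
    have hpos : 0 < (Sa z).card := Multiset.card_pos_iff_exists_mem.2
      ⟨a, (ha1.self_of_nhds a).2 ⟨mem_closedBall_self hρ.le, ((hmemR a).1 ha).2⟩⟩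
    filter_upwards [ha1, ha3] with x hx1 hx3
    rw [← hx3] at hpos
    obtain ⟨t, ht⟩ := Multiset.card_pos_iff_exists_mem.1 hpos
    exact ⟨t, (hx1 t).1 ht⟩
  have ht₁R : t₁ ∈ (S z).toFinset := (hmemR t₁).2 ⟨ball_subset_closedBall ht₁, hgt₁⟩
  -- Each of the `m` disjoint discs contains a zero over `x` and there are only `m` distinct zeros,
  -- so each disc contains exactly one.
  have huniq : ∀ᶠ x in 𝓝 z, ∀ t ∈ closedBall t₁ ρ, ∀ t' ∈ closedBall t₁ ρ,
      g (x, t) = 0 → g (x, t') = 0 → t = t' := by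
    filter_upwards [hroot, hDm, h1] with x hx1 hx2 hx3 t ht t' ht' hgt hgt'
    have hDz : (S z).toFinset.card = m := hDm.self_of_nhds
    -- `ψ` sends a point to the centre of its disc; the default `t₁` only serves to keep its values
    -- in the fibre over `z`.
    set ψ : ℂ → ℂ := fun t => if h : ∃ a ∈ (S z).toFinset, t ∈ closedBall a ρ then h.choose else t₁
    have hψ : ∀ a ∈ (S z).toFinset, ∀ t ∈ closedBall a ρ, ψ t = a := by
      intro a ha t ht
      have hex : ∃ a ∈ (S z).toFinset, t ∈ closedBall a ρ := ⟨a, ha, ht⟩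
      have hs := hex.choose_spec
      simp only [ψ, dif_pos hex]
      by_contra hne
      exact Set.disjoint_left.1 (hρ2 _ hs.1 a ha hne) hs.2 ht
    have hmaps : ∀ t ∈ (S x).toFinset, ψ t ∈ (S z).toFinset := by
      intro t _
      by_cases hex : ∃ a ∈ (S z).toFinset, t ∈ closedBall a ρ
      · obtain ⟨a, ha, ht⟩ := hex
        rw [hψ a ha t ht]; exact ha
      · simp only [ψ, dif_neg hex]; exact ht₁R
    have hmem : ∀ a ∈ (S z).toFinset, ∀ t ∈ closedBall a ρ, g (x, t) = 0 → t ∈ (S x).toFinset :=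
      fun a ha t ht h0 =>
        Multiset.mem_toFinset.2 ((hx3 t).2 ⟨ball_subset_closedBall (hρ1 a ha ht), h0⟩)
    have hsurj : Set.SurjOn ψ (S x).toFinset (S z).toFinset := by
      intro a ha
      obtain ⟨t, ht, h0⟩ := hx1 a ha
      exact ⟨t, hmem a ha t ht h0, hψ a ha t ht⟩
    have hinj := Finset.injOn_of_surjOn_of_card_le ψ hmaps hsurj (by
      have : (S x).toFinset.card = m := hx2
      omega)
    exact hinj (hmem t₁ ht₁R t ht hgt) (hmem t₁ ht₁R t' ht' hgt')
      (by rw [hψ t₁ ht₁R t ht, hψ t₁ ht₁R t' ht'])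
  obtain ⟨Sa, ha1, -, ha3, ha4⟩ := hfam t₁ ht₁R
  have hpos : 0 < (Sa z).card := Multiset.card_pos_iff_exists_mem.2
    ⟨t₁, (ha1.self_of_nhds t₁).2 ⟨mem_closedBall_self hρ.le, hgt₁⟩⟩
  -- The zeros in the disc around `t₁` all coincide, so the branch is their mean, a holomorphic
  -- symmetric function.
  have hval : ∀ᶠ x in 𝓝 z, ∀ t ∈ closedBall t₁ ρ, g (x, t) = 0 →
      ((Sa z).card : ℂ)⁻¹ * ((Sa x).map fun a => a).sum = t := by
    filter_upwards [huniq, ha1, ha3] with x hx1 hx2 hx3 t ht hgt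
    have hall : ∀ b ∈ Sa x, b = t := fun b hb =>
      hx1 b ((hx2 b).1 hb).1 t ht ((hx2 b).1 hb).2 hgt
    rw [Multiset.map_id', Multiset.eq_replicate_card.2 hall, Multiset.sum_replicate, hx3,
      nsmul_eq_mul, ← mul_assoc, inv_mul_cancel₀ (by exact_mod_cast hpos.ne'), one_mul]
  refine ⟨fun x => ((Sa z).card : ℂ)⁻¹ * ((Sa x).map fun a => a).sum, ?_, ?_, ?_⟩
  · exact (holAt_const _ _).mul (ha4 (fun q => q.2) fun t _ =>
      Eventually.of_forall fun q => by fun_prop)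
  · exact hval.self_of_nhds t₁ (mem_closedBall_self hρ.le) hgt₁
  · rw [nhds_prod_eq]
    filter_upwards [hval.prod_mk (closedBall_mem_nhds t₁ hρ)] with q hq h0
    exact (hq.1 q.2 hq.2 h0).symm

/-- Away from a proper analytic subset of the base, the points of an analytic germ with isolated
fibre lie locally on graphs of holomorphic maps. -/
theorem exists_branch_locus {k n : ℕ} {f : Fin n → P × (Fin k → ℂ) → ℂ} {z₀ : P}
    {w₀ : Fin k → ℂ} (hf : ∀ i, HolAt (f i) (z₀, w₀))
    (hiso : ∀ᶠ w in 𝓝 w₀, (∀ i, f i (z₀, w) = 0) → w = w₀) :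
    ∃ U : Set (Fin k → ℂ), IsOpen U ∧ w₀ ∈ U ∧ ∃ (M : ℕ) (δ : P → ℂ), HolAt δ z₀ ∧
      (¬ ∀ᶠ z in 𝓝 z₀, δ z = 0) ∧
      ∀ᶠ z in 𝓝 z₀, {w ∈ U | ∀ i, f i (z, w) = 0}.encard ≤ M ∧
        (δ z ≠ 0 → ∀ w₁ ∈ U, (∀ i, f i (z, w₁) = 0) → ∃ h : P → Fin k → ℂ,
          (∀ᶠ x in 𝓝 z, DifferentiableAt ℂ h x) ∧ h z = w₁ ∧
          ∀ᶠ q in 𝓝 (z, w₁), (∀ i, f i q = 0) → q.2 = h q.1) := by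
  classical
  choose g hg hgn U hU hUg using exists_coordinate_equation hf hiso
  choose r hr M δ hδ hδn hδz using fun j => exists_branch_locus_one (hg j) (hgn j)
  have hint : ∀ j, interior (U j) ∈ 𝓝 w₀ := fun j => interior_mem_nhds.2 (hU j)
  set W : Set (Fin k → ℂ) := {w | ∀ j, w ∈ interior (U j) ∧ w j ∈ ball (w₀ j) (r j)} with hW
  have hWo : IsOpen W := by
    have : W = ⋂ j, interior (U j) ∩ (fun w : Fin k → ℂ => w j) ⁻¹' ball (w₀ j) (r j) := by
      ext w; simp [hW]
    rw [this]
    exact isOpen_iInter_of_finite fun j =>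
      isOpen_interior.inter (isOpen_ball.preimage (continuous_apply j))
  refine ⟨W, hWo, fun j => ⟨mem_of_mem_nhds (hint j), mem_ball_self (hr j)⟩, ∏ j, M j,
    fun z => ∏ j, δ j z, HolAt.prod fun j _ => hδ j,
    HolAt.not_eventually_prod_eq_zero (fun j _ => hδ j) (fun j _ => hδn j), ?_⟩
  filter_upwards [eventually_all.2 hδz, (eventually_all.2 hUg).eventually_nhds] with z h1 h2
  have h3 := h2.self_of_nhds
  refine ⟨?_, ?_⟩
  · choose R hR hRt using fun j => (h1 j).1
    have hsub : {w ∈ W | ∀ i, f i (z, w) = 0} ⊆ (Fintype.piFinset R : Set (Fin k → ℂ)) := by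
      intro w hw
      rw [Finset.mem_coe, Fintype.mem_piFinset]
      intro j
      exact hRt j _ (hw.1 j).2 (h3 j w (interior_subset (hw.1 j).1) hw.2)
    refine (encard_le_encard hsub).trans ?_
    rw [encard_coe_eq_coe_finsetCard, Fintype.card_piFinset]
    exact_mod_cast Finset.prod_le_prod' fun j _ => hR j
  · intro hδz₁ w₁ hw₁ hfw₁
    have hδj : ∀ j, δ j z ≠ 0 := fun j => Finset.prod_ne_zero_iff.1 hδz₁ j (Finset.mem_univ j)
    -- A branch for the point is assembled from branches for its coordinates, all of which exist
    -- since the product of the `δ j` is nonzero.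
    choose h hh hhz hhq using fun j => (h1 j).2 (hδj j) (w₁ j) (hw₁ j).2
      (h3 j w₁ (interior_subset (hw₁ j).1) hfw₁)
    refine ⟨fun x j => h j x, ?_, funext hhz, ?_⟩
    · filter_upwards [eventually_all.2 hh] with x hx
      exact differentiableAt_pi.2 hx
    · have e1 : ∀ᶠ q in 𝓝 (z, w₁), ∀ j, g j (q.1, q.2 j) = 0 → q.2 j = h j q.1 := by
        refine eventually_all.2 fun j => ?_
        have hc : ContinuousAt (fun q : P × (Fin k → ℂ) => (q.1, q.2 j)) (z, w₁) :=
          (continuous_fst.prodMk ((continuous_apply j).comp continuous_snd)).continuousAt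
        exact hc.eventually (hhq j)
      have e2 : ∀ᶠ q in 𝓝 (z, w₁), q.2 ∈ W := continuousAt_snd.eventually (hWo.mem_nhds hw₁)
      have e3 : ∀ᶠ q in 𝓝 (z, w₁), ∀ j, ∀ w ∈ U j, (∀ i, f i (q.1, w) = 0) → g j (q.1, w j) = 0 :=
        (continuousAt_fst (p := (z, w₁))).eventually h2
      filter_upwards [e1, e2, e3] with q hq1 hq2 hq3 hq0
      funext j
      exact hq1 j (hq3 j q.2 (interior_subset (hq2 j).1) hq0)

end Branches

/-! ### Connectedness of the complement of a zero set. -/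

section Connected

variable {V : Type*} [NormedAddCommGroup V] [NormedSpace ℂ V]

/-- The arcs `τ + i s τ (1 - τ)` are disjoint for different `s` except at their ends, and `f` has
countably many zeros, so arbitrarily small `s` avoid all of them. -/
theorem exists_ne_zero_path {f : ℂ → ℂ} {C : Set ℂ} (hC : IsOpen C) (hconv : Convex ℝ C)
    (hf : AnalyticOnNhd ℂ f C) (h0 : (0 : ℂ) ∈ C) (h1 : (1 : ℂ) ∈ C) (hf0 : f 0 ≠ 0)
    (hf1 : f 1 ≠ 0) :
    ∃ γ : ℝ → ℂ, Continuous γ ∧ γ 0 = 0 ∧ γ 1 = 1 ∧ ∀ τ ∈ Icc (0 : ℝ) 1, γ τ ∈ C ∧ f (γ τ) ≠ 0 := by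
  have hZ : {ζ | ζ ∈ C ∧ f ζ = 0}.Countable := by
    rcases hf.eqOn_zero_or_eventually_ne_zero_of_preconnected hconv.isPreconnected with h | h
    · exact absurd (h h0) hf0
    · have : ({ζ | f ζ = 0} ∩ C).Countable :=
        (HereditarilyLindelofSpace.isLindelof _).countable_of_isDiscrete
          (isDiscrete_of_codiscreteWithin (s := {ζ | f ζ = 0}) (U := C) h)
      exact this.mono (fun ζ hζ => And.intro hζ.2 hζ.1)
  set γ : ℝ → ℝ → ℂ := fun s τ => τ + (s * (τ * (1 - τ)) : ℝ) * Complex.I with hγ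
  have hre : ∀ s τ, (γ s τ).re = τ := by intro s τ; simp [hγ]
  have him : ∀ s τ, (γ s τ).im = s * (τ * (1 - τ)) := by intro s τ; simp [hγ]
  have hev : ∀ᶠ s in 𝓝 (0 : ℝ), ∀ τ ∈ Icc (0 : ℝ) 1, γ s τ ∈ C := by
    refine isCompact_Icc.eventually_forall_of_forall_eventually fun τ hτ => ?_
    have hc : Continuous fun q : ℝ × ℝ => γ q.1 q.2 := by simp only [hγ]; fun_prop
    refine hc.continuousAt.eventually (hC.mem_nhds ?_)
    have := hconv h0 h1 (sub_nonneg.2 hτ.2) hτ.1 (by ring)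
    simpa [hγ] using this
  -- The parameter `s` of the arc through `ζ` is recovered as `ζ.im / (ζ.re * (1 - ζ.re))`.
  set bad : Set ℝ := (fun ζ : ℂ => ζ.im / (ζ.re * (1 - ζ.re))) '' {ζ | ζ ∈ C ∧ f ζ = 0} with hbad
  have hd : Dense badᶜ := (hZ.image _).dense_compl ℝ
  obtain ⟨s, hsbad, hs⟩ : ∃ s, s ∈ badᶜ ∧ ∀ τ ∈ Icc (0 : ℝ) 1, γ s τ ∈ C := by
    obtain ⟨s, h1, h2⟩ := hd.inter_nhds_nonempty hev
    exact ⟨s, h1, h2⟩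
  have e0 : γ s 0 = 0 := by simp [hγ]
  have e1 : γ s 1 = 1 := by simp [hγ]
  refine ⟨γ s, by simp only [hγ]; fun_prop, e0, e1, fun τ hτ => ⟨hs τ hτ, fun hz => ?_⟩⟩
  rcases eq_or_ne τ 0 with rfl | hτ0
  · exact hf0 (e0 ▸ hz)
  rcases eq_or_ne τ 1 with rfl | hτ1
  · exact hf1 (e1 ▸ hz)
  refine hsbad ⟨γ s τ, ⟨hs τ hτ, hz⟩, ?_⟩
  have : τ * (1 - τ) ≠ 0 := mul_ne_zero hτ0 (sub_ne_zero.2 hτ1.symm)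
  beta_reduce
  rw [hre, him]
  field_simp

/-- The complement of the zero set of a holomorphic function in a ball is connected. -/
theorem isPreconnected_ball_inter_ne_zero {f : V → ℂ} {p : V} {ε : ℝ}
    (hf : ∀ q ∈ Metric.ball p ε, DifferentiableAt ℂ f q) :
    IsPreconnected {x ∈ Metric.ball p ε | f x ≠ 0} := by
  let _ : NormedSpace ℝ V := NormedSpace.restrictScalars ℝ ℂ V
  refine isPreconnected_of_forall_pair fun x hx y hy => ?_
  have hc : Continuous fun ζ : ℂ => x + ζ • (y - x) := by fun_prop
  obtain ⟨γ, hγ, h0, h1, hγC⟩ := exists_ne_zero_path (f := fun ζ => f (x + ζ • (y - x)))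
    (Metric.isOpen_ball.preimage hc) (convex_line_preimage (convex_ball p ε) x (y - x))
    (analyticOnNhd_line Metric.isOpen_ball hf x (y - x)) (by simpa using hx.1)
    (by simpa using hy.1) (by simpa using hx.2) (by simpa using hy.2)
  refine ⟨(fun τ => x + γ τ • (y - x)) '' Icc 0 1, ?_, ⟨0, by simp, by simp [h0]⟩,
    ⟨1, by simp, by simp [h1]⟩, isPreconnected_Icc.image _ (by fun_prop)⟩
  rintro _ ⟨τ, hτ, rfl⟩
  exact hγC τ hτ

theorem ball_subset_closure_ne_zero {f : V → ℂ} {p : V} {ε : ℝ} (hε : 0 < ε)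
    (hf : ∀ q ∈ Metric.ball p ε, DifferentiableAt ℂ f q) (h0 : ¬ ∀ᶠ q in 𝓝 p, f q = 0) :
    Metric.ball p ε ⊆ closure {x ∈ Metric.ball p ε | f x ≠ 0} := by
  intro x hx
  by_contra hcl
  refine h0 (Metric.eventually_nhds_iff_ball.2 ⟨ε, hε, eqOn_zero_of_eventually_zero hf hx ?_⟩)
  have : (closure {x ∈ Metric.ball p ε | f x ≠ 0})ᶜ ∈ 𝓝 x := isClosed_closure.isOpen_compl.mem_nhds hcl
  filter_upwards [this, Metric.isOpen_ball.mem_nhds hx] with y hy hyb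
  by_contra hne
  exact hy (subset_closure ⟨hyb, hne⟩)

end Connected

/-! ### Analytic subsets in charts, and their regular points. -/

section AnalyticSubsets

variable {E : Type*} [NormedAddCommGroup E] [NormedSpace ℂ E] {X : Type*} [TopologicalSpace X]
  [ChartedSpace E X]

theorem IsAnalyticSubset.isClosed {H : Type*} [TopologicalSpace H] {I : ModelWithCorners ℂ E H}
    {M : Type*} [TopologicalSpace M]
    [ChartedSpace H M] {A : Set M} (hA : IsAnalyticSubset I A) : IsClosed A := by
  rw [← isOpen_compl_iff, isOpen_iff_mem_nhds]
  intro p hp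
  obtain ⟨U, hU, hpU, n, f, hf, hfA⟩ := hA p
  have : ∃ i, f i p ≠ 0 := by
    by_contra! h
    exact hp ((hfA p hpU).2 h)
  obtain ⟨i, hi⟩ := this
  have hc : ContinuousAt (f i) p := (hf i).continuousOn.continuousAt (hU.mem_nhds hpU)
  filter_upwards [hc.eventually_ne hi, hU.mem_nhds hpU] with q hq hqU hqA
  exact hq ((hfA q hqU).1 hqA i)

variable [IsManifold 𝓘(ℂ, E) ω X]

/-- The equations of an analytic subset of `X × X` in a pair of charts. -/
theorem IsAnalyticSubset.exists_local_equations {A : Set (X × X)}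
    (hA : IsAnalyticSubset (𝓘(ℂ, E).prod 𝓘(ℂ, E)) A) (w₀ z₀ : X) :
    ∃ (n : ℕ) (F : Fin n → E × E → ℂ),
      (∀ i, HolAt (F i) (chartAt E z₀ z₀, chartAt E w₀ w₀)) ∧
      ∀ᶠ q in 𝓝 (chartAt E z₀ z₀, chartAt E w₀ w₀),
        ((chartAt E w₀).symm q.2, (chartAt E z₀).symm q.1) ∈ A ↔ ∀ i, F i q = 0 := by
  obtain ⟨U, hU, hpU, n, f, hf, hfA⟩ := hA (w₀, z₀)
  set G : E × E → X × X := fun q => ((chartAt E w₀).symm q.2, (chartAt E z₀).symm q.1) with hG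
  set T : Set (E × E) := (chartAt E z₀).target ×ˢ (chartAt E w₀).target with hT
  have hTo : IsOpen T := (chartAt E z₀).open_target.prod (chartAt E w₀).open_target
  have hGs : ContMDiffOn 𝓘(ℂ, E × E) (𝓘(ℂ, E).prod 𝓘(ℂ, E)) ω G T := by
    refine ContMDiffOn.prodMk ?_ ?_
    · exact (contMDiffOn_chart_symm (I := 𝓘(ℂ, E)) (n := ω) (x := w₀)).comp
        contDiff_snd.contMDiff.contMDiffOn (fun q hq => hq.2)
    · exact (contMDiffOn_chart_symm (I := 𝓘(ℂ, E)) (n := ω) (x := z₀)).comp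
        contDiff_fst.contMDiff.contMDiffOn (fun q hq => hq.1)
  have hTU : IsOpen (T ∩ G ⁻¹' U) := hGs.continuousOn.isOpen_inter_preimage hTo hU
  have hmem : (chartAt E z₀ z₀, chartAt E w₀ w₀) ∈ T ∩ G ⁻¹' U := by
    refine ⟨⟨mem_chart_target _ _, mem_chart_target _ _⟩, ?_⟩
    simp only [hG, mem_preimage]
    rwa [(chartAt E w₀).left_inv (mem_chart_source _ _),
      (chartAt E z₀).left_inv (mem_chart_source _ _)]
  refine ⟨n, fun i q => f i (G q), fun i => ?_, ?_⟩
  · filter_upwards [hTU.mem_nhds hmem] with q hq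
    have h1 : ContMDiffOn 𝓘(ℂ, E × E) 𝓘(ℂ, ℂ) ω (fun q => f i (G q)) (T ∩ G ⁻¹' U) :=
      (hf i).comp (hGs.mono inter_subset_left) (fun q hq => hq.2)
    have h2 := contMDiffOn_iff_contDiffOn.1 h1
    exact (h2.contDiffAt (hTU.mem_nhds hq)).differentiableAt (by simp)
  · filter_upwards [hTU.mem_nhds hmem] with q hq
    exact hfA _ hq.2

/-- Near a regular point, an analytic set of dimension `k` that lies on the graph of a holomorphic
map is equal to this graph. -/
theorem IsRegularPointOfDim.eventually_mem_of_graph [FiniteDimensional ℂ E] {A : Set (X × X)}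
    {p : X × X}
    (hp : IsRegularPointOfDim (𝓘(ℂ, E).prod 𝓘(ℂ, E)) A (Module.finrank ℂ E) p) {w₀ z₀ : X}
    (hw : p.1 ∈ (chartAt E w₀).source) (hz : p.2 ∈ (chartAt E z₀).source) {h : E → E}
    (hh : DifferentiableAt ℂ h (chartAt E z₀ p.2))
    (hA : ∀ᶠ q in 𝓝 p, q ∈ A → chartAt E w₀ q.1 = h (chartAt E z₀ q.2)) :
    ∀ᶠ z in 𝓝 (chartAt E z₀ p.2), ((chartAt E w₀).symm (h z), (chartAt E z₀).symm z) ∈ A := by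
  obtain ⟨hpA, e₁, he, hpe, L, hL, heL⟩ := hp
  set cw := chartAt E w₀
  set cz := chartAt E z₀
  obtain ⟨e, rfl⟩ : ∃ e : OpenPartialHomeomorph (X × X) (E × E), e = e₁ := ⟨e₁, rfl⟩
  have h1 : ContMDiffOn 𝓘(ℂ, E × E) (𝓘(ℂ, E).prod 𝓘(ℂ, E)) ω e.symm e.target := by
    have := contMDiffOn_symm_of_mem_maximalAtlas he
    rw [modelWithCornersSelf_prod]
    exact this
  have h2 : ContMDiffOn (𝓘(ℂ, E).prod 𝓘(ℂ, E)) 𝓘(ℂ, E × E) ω e e.source := by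
    have := contMDiffOn_of_mem_maximalAtlas he
    rw [modelWithCornersSelf_prod]
    exact this
  set x₀ : E × E := e p with hx₀
  have hx₀t : x₀ ∈ e.target := e.map_source hpe
  have hsymm₀ : e.symm x₀ = p := e.left_inv hpe
  -- The factors are swapped, so that the base variable comes first in the chart coordinates.
  set Φ : X × X → E × E := fun q => (cz q.2, cw q.1) with hΦ
  set Ψ : E × E → X × X := fun q => (cw.symm q.2, cz.symm q.1) with hΨ
  have hΦs : ContMDiffOn (𝓘(ℂ, E).prod 𝓘(ℂ, E)) 𝓘(ℂ, E × E) ω Φ (cw.source ×ˢ cz.source) := by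
    rw [modelWithCornersSelf_prod, ← chartedSpaceSelf_prod]
    refine ContMDiffOn.prodMk ?_ ?_
    · exact (contMDiffOn_chart (I := 𝓘(ℂ, E)) (n := ω) (x := z₀)).comp
        contMDiff_snd.contMDiffOn (fun q hq => hq.2)
    · exact (contMDiffOn_chart (I := 𝓘(ℂ, E)) (n := ω) (x := w₀)).comp
        contMDiff_fst.contMDiffOn (fun q hq => hq.1)
  have hΨs : ContMDiffOn 𝓘(ℂ, E × E) (𝓘(ℂ, E).prod 𝓘(ℂ, E)) ω Ψ (cz.target ×ˢ cw.target) := by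
    refine ContMDiffOn.prodMk ?_ ?_
    · exact (contMDiffOn_chart_symm (I := 𝓘(ℂ, E)) (n := ω) (x := w₀)).comp
        contDiff_snd.contMDiff.contMDiffOn (fun q hq => hq.2)
    · exact (contMDiffOn_chart_symm (I := 𝓘(ℂ, E)) (n := ω) (x := z₀)).comp
        contDiff_fst.contMDiff.contMDiffOn (fun q hq => hq.1)
  have hS : IsOpen (cw.source ×ˢ cz.source) := cw.open_source.prod cz.open_source
  have hT : IsOpen (cz.target ×ˢ cw.target) := cz.open_target.prod cw.open_target
  have hsymmc : ContinuousAt e.symm x₀ :=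
    h1.continuousOn.continuousAt (e.open_target.mem_nhds hx₀t)
  have hpS : p ∈ cw.source ×ˢ cz.source := ⟨hw, hz⟩
  have hΨΦ : ∀ q ∈ cw.source ×ˢ cz.source, Ψ (Φ q) = q := fun q hq =>
    Prod.ext (cw.left_inv hq.1) (cz.left_inv hq.2)
  set γ : E × E → E × E := fun x => Φ (e.symm x) with hγ
  have hγs : ContDiffAt ℂ ω γ x₀ := by
    have hm : ContMDiffAt 𝓘(ℂ, E × E) 𝓘(ℂ, E × E) ω γ x₀ := by
      refine ContMDiffAt.comp (g := Φ) (f := e.symm) (I' := 𝓘(ℂ, E).prod 𝓘(ℂ, E)) x₀ ?_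
        (h1.contMDiffAt (e.open_target.mem_nhds hx₀t))
      rw [hsymm₀]
      exact hΦs.contMDiffAt (hS.mem_nhds hpS)
    exact hm.contDiffAt
  have hηs : ContDiffAt ℂ ω (fun y => e (Ψ y)) (γ x₀) := by
    have hΨp : Ψ (γ x₀) = p := by simp only [hγ, hsymm₀]; exact hΨΦ p hpS
    have hm : ContMDiffAt 𝓘(ℂ, E × E) 𝓘(ℂ, E × E) ω (fun y => e (Ψ y)) (γ x₀) := by
      refine ContMDiffAt.comp (g := e) (f := Ψ) (I' := 𝓘(ℂ, E).prod 𝓘(ℂ, E)) (γ x₀) ?_ (hΨs.contMDiffAt (hT.mem_nhds ?_))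
      · rw [hΨp]
        exact h2.contMDiffAt (e.open_source.mem_nhds hpe)
      · simp only [hγ, hsymm₀]
        exact ⟨cz.map_source hz, cw.map_source hw⟩
    exact hm.contDiffAt
  have hγd := hγs.hasStrictFDerivAt (n := ω) (by simp)
  have hηd := (hηs.differentiableAt (by simp)).hasFDerivAt
  set γ' := fderiv ℂ γ x₀
  set η' := fderiv ℂ (fun y => e (Ψ y)) (γ x₀)
  have hevS : ∀ᶠ x in 𝓝 x₀, e.symm x ∈ cw.source ×ˢ cz.source :=
    hsymmc.eventually (by rw [hsymm₀]; exact hS.mem_nhds hpS)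
  have hid : ∀ v, η' (γ' v) = v := by
    have hc := hηd.comp x₀ hγd.hasFDerivAt
    have hid : HasFDerivAt ((fun y => e (Ψ y)) ∘ γ) (ContinuousLinearMap.id ℂ (E × E)) x₀ := by
      refine (hasFDerivAt_id x₀).congr_of_eventuallyEq ?_
      filter_upwards [hevS, e.open_target.mem_nhds hx₀t] with x hx hxt
      simp only [Function.comp, hγ]
      rw [hΨΦ _ hx]
      exact e.right_inv hxt
    intro v
    exact DFunLike.congr_fun (hc.unique hid) v
  have hx₀L : x₀ ∈ L := (heL p hpe).1 hpA
  set xL : L := ⟨x₀, hx₀L⟩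
  have hsub : HasStrictFDerivAt (fun x : L => (x : E × E)) L.subtypeL xL :=
    L.subtypeL.hasStrictFDerivAt
  have hγL : HasStrictFDerivAt (fun x : L => γ x) (γ' ∘SL L.subtypeL) xL :=
    HasStrictFDerivAt.comp xL hγd hsub
  have hψ : HasStrictFDerivAt (fun x : L => (γ x).1)
      (ContinuousLinearMap.fst ℂ E E ∘SL (γ' ∘SL L.subtypeL)) xL := hγL.fst
  have hψ2 : HasFDerivAt (fun x : L => (γ x).2)
      (ContinuousLinearMap.snd ℂ E E ∘SL (γ' ∘SL L.subtypeL)) xL := hγL.snd.hasFDerivAt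
  have hψx : (γ xL).1 = cz p.2 := by simp only [hγ, xL, hsymm₀, hΦ]
  have hcL : ContinuousAt (fun x : L => (x : E × E)) xL := continuous_subtype_val.continuousAt
  have hgraph : ∀ᶠ x : L in 𝓝 xL, e.symm (x : E × E) ∈ A ∧ (γ x).2 = h (γ x).1 := by
    have e1 : ∀ᶠ x in 𝓝 x₀, e.symm x ∈ A → cw (e.symm x).1 = h (cz (e.symm x).2) :=
      hsymmc.eventually (by rw [hsymm₀]; exact hA)
    filter_upwards [hcL.eventually e1, hcL.eventually (e.open_target.mem_nhds hx₀t)] with x hx hxt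
    have hxA : e.symm (x : E × E) ∈ A := by
      refine (heL _ (e.map_target hxt)).2 ?_
      rw [e.right_inv hxt]
      exact x.2
    exact ⟨hxA, hx hxA⟩
  -- A tangent vector of `A` with zero base component has zero fibre component too, because `A` lies
  -- on the graph of `h`; and `γ'` has the left inverse `η'`.
  have hinj : Function.Injective (ContinuousLinearMap.fst ℂ E E ∘SL (γ' ∘SL L.subtypeL)) := by
    rw [injective_iff_map_eq_zero]
    intro v hv
    have hh' : HasFDerivAt h (fderiv ℂ h (γ xL).1) (γ xL).1 := by
      rw [hψx]; exact hh.hasFDerivAt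
    have hc := HasFDerivAt.comp xL hh' hψ.hasFDerivAt
    have heq : (fun x : L => (γ x).2) =ᶠ[𝓝 xL] h ∘ fun x : L => (γ x).1 := by
      filter_upwards [hgraph] with x hx using hx.2
    have hu := hψ2.unique (hc.congr_of_eventuallyEq heq)
    have hv2 := DFunLike.congr_fun hu v
    rw [ContinuousLinearMap.comp_apply (fderiv ℂ h (γ xL).1), hv, map_zero] at hv2
    have hγv : γ' v = 0 := Prod.ext hv hv2
    have := hid v
    rw [hγv, map_zero] at this
    exact Subtype.ext this.symm
  -- Here the dimension enters: `L` and `E` have equal dimension, so the projection of `A` to the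
  -- base is a local surjection.
  have hsurj : Function.Surjective (ContinuousLinearMap.fst ℂ E E ∘SL (γ' ∘SL L.subtypeL)) :=
    (LinearMap.injective_iff_surjective_of_finrank_eq_finrank
      (f := (ContinuousLinearMap.fst ℂ E E ∘SL (γ' ∘SL L.subtypeL) : L →L[ℂ] E).toLinearMap) hL).1 hinj
  have hmap := hψ.map_nhds_eq_of_surj (LinearMap.range_eq_top.2 hsurj)
  rw [← hψx, ← hmap, eventually_map]
  filter_upwards [hgraph, hcL.eventually hevS] with x hx hxS
  rw [← hx.2]
  have : ((cw.symm (γ x).2, cz.symm (γ x).1) : X × X) = e.symm (x : E × E) := hΨΦ _ hxS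
  rw [this]
  exact hx.1

end AnalyticSubsets

/-! ### Finite correspondences as local graphs. -/

section LocalStructure

variable {E : Type*} [NormedAddCommGroup E] [NormedSpace ℂ E] [FiniteDimensional ℂ E]
  {X : Type*} [TopologicalSpace X] [ChartedSpace E X] [IsManifold 𝓘(ℂ, E) ω X]

/-- `A` is, near `(w, z)`, the graph of a map of the second variable that is continuous at `z`. -/
def IsGraphAt {X : Type*} [TopologicalSpace X] (A : Set (X × X)) (w z : X) : Prop :=
  ∃ h : X → X, ContinuousAt h z ∧ h z = w ∧ ∀ᶠ q in 𝓝 (w, z), q ∈ A ↔ q.1 = h q.2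

/-- The hypotheses place `A` inside the graph of `h`. Regular points of full dimension accumulate at
`(w, z)`, and near one of them `A` contains the graph. The functions `F i (y, h y)` then vanish on
an open set, hence on the whole ball, and `A` is the graph. -/
theorem isGraphAt_of_chart_graph {A : Set (X × X)}
    (hdim : ∀ p ∈ A, HasDimAt (𝓘(ℂ, E).prod 𝓘(ℂ, E)) A (Module.finrank ℂ E) p) {w₀ z₀ w z : X}
    (hw : w ∈ (chartAt E w₀).source) (hz : z ∈ (chartAt E z₀).source) (hwz : (w, z) ∈ A)
    {n : ℕ} {F : Fin n → E × E → ℂ}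
    (hF : ∀ᶠ q in 𝓝 (chartAt E z₀ z, chartAt E w₀ w), (∀ i, DifferentiableAt ℂ (F i) q) ∧
      (((chartAt E w₀).symm q.2, (chartAt E z₀).symm q.1) ∈ A ↔ ∀ i, F i q = 0))
    {h : E → E} (hh : ∀ᶠ y in 𝓝 (chartAt E z₀ z), DifferentiableAt ℂ h y)
    (hhz : h (chartAt E z₀ z) = chartAt E w₀ w)
    (hgr : ∀ᶠ q in 𝓝 (chartAt E z₀ z, chartAt E w₀ w), (∀ i, F i q = 0) → q.2 = h q.1) :
    IsGraphAt A w z := by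
  set cw := chartAt E w₀
  set cz := chartAt E z₀
  have hcz : ContinuousAt cz z := cz.continuousAt hz
  have hcw : ContinuousAt cw w := cw.continuousAt hw
  have hΦ : ContinuousAt (fun q : X × X => (cz q.2, cw q.1)) (w, z) :=
    (hcz.comp (x := (w, z)) continuousAt_snd).prodMk (hcw.comp (x := (w, z)) continuousAt_fst)
  have hsrc : ∀ᶠ q : X × X in 𝓝 (w, z), q.1 ∈ cw.source ∧ q.2 ∈ cz.source :=
    (continuousAt_fst.eventually (cw.open_source.mem_nhds hw)).and
      (continuousAt_snd.eventually (cz.open_source.mem_nhds hz))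
  have hAgr : ∀ᶠ q : X × X in 𝓝 (w, z), q ∈ A → cw q.1 = h (cz q.2) := by
    filter_upwards [hΦ.eventually hF, hΦ.eventually hgr, hsrc] with q h1 h2 h3 hqA
    refine h2 (h1.2.1 ?_)
    rwa [cw.left_inv h3.1, cz.left_inv h3.2]
  have hhc : ContinuousAt h (cz z) := hh.self_of_nhds.continuousAt
  have hpair : ContinuousAt (fun y => (y, h y)) (cz z) := continuousAt_id.prodMk hhc
  have hFh : ∀ᶠ y in 𝓝 (cz z), (∀ i, DifferentiableAt ℂ (F i) (y, h y)) ∧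
      ((cw.symm (h y), cz.symm y) ∈ A ↔ ∀ i, F i (y, h y) = 0) :=
    hpair.eventually (p := fun q => (∀ i, DifferentiableAt ℂ (F i) q) ∧
      ((cw.symm q.2, cz.symm q.1) ∈ A ↔ ∀ i, F i q = 0)) (by simp only [hhz]; exact hF)
  obtain ⟨ε, hε, hball⟩ := Metric.eventually_nhds_iff_ball.1 (hFh.and hh)
  have hd : ∀ i, ∀ y ∈ Metric.ball (cz z) ε, DifferentiableAt ℂ (fun y => F i (y, h y)) y :=
    fun i y hy => ((hball y hy).1.1 i).comp y (differentiableAt_id.prodMk (hball y hy).2)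
  have hvan : ∀ y ∈ Metric.ball (cz z) ε, ∀ i, F i (y, h y) = 0 := by
    have hbq : ∀ᶠ q : X × X in 𝓝 (w, z), cz q.2 ∈ Metric.ball (cz z) ε :=
      (hcz.comp (x := (w, z)) continuousAt_snd).eventually (Metric.ball_mem_nhds _ hε)
    obtain ⟨q, ⟨⟨hreg, hqb⟩, hqs⟩, hqA⟩ := (((hdim _ hwz).1.and_eventually hbq).and_eventually
      hsrc).and_eventually hAgr.eventually_nhds |>.exists
    have hev := hreg.eventually_mem_of_graph hqs.1 hqs.2 (hball _ hqb).2 hqA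
    intro y hy i
    refine eqOn_zero_of_eventually_zero (hd i) hqb ?_ y hy
    filter_upwards [hev, Metric.isOpen_ball.mem_nhds hqb] with x hx hxb
    exact (hball x hxb).1.2.1 hx i
  refine ⟨fun x => cw.symm (h (cz x)), ?_, ?_, ?_⟩
  · have h1 : ContinuousAt (fun x => h (cz x)) z := ContinuousAt.comp (g := h) hhc hcz
    refine ContinuousAt.comp (g := cw.symm) ?_ h1
    rw [hhz]
    exact cw.continuousAt_symm (cw.map_source hw)
  · simp only [hhz]
    exact cw.left_inv hw
  · have hbq : ∀ᶠ q : X × X in 𝓝 (w, z), cz q.2 ∈ Metric.ball (cz z) ε :=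
      (hcz.comp (x := (w, z)) continuousAt_snd).eventually (Metric.ball_mem_nhds _ hε)
    filter_upwards [hAgr, hsrc, hbq] with q h1 h2 h3
    constructor
    · intro hqA
      rw [← h1 hqA, cw.left_inv h2.1]
    · intro hq
      have := (hball _ h3).1.2.2 (hvan _ h3)
      rwa [← hq, cz.left_inv h2.2] at this

/-- Finiteness of the fibre isolates `w₀` in the slice over `z₀`, so `exists_branch_locus` applies
in charts; `isGraphAt_of_chart_graph` turns inclusion in a branch into equality. -/
theorem exists_local_branches [T2Space X] {A : Set (X × X)}
    (hA : IsAnalyticSubset (𝓘(ℂ, E).prod 𝓘(ℂ, E)) A)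
    (hdim : ∀ p ∈ A, HasDimAt (𝓘(ℂ, E).prod 𝓘(ℂ, E)) A (Module.finrank ℂ E) p)
    (hfin : ∀ z, {w | (w, z) ∈ A}.Finite) (w₀ z₀ : X) :
    ∃ U : Set X, IsOpen U ∧ w₀ ∈ U ∧ ∃ (M : ℕ) (δ : E → ℂ), HolAt δ (chartAt E z₀ z₀) ∧
      (¬ ∀ᶠ y in 𝓝 (chartAt E z₀ z₀), δ y = 0) ∧
      ∀ᶠ z in 𝓝 z₀, {w ∈ U | (w, z) ∈ A}.encard ≤ M ∧
        (δ (chartAt E z₀ z) ≠ 0 → ∀ w ∈ U, (w, z) ∈ A → IsGraphAt A w z) := by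
  obtain ⟨n, F, hF, hFA⟩ := hA.exists_local_equations w₀ z₀
  set cw := chartAt E w₀ with hcw
  set cz := chartAt E z₀ with hcz
  let φ : E ≃L[ℂ] (Fin (Module.finrank ℂ E) → ℂ) := ContinuousLinearEquiv.ofFinrankEq (by simp)
  have hw₀ : w₀ ∈ cw.source := mem_chart_source _ _
  have hz₀ : z₀ ∈ cz.source := mem_chart_source _ _
  have hall : ∀ᶠ q in 𝓝 (cz z₀, cw w₀), (∀ i, HolAt (F i) q) ∧
      ((cw.symm q.2, cz.symm q.1) ∈ A ↔ ∀ i, F i q = 0) :=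
    (eventually_all.2 fun i => (hF i).eventually).and hFA
  rw [nhds_prod_eq] at hall
  obtain ⟨Z, hZ, W, hW, hZW⟩ := Filter.mem_prod_iff.1 hall
  have hgood : ∀ y ∈ interior Z, ∀ x ∈ interior W, ∀ᶠ q in 𝓝 (y, x),
      (∀ i, DifferentiableAt ℂ (F i) q) ∧ ((cw.symm q.2, cz.symm q.1) ∈ A ↔ ∀ i, F i q = 0) := by
    intro y hy x hx
    have : interior Z ×ˢ interior W ∈ 𝓝 (y, x) :=
      (isOpen_interior.prod isOpen_interior).mem_nhds ⟨hy, hx⟩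
    filter_upwards [this] with q hq
    have h := hZW (show q ∈ Z ×ˢ W from ⟨interior_subset hq.1, interior_subset hq.2⟩)
    exact ⟨fun i => (h.1 i).differentiableAt, h.2⟩
  have hiso : ∀ᶠ x in 𝓝 (φ (cw w₀)), (∀ i, F i (cz z₀, φ.symm x) = 0) → x = φ (cw w₀) := by
    have h1 : ∀ᶠ w in 𝓝 w₀, (w, z₀) ∈ A → w = w₀ := by
      have hcl : IsClosed ({w | (w, z₀) ∈ A} \ {w₀}) := ((hfin z₀).subset sdiff_subset).isClosed
      filter_upwards [hcl.isOpen_compl.mem_nhds (fun h => h.2 rfl)] with w hw hwA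
      by_contra hne
      exact hw ⟨hwA, hne⟩
    have hc : ContinuousAt (fun x => cw.symm (φ.symm x)) (φ (cw w₀)) := by
      refine ContinuousAt.comp (g := cw.symm) ?_ φ.symm.continuous.continuousAt
      simp only [ContinuousLinearEquiv.symm_apply_apply]
      exact cw.continuousAt_symm (cw.map_source hw₀)
    have hcφ : ContinuousAt (fun x => φ.symm x) (φ (cw w₀)) := φ.symm.continuous.continuousAt
    have h2 : ∀ᶠ x in 𝓝 (φ (cw w₀)), φ.symm x ∈ cw.target ∩ W := by
      refine hcφ.eventually ?_
      simp only [φ.symm_apply_apply]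
      exact inter_mem (cw.open_target.mem_nhds (cw.map_source hw₀)) hW
    have h3 := hc.eventually (p := fun w => (w, z₀) ∈ A → w = w₀) (by
      simp only [φ.symm_apply_apply, cw.left_inv hw₀]; exact h1)
    filter_upwards [h3, h2] with x hx3 hx2 hx
    have hq := (hZW (show (cz z₀, φ.symm x) ∈ Z ×ˢ W from ⟨mem_of_mem_nhds hZ, hx2.2⟩)).2.2 hx
    simp only [cz.left_inv hz₀] at hq
    have := hx3 hq
    rw [← this, cw.right_inv hx2.1, φ.apply_symm_apply]
  obtain ⟨U', hU'o, hU'm, M, δ, hδ, hδn, hδz⟩ := exists_branch_locus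
    (f := fun i q => F i (q.1, φ.symm q.2)) (z₀ := cz z₀) (w₀ := φ (cw w₀)) (fun i => by
      refine HolAt.comp_differentiable (f := F i)
        (g := fun q : E × (Fin (Module.finrank ℂ E) → ℂ) => (q.1, φ.symm q.2)) ?_ ?_
      · simpa using hF i
      · exact differentiable_fst.prodMk (φ.symm.differentiable.comp differentiable_snd)) hiso
  refine ⟨cw.source ∩ cw ⁻¹' (interior W ∩ φ ⁻¹' U'),
    cw.isOpen_inter_preimage (isOpen_interior.inter (hU'o.preimage φ.continuous)),
    ⟨hw₀, mem_interior_iff_mem_nhds.2 hW, hU'm⟩, M, δ, hδ, hδn, ?_⟩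
  have hczc : ContinuousAt cz z₀ := cz.continuousAt hz₀
  filter_upwards [hczc.eventually hδz, hczc.eventually (interior_mem_nhds.2 hZ),
    cz.open_source.mem_nhds hz₀] with z h1 h2 h3
  have hzero : ∀ w ∈ cw.source ∩ cw ⁻¹' (interior W ∩ φ ⁻¹' U'), (w, z) ∈ A →
      ∀ i, F i (cz z, cw w) = 0 := by
    intro w hw hwA
    refine (hgood (cz z) h2 (cw w) hw.2.1).self_of_nhds.2.1 ?_
    simpa only [cw.left_inv hw.1, cz.left_inv h3] using hwA
  refine ⟨?_, ?_⟩
  · have hinj : Set.InjOn (fun w => φ (cw w))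
        {w | w ∈ cw.source ∩ cw ⁻¹' (interior W ∩ φ ⁻¹' U') ∧ (w, z) ∈ A} :=
      fun a ha b hb hab => cw.injOn ha.1.1 hb.1.1 (φ.injective hab)
    rw [← hinj.encard_image]
    refine (encard_le_encard ?_).trans h1.1
    rintro _ ⟨w, ⟨hwU, hwA⟩, rfl⟩
    exact ⟨hwU.2.2, fun i => by simpa using hzero w hwU hwA i⟩
  · intro hδ0 w hwU hwA
    obtain ⟨h, hhd, hhz, hhq⟩ := h1.2 hδ0 (φ (cw w)) hwU.2.2
      (fun i => by simpa using hzero w hwU hwA i)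
    refine isGraphAt_of_chart_graph hdim (w₀ := w₀) (z₀ := z₀) hwU.1 h3 hwA
      (hgood (cz z) h2 (cw w) hwU.2.1) (h := fun y => φ.symm (h y)) ?_ ?_ ?_
    · filter_upwards [hhd] with y hy
      exact φ.symm.differentiableAt.comp y hy
    · show φ.symm (h (cz z)) = cw w
      rw [hhz, φ.symm_apply_apply]
    · have hc : ContinuousAt (fun q : E × E => (q.1, φ q.2)) (cz z, cw w) :=
        (continuous_fst.prodMk (φ.continuous.comp continuous_snd)).continuousAt
      filter_upwards [hc.eventually hhq] with q hq hq0
      have := hq fun i => by simpa using hq0 i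
      rw [← this, φ.symm_apply_apply]

/-- The fibres of a finite correspondence, locally over the base: they are bounded, and over a
connected dense open set of the base the correspondence is locally a graph. -/
theorem exists_local_structure [T2Space X] [CompactSpace X] {A : Set (X × X)}
    (hA : IsAnalyticSubset (𝓘(ℂ, E).prod 𝓘(ℂ, E)) A)
    (hdim : ∀ p ∈ A, HasDimAt (𝓘(ℂ, E).prod 𝓘(ℂ, E)) A (Module.finrank ℂ E) p)
    (hfin : ∀ z, {w | (w, z) ∈ A}.Finite) (z₀ : X) :
    ∃ D D' : Set X, IsOpen D ∧ z₀ ∈ D ∧ IsOpen D' ∧ D' ⊆ D ∧ IsPreconnected D' ∧ D ⊆ closure D' ∧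
      (∃ M : ℕ, ∀ z ∈ D, {w | (w, z) ∈ A}.encard ≤ M) ∧
      ∀ z ∈ D', ∀ w, (w, z) ∈ A → IsGraphAt A w z := by
  classical
  choose U hUo hUm M δ hδ hδn hev using fun w₀ => exists_local_branches hA hdim hfin w₀ z₀
  set cz := chartAt E z₀
  have hz₀ : z₀ ∈ cz.source := mem_chart_source _ _
  set R := (hfin z₀).toFinset
  -- By compactness, nearby fibres lie in the finitely many neighbourhoods `U a` of the points of
  -- the fibre over `z₀`.
  have htube : ∀ᶠ z in 𝓝 z₀, ∀ w, (w, z) ∈ A → ∃ a ∈ R, w ∈ U a := by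
    have hK : IsCompact (⋃ a ∈ R, U a)ᶜ := (isOpen_biUnion fun a _ => hUo a).isClosed_compl.isCompact
    have := hK.eventually_forall_of_forall_eventually (x₀ := z₀)
      (P := fun z w => (w, z) ∉ A) (fun w hw => by
        have hwA : (w, z₀) ∉ A := fun h => hw (mem_biUnion
          (show w ∈ (R : Set X) from (hfin z₀).mem_toFinset.2 h) (hUm w))
        have hc : ContinuousAt (fun q : X × X => (q.2, q.1)) (z₀, w) :=
          continuous_swap.continuousAt
        exact hc.eventually (hA.isClosed.isOpen_compl.mem_nhds (x := (w, z₀)) hwA))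
    filter_upwards [this] with z hz w hwA
    by_contra! hne
    exact hz w (by simpa using hne) hwA
  set Δ : E → ℂ := fun y => ∏ a ∈ R, δ a y
  have hΔ : HolAt Δ (cz z₀) := HolAt.prod fun a _ => hδ a
  have hΔn : ¬ ∀ᶠ y in 𝓝 (cz z₀), Δ y = 0 :=
    HolAt.not_eventually_prod_eq_zero (fun a _ => hδ a) fun a _ => hδn a
  have hcs : ContinuousAt cz.symm (cz z₀) := cz.continuousAt_symm (cz.map_source hz₀)
  have hX : ∀ᶠ y in 𝓝 (cz z₀), (∀ w, (w, cz.symm y) ∈ A → ∃ a ∈ R, w ∈ U a) ∧ ∀ a ∈ R,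
      {w ∈ U a | (w, cz.symm y) ∈ A}.encard ≤ M a ∧
        (δ a (cz (cz.symm y)) ≠ 0 → ∀ w ∈ U a, (w, cz.symm y) ∈ A → IsGraphAt A w (cz.symm y)) :=
    hcs.eventually (by
      rw [cz.left_inv hz₀]
      exact htube.and ((Finset.eventually_all R).2 fun a _ => hev a))
  obtain ⟨ε, hε, hball⟩ := Metric.eventually_nhds_iff_ball.1
    ((hX.and hΔ).and (cz.open_target.mem_nhds (cz.map_source hz₀)))
  have hd : ∀ y ∈ Metric.ball (cz z₀) ε, DifferentiableAt ℂ Δ y := fun y hy => (hball y hy).1.2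
  have ht : Metric.ball (cz z₀) ε ⊆ cz.target := fun y hy => (hball y hy).2
  -- `D'` will be the image of `B'`, the complement of the zeros of the product of all
  -- discriminants; `B'` is connected and dense in the ball.
  set B' := {y ∈ Metric.ball (cz z₀) ε | Δ y ≠ 0} with hB'
  have hB'o : IsOpen B' := by
    have hc : ContinuousOn Δ (Metric.ball (cz z₀) ε) := fun y hy =>
      (hd y hy).continuousAt.continuousWithinAt
    exact hc.isOpen_inter_preimage Metric.isOpen_ball isOpen_compl_singleton
  have hB't : B' ⊆ cz.target := fun y hy => ht hy.1
  refine ⟨cz.symm '' Metric.ball (cz z₀) ε, cz.symm '' B',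
    cz.symm.isOpen_image_of_subset_source Metric.isOpen_ball ht,
    ⟨cz z₀, Metric.mem_ball_self hε, cz.left_inv hz₀⟩,
    cz.symm.isOpen_image_of_subset_source hB'o hB't, image_mono fun y hy => hy.1,
    (isPreconnected_ball_inter_ne_zero hd).image _ (cz.continuousOn_symm.mono hB't), ?_,
    ⟨∑ a ∈ R, M a, ?_⟩, ?_⟩
  · rintro _ ⟨y, hy, rfl⟩
    have hyc := ball_subset_closure_ne_zero hε hd hΔn hy
    exact mem_closure_image (cz.continuousOn_symm.continuousAt (cz.open_target.mem_nhds (ht hy))) hyc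
  · rintro _ ⟨y, hy, rfl⟩
    have hsub : {w | (w, cz.symm y) ∈ A} ⊆ ⋃ a ∈ R, {w ∈ U a | (w, cz.symm y) ∈ A} := by
      intro w hw
      obtain ⟨a, ha, hwa⟩ := (hball y hy).1.1.1 w hw
      exact mem_biUnion (show a ∈ (R : Set X) from ha) ⟨hwa, hw⟩
    refine (encard_le_encard hsub).trans ((Finset.set_encard_biUnion_le R _).trans ?_)
    push_cast
    exact Finset.sum_le_sum fun a ha => ((hball y hy).1.1.2 a ha).1
  · rintro _ ⟨y, hy, rfl⟩ w hw
    obtain ⟨a, ha, hwa⟩ := (hball y hy.1).1.1.1 w hw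
    refine ((hball y hy.1).1.1.2 a ha).2 ?_ w hwa hw
    rw [cz.right_inv (ht hy.1)]
    exact Finset.prod_ne_zero_iff.1 hy.2 a ha

end LocalStructure

/-! ### Global branched covers. -/

section Fibers

variable {X : Type*} [TopologicalSpace X]

/-- The tube lemma for the fibres of a closed relation on a compact space. -/
theorem eventually_fiber_subset [CompactSpace X] {A : Set (X × X)} (hA : IsClosed A) {z₀ : X}
    {O : Set X}
    (hO : IsOpen O) (h : ∀ w, (w, z₀) ∈ A → w ∈ O) : ∀ᶠ z in 𝓝 z₀, ∀ w, (w, z) ∈ A → w ∈ O := by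
  have := hO.isClosed_compl.isCompact.eventually_forall_of_forall_eventually (x₀ := z₀)
    (P := fun z w => (w, z) ∉ A) (fun w hw => by
      have hwA : (w, z₀) ∉ A := fun h' => hw (h w h')
      have hc : ContinuousAt (fun q : X × X => (q.2, q.1)) (z₀, w) := continuous_swap.continuousAt
      exact hc.eventually (hA.isOpen_compl.mem_nhds (x := (w, z₀)) hwA))
  filter_upwards [this] with z hz w hwA
  by_contra hne
  exact hz w hne hwA

theorem IsGraphAt.mem {A : Set (X × X)} {w z : X} (h : IsGraphAt A w z) : (w, z) ∈ A := by
  obtain ⟨f, -, hf, hq⟩ := h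
  exact hq.self_of_nhds.2 hf.symm

/-- Where a closed relation with finite fibres is locally a graph, the cardinality of its fibres is
locally constant. -/
theorem eventually_ncard_fiber_eq [CompactSpace X] [T2Space X] {A : Set (X × X)} (hA : IsClosed A)
    {z₀ : X} (hfin : {w | (w, z₀) ∈ A}.Finite) (hg : ∀ w, (w, z₀) ∈ A → IsGraphAt A w z₀) :
    ∀ᶠ z in 𝓝 z₀, {w | (w, z) ∈ A}.ncard = {w | (w, z₀) ∈ A}.ncard := by
  classical
  obtain ⟨U, hU, hUd⟩ := hfin.t2_separation
  choose! h hc hz hq using hg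
  have hq' : ∀ w, (w, z₀) ∈ A → ∃ O : Set X, IsOpen O ∧ w ∈ O ∧ O ⊆ U w ∧
      ∀ᶠ z in 𝓝 z₀, h w z ∈ O ∧ ∀ w' ∈ O, (w', z) ∈ A ↔ w' = h w z := by
    intro w hw
    have h1 := hq w hw
    rw [nhds_prod_eq] at h1
    obtain ⟨O, hO, N, hN, hON⟩ := Filter.mem_prod_iff.1 h1
    have hOU : interior O ∩ U w ∈ 𝓝 w :=
      inter_mem (interior_mem_nhds.2 hO) ((hU w).2.mem_nhds (hU w).1)
    refine ⟨interior O ∩ U w, isOpen_interior.inter (hU w).2, mem_of_mem_nhds hOU,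
      inter_subset_right, ?_⟩
    filter_upwards [hN, (hc w hw).eventually (by rw [hz w hw]; exact hOU)] with z h2 h3
    exact ⟨h3, fun w' hw' => hON (Set.mk_mem_prod (interior_subset hw'.1) h2)⟩
  choose! O hOo hOm hOU hOz using hq'
  have htube := eventually_fiber_subset hA (z₀ := z₀) (O := ⋃ w ∈ {w | (w, z₀) ∈ A}, O w)
    (isOpen_biUnion fun w hw => hOo w hw) (fun w hw => mem_biUnion hw (hOm w hw))
  filter_upwards [htube, (hfin.eventually_all).2 hOz] with z h1 h2
  symm
  -- The local graphs match the fibres: the disjoint sets `U w` give injectivity, the tube gives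
  -- surjectivity.
  refine Set.ncard_congr (fun w _ => h w z) (fun w hw => ?_) (fun a b ha hb hab => ?_) fun w hw => ?_
  · exact ((h2 w hw).2 _ (h2 w hw).1).2 rfl
  · by_contra hne
    have h3 := hOU a ha (h2 a ha).1
    have h4 := hOU b hb (h2 b hb).1
    rw [hab] at h3
    exact Set.disjoint_left.1 (hUd ha hb hne) h3 h4
  · obtain ⟨a, ha, hwa⟩ := mem_iUnion₂.1 (h1 w hw)
    exact ⟨a, ha, (((h2 a ha).2 w hwa).1 hw).symm⟩

/-- `A ⊆ X × X` is a finite branched cover of the second factor, with `s` sheets, which is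
unbranched over the dense open set `V`. -/
structure IsBranchedCover (A : Set (X × X)) (s : ℕ) (V : Set X) : Prop where
  isClosed : IsClosed A
  finite : ∀ z, {w | (w, z) ∈ A}.Finite
  bounded : ∀ z₀, ∃ M : ℕ, ∀ᶠ z in 𝓝 z₀, {w | (w, z) ∈ A}.encard ≤ M
  isOpen : IsOpen V
  dense : Dense V
  ncard_eq : ∀ z ∈ V, {w | (w, z) ∈ A}.ncard = s
  isGraphAt : ∀ z ∈ V, ∀ w, (w, z) ∈ A → IsGraphAt A w z

/-- The fibre count is constant on each connected `D'`. Density of `D'` in `D` makes the sets `D'`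
of neighbouring points meet, so the generic count is locally constant on the connected space `X`. -/
theorem exists_isBranchedCover [CompactSpace X] [T2Space X] [PreconnectedSpace X] [Nonempty X]
    {A : Set (X × X)} (hA : IsClosed A) (hfin : ∀ z, {w | (w, z) ∈ A}.Finite)
    (hloc : ∀ z₀, ∃ D D' : Set X, IsOpen D ∧ z₀ ∈ D ∧ IsOpen D' ∧ D' ⊆ D ∧ IsPreconnected D' ∧
      D ⊆ closure D' ∧ (∃ M : ℕ, ∀ z ∈ D, {w | (w, z) ∈ A}.encard ≤ M) ∧
      ∀ z ∈ D', ∀ w, (w, z) ∈ A → IsGraphAt A w z) :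
    ∃ s V, IsBranchedCover A s V := by
  choose D D' hDo hDm hD'o hD'D hD'c hDcl M hg using hloc
  set c : X → ℕ := fun z => {w | (w, z) ∈ A}.ncard
  have hcD' : ∀ z₀, ∀ x ∈ D' z₀, ∀ y ∈ D' z₀, c x = c y := by
    intro z₀ x hx y hy
    refine (hD'c z₀).constant (f := c) (fun z hz => ?_) hx hy
    refine ContinuousAt.continuousWithinAt ?_
    have := eventually_ncard_fiber_eq hA (hfin z) (hg z₀ z hz)
    exact (continuousAt_const (y := c z)).congr (this.mono fun x hx => hx.symm)
  have hne : ∀ z₀, (D' z₀).Nonempty := fun z₀ => closure_nonempty_iff.1 ⟨z₀, hDcl z₀ (hDm z₀)⟩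
  choose p hp using hne
  have hmeet : ∀ z₀ z₁, z₁ ∈ D z₀ → c (p z₁) = c (p z₀) := by
    intro z₀ z₁ h1
    obtain ⟨a, ha, ha'⟩ := mem_closure_iff.1 (hDcl z₀ h1) (D z₁) (hDo z₁) (hDm z₁)
    obtain ⟨b, hb, hb'⟩ := mem_closure_iff.1 (hDcl z₁ ha) (D' z₀) (hD'o z₀) ha'
    rw [hcD' z₁ _ (hp z₁) b hb', hcD' z₀ _ (hp z₀) b hb]
  have hcont : Continuous fun z => c (p z) := by
    rw [continuous_iff_continuousAt]
    intro z₀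
    refine (continuousAt_const (y := c (p z₀))).congr ?_
    filter_upwards [(hDo z₀).mem_nhds (hDm z₀)] with z hz using (hmeet z₀ z hz).symm
  obtain ⟨x₀⟩ := ‹Nonempty X›
  refine ⟨c (p x₀), ⋃ z, D' z, hA, hfin, fun z₀ => ?_, isOpen_iUnion hD'o, fun z => ?_, ?_, ?_⟩
  · obtain ⟨m, hm⟩ := M z₀
    exact ⟨m, Filter.eventually_of_mem ((hDo z₀).mem_nhds (hDm z₀)) hm⟩
  · exact closure_mono (subset_iUnion D' z) (hDcl z (hDm z))
  · intro z hz
    obtain ⟨y, hy⟩ := mem_iUnion.1 hz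
    show c z = _
    rw [hcD' y z hy _ (hp y)]
    exact PreconnectedSpace.constant ‹_› hcont
  · intro z hz w hw
    obtain ⟨y, hy⟩ := mem_iUnion.1 hz
    exact hg y z hy w hw

end Fibers

/-! ### Local degrees and sums over fibres. -/

section Multiplicity

open Classical in
/-- The fibre of `A` over `z` as a finite set; it is empty if the fibre is infinite. -/
noncomputable def fiberFinset {X : Type*} (A : Set (X × X)) (z : X) : Finset X :=
  if h : {w | (w, z) ∈ A}.Finite then h.toFinset else ∅

theorem mem_fiberFinset {X : Type*} {A : Set (X × X)} {w z : X} (h : {w | (w, z) ∈ A}.Finite) :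
    w ∈ fiberFinset A z ↔ (w, z) ∈ A := by
  rw [fiberFinset, dif_pos h, h.mem_toFinset]
  rfl

theorem card_fiberFinset {X : Type*} {A : Set (X × X)} {z : X} (h : {w | (w, z) ∈ A}.Finite) :
    (fiberFinset A z).card = {w | (w, z) ∈ A}.ncard := by
  rw [fiberFinset, dif_pos h, Set.ncard_eq_toFinset_card _ h]

variable {X : Type*} [TopologicalSpace X]

/-- The local degree as an extended natural number. -/
noncomputable def emult (A : Set (X × X)) (w z : X) : ℕ∞ :=
  ⨅ U ∈ 𝓝 w, limsup (fun z' : X => {w' : X | w' ∈ U ∧ (w', z') ∈ A}.encard) (𝓝 z)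

theorem multiplicity_eq_toNat (A : Set (X × X)) (w z : X) :
    FormalCorr.multiplicity A w z = (emult A w z).toNat := rfl

theorem one_le_emult {A : Set (X × X)} {w z : X} (h : (w, z) ∈ A) : 1 ≤ emult A w z := by
  refine le_iInf₂ fun U hU => ?_
  have h1 : (1 : ℕ∞) ≤ {w' : X | w' ∈ U ∧ (w', z) ∈ A}.encard :=
    Set.one_le_encard_iff_nonempty.2 ⟨w, mem_of_mem_nhds hU, h⟩
  refine h1.trans ?_
  refine le_limsup_of_frequently_le ?_ (by isBoundedDefault)
  intro hn
  exact hn.self_of_nhds le_rfl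

theorem emult_le_of_eventually {A : Set (X × X)} {w z : X} {U : Set X} (hU : U ∈ 𝓝 w) {n : ℕ∞}
    (h : ∀ᶠ z' in 𝓝 z, {w' : X | w' ∈ U ∧ (w', z') ∈ A}.encard ≤ n) : emult A w z ≤ n :=
  (iInf₂_le U hU).trans (limsup_le_of_le (by isBoundedDefault) h)

theorem emult_eq_zero {A : Set (X × X)} (hA : IsClosed A) {w z : X} (h : (w, z) ∉ A) :
    emult A w z = 0 := by
  have h1 : Aᶜ ∈ 𝓝 (w, z) := hA.isOpen_compl.mem_nhds h
  rw [nhds_prod_eq] at h1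
  obtain ⟨U, hU, V, hV, hUV⟩ := Filter.mem_prod_iff.1 h1
  refine le_antisymm (emult_le_of_eventually hU ?_) bot_le
  filter_upwards [hV] with z' hz'
  rw [nonpos_iff_eq_zero, Set.encard_eq_zero, Set.eq_empty_iff_forall_notMem]
  exact fun w' hw' => hUV (Set.mk_mem_prod hw'.1 hz') hw'.2

/-- A finite infimum in `ℕ∞` is attained, since being below `n + 1` is the same as being at most
`n`. -/
theorem exists_nhds_encard_le_emult {A : Set (X × X)} {w z : X} (h : emult A w z ≠ ⊤) :
    ∃ U ∈ 𝓝 w, ∀ᶠ z' in 𝓝 z, {w' : X | w' ∈ U ∧ (w', z') ∈ A}.encard ≤ emult A w z := by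
  have hlt : emult A w z < emult A w z + 1 := ENat.lt_add_one_iff h |>.2 le_rfl
  have hlt' : (⨅ U ∈ 𝓝 w, limsup (fun z' : X => {w' : X | w' ∈ U ∧ (w', z') ∈ A}.encard) (𝓝 z)) <
      emult A w z + 1 := hlt
  obtain ⟨U, hlt'⟩ := iInf_lt_iff.1 hlt'
  obtain ⟨hU, hlt'⟩ := iInf_lt_iff.1 hlt'
  refine ⟨U, hU, ?_⟩
  filter_upwards [eventually_lt_of_limsup_lt hlt' (by isBoundedDefault)] with z' hz'
  exact (ENat.lt_add_one_iff h).1 hz'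

theorem IsGraphAt.emult_eq_one {A : Set (X × X)} {w z : X} (h : IsGraphAt A w z) :
    emult A w z = 1 := by
  refine le_antisymm ?_ (one_le_emult h.mem)
  obtain ⟨f, -, -, hq⟩ := h
  rw [nhds_prod_eq] at hq
  obtain ⟨U, hU, V, hV, hUV⟩ := Filter.mem_prod_iff.1 hq
  refine emult_le_of_eventually hU ?_
  filter_upwards [hV] with z' hz'
  rw [Set.encard_le_one_iff]
  intro a b ha hb
  have e1 : a = f z' := (hUV (Set.mk_mem_prod ha.1 hz')).1 ha.2
  have e2 : b = f z' := (hUV (Set.mk_mem_prod hb.1 hz')).1 hb.2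
  rw [e1, e2]

namespace IsBranchedCover

variable {A : Set (X × X)} {s : ℕ} {V : Set X}

theorem emult_ne_top (h : IsBranchedCover A s V) (w z : X) : emult A w z ≠ ⊤ := by
  obtain ⟨M, hM⟩ := h.bounded z
  have : emult A w z ≤ M := emult_le_of_eventually univ_mem (by simpa using hM)
  exact ne_top_of_le_ne_top (ENat.natCast_ne_top M) this

theorem coe_multiplicity (h : IsBranchedCover A s V) (w z : X) :
    (FormalCorr.multiplicity A w z : ℕ∞) = emult A w z :=
  ENat.natCast_toNat (h.emult_ne_top w z)

theorem multiplicity_pos (h : IsBranchedCover A s V) {w z : X} (hwz : (w, z) ∈ A) :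
    0 < FormalCorr.multiplicity A w z := by
  have := one_le_emult hwz
  rw [← h.coe_multiplicity] at this
  exact_mod_cast this

theorem multiplicity_eq_zero (h : IsBranchedCover A s V) {w z : X} (hwz : (w, z) ∉ A) :
    FormalCorr.multiplicity A w z = 0 := by
  rw [multiplicity_eq_toNat, emult_eq_zero h.isClosed hwz, ENat.toNat_zero]

theorem multiplicity_eq_one (h : IsBranchedCover A s V) {w z : X} (hz : z ∈ V) (hwz : (w, z) ∈ A) :
    FormalCorr.multiplicity A w z = 1 := by
  rw [multiplicity_eq_toNat, (h.isGraphAt z hz w hwz).emult_eq_one, ENat.toNat_one]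

theorem mem_fiber (h : IsBranchedCover A s V) {w z : X} : w ∈ fiberFinset A z ↔ (w, z) ∈ A :=
  mem_fiberFinset (h.finite z)

theorem finsum_eq (h : IsBranchedCover A s V) (φ : X → ℝ) (z : X) :
    ∑ᶠ w : X, (FormalCorr.multiplicity A w z : ℝ) * φ w =
      ∑ w ∈ fiberFinset A z, (FormalCorr.multiplicity A w z : ℝ) * φ w := by
  refine finsum_eq_sum_of_support_subset _ fun w hw => ?_
  by_contra hne
  refine hw ?_
  simp [h.multiplicity_eq_zero (fun h' => hne (h.mem_fiber.2 h'))]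

theorem finsum_nat_eq (h : IsBranchedCover A s V) (z : X) :
    ∑ᶠ w : X, FormalCorr.multiplicity A w z =
      ∑ w ∈ fiberFinset A z, FormalCorr.multiplicity A w z := by
  refine finsum_eq_sum_of_support_subset _ fun w hw => ?_
  by_contra hne
  exact hw (h.multiplicity_eq_zero (fun h' => hne (h.mem_fiber.2 h')))

theorem card_fiber (h : IsBranchedCover A s V) {z : X} (hz : z ∈ V) :
    (fiberFinset A z).card = s := by
  rw [card_fiberFinset (h.finite z), h.ncard_eq z hz]

theorem sum_multiplicity_of_mem (h : IsBranchedCover A s V) {z : X} (hz : z ∈ V) :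
    ∑ w ∈ fiberFinset A z, FormalCorr.multiplicity A w z = s := by
  rw [← h.card_fiber hz, Finset.card_eq_sum_ones]
  exact Finset.sum_congr rfl fun w hw => h.multiplicity_eq_one hz (h.mem_fiber.1 hw)

/-- Near a fibre, the relation decomposes into disjoint pieces, one for each point of the fibre. -/
theorem exists_decomposition [CompactSpace X] [T2Space X] [DecidableEq X]
    (h : IsBranchedCover A s V) (z₀ : X) {N : X → Set X}
    (hN : ∀ w ∈ fiberFinset A z₀, N w ∈ 𝓝 w) :
    ∀ᶠ z in 𝓝 z₀, ∃ part : X → Finset X,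
      (∀ w ∈ fiberFinset A z₀, ∀ w' ∈ part w, w' ∈ N w) ∧
      (∀ w ∈ fiberFinset A z₀, (part w).card ≤ FormalCorr.multiplicity A w z₀) ∧
      (fiberFinset A z₀ : Set X).PairwiseDisjoint part ∧
      fiberFinset A z = (fiberFinset A z₀).biUnion part := by
  classical
  obtain ⟨U, hU, hUd⟩ := (h.finite z₀).t2_separation
  choose O hO hOz using fun w => exists_nhds_encard_le_emult (h.emult_ne_top w z₀)
  set W : X → Set X := fun w => interior (O w ∩ N w) ∩ U w with hW
  have htube := eventually_fiber_subset h.isClosed (z₀ := z₀) (O := ⋃ w ∈ fiberFinset A z₀, W w)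
    (isOpen_biUnion fun w _ => isOpen_interior.inter (hU w).2) (fun w hw => by
      have hw' := h.mem_fiber.2 hw
      refine mem_biUnion (show w ∈ (fiberFinset A z₀ : Set X) from hw') ⟨?_, (hU w).1⟩
      exact mem_interior_iff_mem_nhds.2 (inter_mem (hO w) (hN w hw')))
  filter_upwards [htube, ((fiberFinset A z₀).eventually_all).2 fun w _ => hOz w] with z h1 h2
  refine ⟨fun w => (fiberFinset A z).filter (· ∈ W w), ?_, ?_, ?_, ?_⟩
  · intro w _ w' hw'
    exact (interior_subset (Finset.mem_filter.1 hw').2.1).2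
  · intro w hw
    have h3 := h2 w hw
    rw [← h.coe_multiplicity] at h3
    have hsub : (((fiberFinset A z).filter (· ∈ W w) : Finset X) : Set X) ⊆ {w' | w' ∈ O w ∧ (w', z) ∈ A} := by
      intro w' hw'
      have := Finset.mem_filter.1 (Finset.mem_coe.1 hw')
      exact ⟨(interior_subset this.2.1).1, h.mem_fiber.1 this.1⟩
    have h4 := (Set.encard_le_encard hsub).trans h3
    rw [Set.encard_coe_eq_coe_finsetCard] at h4
    exact_mod_cast h4
  · intro a ha b hb hab
    refine Finset.disjoint_left.2 fun x hx hx' => ?_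
    exact Set.disjoint_left.1 (hUd (h.mem_fiber.1 ha) (h.mem_fiber.1 hb) hab)
      (Finset.mem_filter.1 hx).2.2 (Finset.mem_filter.1 hx').2.2
  · ext w
    simp only [Finset.mem_biUnion, Finset.mem_filter]
    constructor
    · intro hw
      obtain ⟨a, ha, hwa⟩ := mem_iUnion₂.1 (h1 w (h.mem_fiber.1 hw))
      exact ⟨a, ha, hw, hwa⟩
    · rintro ⟨a, -, hw, -⟩
      exact hw

/-- A generic nearby fibre has `s` points, and at most as many of them gather near each point of the
given fibre as its local degree. -/
theorem le_sum_multiplicity [CompactSpace X] [T2Space X] (h : IsBranchedCover A s V) (z₀ : X) :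
    s ≤ ∑ w ∈ fiberFinset A z₀, FormalCorr.multiplicity A w z₀ := by
  classical
  have hfr : ∃ᶠ z in 𝓝 z₀, z ∈ V := mem_closure_iff_frequently.1 (h.dense z₀)
  obtain ⟨z, hzV, part, -, hcard, hdisj, heq⟩ := (hfr.and_eventually
    (h.exists_decomposition z₀ (N := fun _ => univ) fun _ _ => univ_mem)).exists
  rw [← h.card_fiber hzV, heq, Finset.card_biUnion hdisj]
  exact Finset.sum_le_sum hcard

/-- At the points where the multiplicities add up to the number of sheets, the sum over the fibre
is the limit of the sums over the generic fibres. -/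
theorem tendsto_sum [CompactSpace X] [T2Space X] (h : IsBranchedCover A s V) {z₀ : X}
    (hz₀ : ∑ w ∈ fiberFinset A z₀, FormalCorr.multiplicity A w z₀ = s) {φ : X → ℝ} (hφ : Continuous φ) :
    Tendsto (fun z => ∑ w ∈ fiberFinset A z, (FormalCorr.multiplicity A w z : ℝ) * φ w) (𝓝[V] z₀)
      (𝓝 (∑ w ∈ fiberFinset A z₀, (FormalCorr.multiplicity A w z₀ : ℝ) * φ w)) := by
  classical
  rw [Metric.tendsto_nhds]
  intro ε hε
  have hε' : 0 < ε / (s + 1) := by positivity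
  have hdec := h.exists_decomposition z₀ (N := fun w => {x | |φ x - φ w| < ε / (s + 1)}) fun w _ =>
    (hφ.continuousAt.sub continuousAt_const).abs.eventually_lt_const (by simpa using hε')
  filter_upwards [hdec.filter_mono nhdsWithin_le_nhds, self_mem_nhdsWithin] with z hz hzV
  obtain ⟨part, hN, hcard, hdisj, heq⟩ := hz
  have hcs : ∑ w ∈ fiberFinset A z₀, (part w).card = ∑ w ∈ fiberFinset A z₀, FormalCorr.multiplicity A w z₀ := by
    rw [hz₀, ← Finset.card_biUnion hdisj, ← heq, h.card_fiber hzV]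
  -- Equality of the totals forces every piece to have exactly as many points as the local degree.
  have hceq := (Finset.sum_eq_sum_iff_of_le hcard).1 hcs
  have e1 : ∑ w ∈ fiberFinset A z, (FormalCorr.multiplicity A w z : ℝ) * φ w =
      ∑ w ∈ fiberFinset A z₀, ∑ w' ∈ part w, φ w' := by
    rw [← Finset.sum_biUnion hdisj, ← heq]
    refine Finset.sum_congr rfl fun w hw => ?_
    rw [h.multiplicity_eq_one hzV (h.mem_fiber.1 hw)]
    simp
  have e2 : ∑ w ∈ fiberFinset A z₀, (FormalCorr.multiplicity A w z₀ : ℝ) * φ w =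
      ∑ w ∈ fiberFinset A z₀, ∑ w' ∈ part w, φ w := by
    refine Finset.sum_congr rfl fun w hw => ?_
    rw [Finset.sum_const, hceq w hw, nsmul_eq_mul]
  rw [e1, e2, Real.dist_eq, ← Finset.sum_sub_distrib]
  calc |∑ w ∈ fiberFinset A z₀, (∑ w' ∈ part w, φ w' - ∑ w' ∈ part w, φ w)|
      ≤ ∑ w ∈ fiberFinset A z₀, |∑ w' ∈ part w, φ w' - ∑ w' ∈ part w, φ w| := Finset.abs_sum_le_sum_abs _ _
    _ ≤ ∑ w ∈ fiberFinset A z₀, (FormalCorr.multiplicity A w z₀ : ℝ) * (ε / (s + 1)) := by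
        refine Finset.sum_le_sum fun w hw => ?_
        rw [← Finset.sum_sub_distrib, ← hceq w hw, ← nsmul_eq_mul, ← Finset.sum_const]
        exact (Finset.abs_sum_le_sum_abs _ _).trans
          (Finset.sum_le_sum fun w' hw' => (hN w hw w' hw').le)
    _ = s * (ε / (s + 1)) := by
        rw [← Finset.sum_mul, ← hz₀]
        push_cast
        rfl
    _ < ε := by
        rw [mul_div_assoc', div_lt_iff₀ (by positivity)]
        nlinarith

end IsBranchedCover

end Multiplicity

/-! ### Local degrees of products. -/

section Product

theorem fiber_prodSet {X Y : Type*} (A : Set (X × X)) (B : Set (Y × Y)) (U : Set X) (W : Set Y)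
    (z : X × Y) :
    {w : X × Y | w ∈ U ×ˢ W ∧ (w, z) ∈ FormalCorr.prodSet A B} =
      {w | w ∈ U ∧ (w, z.1) ∈ A} ×ˢ {w | w ∈ W ∧ (w, z.2) ∈ B} := by
  ext w
  simp only [FormalCorr.prodSet, Set.mem_prod, Set.mem_ofPred_eq]
  tauto

variable {X : Type*} [TopologicalSpace X]

theorem frequently_le_encard_of_le_emult {A : Set (X × X)} {w z : X} {U : Set X} (hU : U ∈ 𝓝 w)
    {n : ℕ}
    (hn : (n : ℕ∞) ≤ emult A w z) :
    ∃ᶠ z' in 𝓝 z, (n : ℕ∞) ≤ {w' : X | w' ∈ U ∧ (w', z') ∈ A}.encard := by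
  intro hcon
  rcases n with _ | n
  · exact hcon.self_of_nhds (by simp)
  have h1 : emult A w z ≤ n := emult_le_of_eventually hU <| by
    filter_upwards [hcon] with z' hz'
    rw [not_le] at hz'
    exact (ENat.lt_add_one_iff (ENat.natCast_ne_top n)).1 (by exact_mod_cast hz')
  have := hn.trans h1
  norm_cast at this
  omega

/-- Fibres over product neighbourhoods are products. For the lower bound, points of the base
realising the two local degrees can be chosen independently in the two factors. -/
theorem emult_prodSet {Y : Type*} [TopologicalSpace Y] {A : Set (X × X)} {B : Set (Y × Y)}
    {w z : X × Y} (hA : emult A w.1 z.1 ≠ ⊤) (hB : emult B w.2 z.2 ≠ ⊤) :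
    emult (FormalCorr.prodSet A B) w z = emult A w.1 z.1 * emult B w.2 z.2 := by
  refine le_antisymm ?_ ?_
  · obtain ⟨U, hU, hUz⟩ := exists_nhds_encard_le_emult hA
    obtain ⟨W, hW, hWz⟩ := exists_nhds_encard_le_emult hB
    refine emult_le_of_eventually (prod_mem_nhds hU hW) ?_
    have h1 : ∀ᶠ z' : X × Y in 𝓝 z, _ := continuous_fst.continuousAt.eventually hUz
    have h2 : ∀ᶠ z' : X × Y in 𝓝 z, _ := continuous_snd.continuousAt.eventually hWz
    filter_upwards [h1, h2] with z' h3 h4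
    rw [fiber_prodSet, Set.encard_prod]
    exact mul_le_mul' h3 h4
  · obtain ⟨a, ha⟩ := ENat.ne_top_iff_exists.1 hA
    obtain ⟨b, hb⟩ := ENat.ne_top_iff_exists.1 hB
    refine le_iInf₂ fun O hO => ?_
    obtain ⟨w₁, w₂⟩ := w
    obtain ⟨z₁, z₂⟩ := z
    rw [nhds_prod_eq] at hO
    obtain ⟨U, hU, W, hW, hUW⟩ := Filter.mem_prod_iff.1 hO
    have f1 := frequently_le_encard_of_le_emult hU ha.le
    have f2 := frequently_le_encard_of_le_emult hW hb.le
    rw [← ha, ← hb]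
    refine le_limsup_of_frequently_le ?_ (by isBoundedDefault)
    rw [nhds_prod_eq]
    intro hcon
    obtain ⟨P, hP, Q, hQ, hPQ⟩ := Filter.eventually_prod_iff.1 hcon
    obtain ⟨z₁', h1, h1'⟩ := (f1.and_eventually hP).exists
    obtain ⟨z₂', h2, h2'⟩ := (f2.and_eventually hQ).exists
    refine hPQ h1' h2' ?_
    refine (mul_le_mul' h1 h2).trans ?_
    rw [← Set.encard_prod, ← fiber_prodSet A B U W (z₁', z₂')]
    exact Set.encard_le_encard fun w hw => ⟨hUW hw.1, hw.2⟩

end Product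

/-! ### Correspondences with finite fibres, and the degree. -/

namespace FormalCorr

theorem exists_of_mem_support_product {X : Type*} {F : FormalCorr X} 
    {P : Set ((X × X) × (X × X))} (hP : P ∈ (F.product F).support) :
    ∃ A ∈ F.support, ∃ B ∈ F.support, P = prodSet A B := by
  classical
  have h1 := Finsupp.support_sum hP
  obtain ⟨A, hA, h2⟩ := Finset.mem_biUnion.1 h1
  obtain ⟨B, hB, h3⟩ := Finset.mem_biUnion.1 (Finsupp.support_sum h2)
  exact ⟨A, hA, B, hB, Finset.mem_singleton.1 (Finsupp.support_single_subset h3)⟩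

variable {X : Type*} [TopologicalSpace X]

/-- The multiplicity of `w` as a preimage of `z` under `F`. -/
noncomputable def weight (F : FormalCorr X) (w z : X) : ℕ := F.sum fun A m => m * multiplicity A w z

/-- The summands of `F` have finite fibres, and the local degrees are positive exactly on them. -/
structure IsFinitary (F : FormalCorr X) : Prop where
  finite : ∀ A ∈ F.support, ∀ z, {w | (w, z) ∈ A}.Finite
  ne_zero_iff : ∀ A ∈ F.support, ∀ w z, multiplicity A w z ≠ 0 ↔ (w, z) ∈ A

namespace IsFinitary

variable {F : FormalCorr X}

theorem mem_carrier_iff (hF : F.IsFinitary) {w z : X} : (w, z) ∈ F.carrier ↔ F.weight w z ≠ 0 := by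
  rw [weight, Finsupp.sum, Ne, Finset.sum_eq_zero_iff, carrier]
  simp only [mem_iUnion, exists_prop, not_forall]
  refine exists_congr fun A => and_congr_right fun hA => ?_
  rw [← hF.ne_zero_iff A hA, mul_eq_zero, not_or]
  exact ⟨fun h => ⟨Finsupp.mem_support_iff.1 hA, h⟩, fun h => h.2⟩

theorem finite_carrier (hF : F.IsFinitary) (z : X) : {w | (w, z) ∈ F.carrier}.Finite := by
  have : {w | (w, z) ∈ F.carrier} = ⋃ A ∈ (F.support : Set (Set (X × X))), {w | (w, z) ∈ A} := by
    ext w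
    simp [carrier]
  rw [this]
  exact F.support.finite_toSet.biUnion fun A hA => hF.finite A hA z

theorem finsum_multiplicity_mul (hF : F.IsFinitary) {A : Set (X × X)} (hA : A ∈ F.support)
    (φ : X → ℝ) (z : X) :
    ∑ᶠ w : X, (multiplicity A w z : ℝ) * φ w =
      ∑ w ∈ fiberFinset F.carrier z, (multiplicity A w z : ℝ) * φ w := by
  refine finsum_eq_sum_of_support_subset _ fun w hw => ?_
  rw [Finset.mem_coe, mem_fiberFinset (hF.finite_carrier z)]
  refine mem_biUnion (show A ∈ (F.support : Set _) from hA) ((hF.ne_zero_iff A hA w z).1 ?_)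
  intro h0
  exact hw (by simp [h0])

theorem preimageSum_eq (hF : F.IsFinitary) (φ : X → ℝ) (z : X) :
    F.preimageSum φ z = ∑ w ∈ fiberFinset F.carrier z, (F.weight w z : ℝ) * φ w := by
  rw [preimageSum, Finsupp.sum,
    Finset.sum_congr rfl fun A hA => by rw [hF.finsum_multiplicity_mul hA, Finset.mul_sum], Finset.sum_comm]
  refine Finset.sum_congr rfl fun w _ => ?_
  rw [weight, Finsupp.sum, Nat.cast_sum, Finset.sum_mul]
  refine Finset.sum_congr rfl fun A _ => ?_
  push_cast
  ring

theorem preimageCount_eq (hF : F.IsFinitary) (z : X) :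
    F.preimageCount z = ∑ w ∈ fiberFinset F.carrier z, F.weight w z := by
  have h1 : (F.preimageCount z : ℝ) = F.preimageSum (fun _ => 1) z := by
    rw [preimageCount, preimageSum, Finsupp.sum, Finsupp.sum, Nat.cast_sum]
    refine Finset.sum_congr rfl fun A hA => ?_
    have hfs : (Function.support fun w => multiplicity A w z).Finite :=
      (hF.finite A hA z).subset fun w hw => (hF.ne_zero_iff A hA w z).1 hw
    rw [Nat.cast_mul]
    congr 1
    rw [← Nat.coe_castAddMonoidHom, AddMonoidHom.map_finsum _ hfs]
    simp
  have h2 := h1.trans (hF.preimageSum_eq (fun _ => 1) z)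
  simp only [mul_one] at h2
  exact_mod_cast h2

theorem preimageSum_one (hF : F.IsFinitary) (z : X) :
    F.preimageSum (fun _ => 1) z = F.preimageCount z := by
  rw [hF.preimageSum_eq, hF.preimageCount_eq]
  simp

end IsFinitary

/-- Two dense open sets meet, so the set whose infimum defines the degree is a singleton. -/
theorem topDegree_eq [Nonempty X] {F : FormalCorr X} {V : Set X} (hV : IsOpen V) (hVd : Dense V)
    {d : ℕ}
    (h : ∀ z ∈ V, F.preimageCount z = d) : F.topDegree = d := by
  have : {d : ℕ | ∃ V : Set X, IsOpen V ∧ Dense V ∧ ∀ z ∈ V, F.preimageCount z = d} = {d} := by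
    ext e
    refine ⟨?_, ?_⟩
    · rintro ⟨W, hW, hWd, hWe⟩
      obtain ⟨z, hz⟩ := (hVd.inter_of_isOpen_left hWd hV).nonempty
      exact (hWe z hz.2).symm.trans (h z hz.1)
    · rintro rfl
      exact ⟨V, hV, hVd, h⟩
  rw [topDegree, this]
  exact csInf_singleton d

/-! ### Sums of branched covers -/

/-- Every summand of `F ≠ 0` is a branched cover, unbranched over `V`, with a positive number `s` of
sheets. -/
structure IsBranched (F : FormalCorr X) (s : Set (X × X) → ℕ) (V : Set X) : Prop where
  ne_zero : F ≠ 0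
  cover : ∀ A ∈ F.support, IsBranchedCover A (s A) V
  pos : ∀ A ∈ F.support, 0 < s A
  isOpen : IsOpen V
  dense : Dense V

theorem IsHolomorphic.exists_isBranched {E : Type*} [NormedAddCommGroup E] [NormedSpace ℂ E]
    [FiniteDimensional ℂ E] [CompactSpace X] [T2Space X] [ConnectedSpace X] [ChartedSpace E X]
    [IsManifold 𝓘(ℂ, E) ω X] {F : FormalCorr X} (hF : F.IsHolomorphic 𝓘(ℂ, E)) :
    ∃ s V, F.IsBranched s V := by
  have h1 : ∀ A ∈ F.support, ∃ s V, IsBranchedCover A s V := fun A hA =>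
    have hA' := hF.irreducible A hA
    exists_isBranchedCover hA'.irreducible.2.1.isClosed (hF.finite_preimage A hA)
      (exists_local_structure hA'.irreducible.2.1 hA'.hasDim (hF.finite_preimage A hA))
  choose! s V h using h1
  have hVo : IsOpen (⋂ A ∈ F.support, V A) := isOpen_biInter_finset fun A hA => (h A hA).isOpen
  have hVd : Dense (⋂ A ∈ F.support, V A) := by
    have : ∀ S : Finset (Set (X × X)), S ⊆ F.support → IsOpen (⋂ A ∈ S, V A) ∧ Dense (⋂ A ∈ S, V A) := by
      classical
      intro S
      induction S using Finset.induction_on with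
      | empty => simp
      | insert A S _ ih =>
        intro hS
        obtain ⟨i1, i2⟩ := ih ((Finset.subset_insert A S).trans hS)
        have hA := h A (hS (Finset.mem_insert_self A S))
        rw [Finset.set_biInter_insert]
        exact ⟨hA.isOpen.inter i1, hA.dense.inter_of_isOpen_left i2 hA.isOpen⟩
    exact (this _ le_rfl).2
  have hcov : ∀ A ∈ F.support, IsBranchedCover A (s A) (⋂ A ∈ F.support, V A) := fun A hA =>
    { isClosed := (h A hA).isClosed
      finite := (h A hA).finite
      bounded := (h A hA).bounded
      isOpen := hVo
      dense := hVd
      ncard_eq := fun z hz => (h A hA).ncard_eq z (mem_iInter₂.1 hz A hA)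
      isGraphAt := fun z hz => (h A hA).isGraphAt z (mem_iInter₂.1 hz A hA) }
  refine ⟨s, _, hF.ne_zero, hcov, fun A hA => ?_, hVo, hVd⟩
  obtain ⟨z, hz⟩ := hVd.nonempty
  rw [← (hcov A hA).ncard_eq z hz, Set.ncard_pos ((hcov A hA).finite z)]
  have : z ∈ Prod.snd '' A := by rw [hF.surj_snd A hA]; trivial
  obtain ⟨⟨w, z'⟩, hwz, rfl⟩ := this
  exact ⟨w, hwz⟩

namespace IsBranched

variable {F : FormalCorr X} {s : Set (X × X) → ℕ} {V : Set X}

theorem isFinitary (hF : F.IsBranched s V) : F.IsFinitary where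
  finite A hA := (hF.cover A hA).finite
  ne_zero_iff A hA w z := by
    refine ⟨fun h => ?_, fun h => ((hF.cover A hA).multiplicity_pos h).ne'⟩
    by_contra hne
    exact h ((hF.cover A hA).multiplicity_eq_zero hne)

theorem preimageCount_eq_sum (hF : F.IsBranched s V) (z : X) :
    F.preimageCount z = ∑ A ∈ F.support, F A * ∑ w ∈ fiberFinset A z, multiplicity A w z :=
  Finset.sum_congr rfl fun A hA => congrArg _ ((hF.cover A hA).finsum_nat_eq z)

theorem preimageSum_eq_sum (hF : F.IsBranched s V) (φ : X → ℝ) (z : X) :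
    F.preimageSum φ z =
      ∑ A ∈ F.support, (F A : ℝ) * ∑ w ∈ fiberFinset A z, (multiplicity A w z : ℝ) * φ w :=
  Finset.sum_congr rfl fun A hA => congrArg _ ((hF.cover A hA).finsum_eq φ z)

theorem preimageCount_of_mem (hF : F.IsBranched s V) {z : X} (hz : z ∈ V) :
    F.preimageCount z = ∑ A ∈ F.support, F A * s A := by
  rw [hF.preimageCount_eq_sum]
  exact Finset.sum_congr rfl fun A hA => by rw [(hF.cover A hA).sum_multiplicity_of_mem hz]

theorem topDegree_eq_sum [Nonempty X] (hF : F.IsBranched s V) :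
    F.topDegree = ∑ A ∈ F.support, F A * s A :=
  topDegree_eq hF.isOpen hF.dense fun _ hz => hF.preimageCount_of_mem hz

theorem preimageCount_eq_topDegree [Nonempty X] (hF : F.IsBranched s V) {z : X} (hz : z ∈ V) :
    F.preimageCount z = F.topDegree := by
  rw [hF.topDegree_eq_sum, hF.preimageCount_of_mem hz]

theorem topDegree_pos [Nonempty X] (hF : F.IsBranched s V) : 0 < F.topDegree := by
  rw [hF.topDegree_eq_sum]
  refine Finset.sum_pos (fun A hA => Nat.mul_pos ?_ (hF.pos A hA)) (Finsupp.support_nonempty_iff.2 hF.ne_zero)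
  exact Nat.pos_of_ne_zero (Finsupp.mem_support_iff.1 hA)

variable [CompactSpace X] [T2Space X]

theorem topDegree_le_preimageCount [Nonempty X] (hF : F.IsBranched s V) (z : X) :
    F.topDegree ≤ F.preimageCount z := by
  rw [hF.topDegree_eq_sum, hF.preimageCount_eq_sum]
  exact Finset.sum_le_sum fun A hA => Nat.mul_le_mul_left _ ((hF.cover A hA).le_sum_multiplicity z)

theorem tendsto_preimageSum [Nonempty X] (hF : F.IsBranched s V) {z : X}
    (hz : F.preimageCount z = F.topDegree)
    {φ : X → ℝ} (hφ : Continuous φ) :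
    Tendsto (F.preimageSum φ) (𝓝[V] z) (𝓝 (F.preimageSum φ z)) := by
  have heq : F.preimageSum φ = fun z => _ := funext (hF.preimageSum_eq_sum φ)
  rw [heq]
  refine tendsto_finsetSum _ fun A hA => Tendsto.const_mul _ ?_
  refine (hF.cover A hA).tendsto_sum ?_ hφ
  rw [hF.topDegree_eq_sum, hF.preimageCount_eq_sum] at hz
  have := (Finset.sum_eq_sum_iff_of_le fun A hA =>
    Nat.mul_le_mul_left (F A) ((hF.cover A hA).le_sum_multiplicity z)).1 hz.symm A hA
  exact (Nat.eq_of_mul_eq_mul_left (Nat.pos_of_ne_zero (Finsupp.mem_support_iff.1 hA)) this).symm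

/-- On this set `preimageSum` agrees with its extension by limits from `V`, which is continuous. -/
theorem continuousOn_preimageSum [Nonempty X] (hF : F.IsBranched s V) {φ : X → ℝ}
    (hφ : Continuous φ) :
    ContinuousOn (F.preimageSum φ) {z | F.preimageCount z = F.topDegree} := by
  have h := continuousOn_extendFrom (A := V) (f := F.preimageSum φ)
    (B := {z | F.preimageCount z = F.topDegree}) (fun z _ => hF.dense z)
    fun z hz => ⟨_, hF.tendsto_preimageSum hz hφ⟩
  exact h.congr fun z hz => (extendFrom_eq (hF.dense z) (hF.tendsto_preimageSum hz hφ)).symm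

/-- Invariance tested on the constant 1 says that `preimageCount` has integral `topDegree`, which is
also a pointwise lower bound for it. -/
theorem ae_preimageCount_eq [Nonempty X] [MeasurableSpace X] (hF : F.IsBranched s V) {μ : Measure X}
    [IsProbabilityMeasure μ] (hμ : F.IsInvariant μ) : ∀ᵐ z ∂μ, F.preimageCount z = F.topDegree := by
  have h1 := hμ (ContinuousMap.const X 1)
  simp only [ContinuousMap.const_apply, integral_const, probReal_univ, smul_eq_mul, mul_one] at h1
  have h2 : ∫ z, (F.preimageCount z : ℝ) ∂μ = F.topDegree := by
    rw [← h1]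
    refine integral_congr_ae (Eventually.of_forall fun z => ?_)
    exact (hF.isFinitary.preimageSum_one z).symm
  have hint : Integrable (fun z => (F.preimageCount z : ℝ)) μ := by
    -- A non-integrable function has integral `0` by convention, contradicting positivity of the
    -- degree.
    by_contra hne
    rw [integral_undef hne] at h2
    exact hF.topDegree_pos.ne (by exact_mod_cast h2)
  have h3 : ∫ z, ((F.preimageCount z : ℝ) - F.topDegree) ∂μ = 0 := by
    rw [integral_sub hint (integrable_const _), h2]
    simp
  rw [integral_eq_zero_iff_of_nonneg (f := fun z => (F.preimageCount z : ℝ) - F.topDegree) (fun z => by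
    simpa using hF.topDegree_le_preimageCount z) (hint.sub (integrable_const _))] at h3
  filter_upwards [h3] with z hz
  exact_mod_cast sub_eq_zero.1 hz

end IsBranched

/-! ### The product correspondence: weights, fibres and degree. -/

section Product

variable {F : FormalCorr X} {s : Set (X × X) → ℕ} {V : Set X}

theorem IsBranched.multiplicity_prodSet (hF : F.IsBranched s V) {A B : Set (X × X)}
    (hA : A ∈ F.support)
    (hB : B ∈ F.support) (w z : X × X) :
    multiplicity (prodSet A B) w z = multiplicity A w.1 z.1 * multiplicity B w.2 z.2 := by
  rw [multiplicity_eq_toNat, emult_prodSet ((hF.cover A hA).emult_ne_top _ _)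
    ((hF.cover B hB).emult_ne_top _ _), ENat.toNat_mul]
  rfl

theorem IsBranched.isFinitary_product (hF : F.IsBranched s V) : (F.product F).IsFinitary where
  finite P hP z := by
    obtain ⟨A, hA, B, hB, rfl⟩ := exists_of_mem_support_product hP
    refine (((hF.cover A hA).finite z.1).prod ((hF.cover B hB).finite z.2)).subset ?_
    exact fun w hw => ⟨hw.1, hw.2⟩
  ne_zero_iff P hP w z := by
    obtain ⟨A, hA, B, hB, rfl⟩ := exists_of_mem_support_product hP
    rw [hF.multiplicity_prodSet hA hB, mul_ne_zero_iff, hF.isFinitary.ne_zero_iff A hA,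
      hF.isFinitary.ne_zero_iff B hB]
    rfl

/-- Summation over the formal sum is additive in the coefficients, so possible coincidences among
the sets `prodSet A B` do not matter. -/
theorem IsBranched.weight_product (hF : F.IsBranched s V) (w z : X × X) :
    (F.product F).weight w z = F.weight w.1 z.1 * F.weight w.2 z.2 := by
  have h0 : ∀ P : Set ((X × X) × (X × X)), 0 * multiplicity P w z = 0 := fun P => zero_mul _
  have ha : ∀ (P : Set ((X × X) × (X × X))) (a b : ℕ),
    (a + b) * multiplicity P w z = a * multiplicity P w z + b * multiplicity P w z :=
    fun P a b => add_mul a b _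
  rw [weight, product, Finsupp.sum_sum_index h0 ha, weight, weight, Finsupp.sum, Finsupp.sum, Finsupp.sum,
    Finset.sum_mul_sum]
  refine Finset.sum_congr rfl fun A hA => ?_
  rw [Finsupp.sum_sum_index h0 ha, Finsupp.sum]
  refine Finset.sum_congr rfl fun B hB => ?_
  rw [Finsupp.sum_single_index (h0 _), hF.multiplicity_prodSet hA hB]
  ring

theorem IsBranched.fiberFinset_product (hF : F.IsBranched s V) (z : X × X) :
    fiberFinset (F.product F).carrier z =
      fiberFinset F.carrier z.1 ×ˢ fiberFinset F.carrier z.2 := by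
  ext w
  rw [Finset.mem_product, mem_fiberFinset (hF.isFinitary_product.finite_carrier z),
    mem_fiberFinset (hF.isFinitary.finite_carrier _), mem_fiberFinset (hF.isFinitary.finite_carrier _),
    hF.isFinitary_product.mem_carrier_iff, hF.isFinitary.mem_carrier_iff, hF.isFinitary.mem_carrier_iff,
    hF.weight_product, mul_ne_zero_iff]

theorem IsBranched.topDegree_product [Nonempty X] (hF : F.IsBranched s V) :
    (F.product F).topDegree = F.topDegree * F.topDegree := by
  refine topDegree_eq (hF.isOpen.prod hF.isOpen) (hF.dense.prod hF.dense) fun z hz => ?_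
  rw [hF.isFinitary_product.preimageCount_eq, hF.fiberFinset_product,
    ← hF.preimageCount_eq_topDegree hz.1, hF.isFinitary.preimageCount_eq]
  nth_rewrite 2 [← hF.isFinitary.preimageCount_eq]
  rw [hF.preimageCount_eq_topDegree hz.1, ← hF.preimageCount_eq_topDegree hz.2,
    hF.isFinitary.preimageCount_eq, Finset.sum_mul_sum, Finset.sum_product]
  simp only [hF.weight_product]

end Product

end FormalCorr

open ProbabilityTheory in
theorem integral_kernel_comp {Y : Type*} [MeasurableSpace Y] {κ : Kernel Y Y} [IsMarkovKernel κ]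
    {μ : Measure Y} [IsProbabilityMeasure μ]
    {f : Y → ℝ} (hf : Integrable f (κ ∘ₘ μ)) : ∫ x, f x ∂(κ ∘ₘ μ) = ∫ z, ∫ x, f x ∂κ z ∂μ := by
  rw [← Measure.snd_compProd] at hf ⊢
  rw [Measure.snd, integral_map measurable_snd.aemeasurable hf.1, Measure.integral_compProd]
  exact (integrable_map_measure hf.1 measurable_snd.aemeasurable).1 hf

namespace FormalCorr

/-! ### The transition kernel of a correspondence. -/

section Transition

variable {X : Type*} [TopologicalSpace X] [MeasurableSpace X]

/-- The measure `∑' δ_w / d`, the sum extending over the preimages `w` of `z` under `F`. -/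
noncomputable def transition (F : FormalCorr X) (z : X) : Measure X :=
  ∑ w ∈ fiberFinset F.carrier z,
    ENNReal.ofReal ((F.weight w z : ℝ) / F.topDegree) • Measure.dirac w

variable {F : FormalCorr X}

theorem transition_apply (z : X) {B : Set X} (hB : MeasurableSet B) :
    F.transition z B = ∑ w ∈ fiberFinset F.carrier z,
      ENNReal.ofReal ((F.weight w z : ℝ) / F.topDegree) * B.indicator 1 w := by
  simp [transition, Measure.finsetSum_apply, Measure.dirac_apply' _ hB]

theorem IsFinitary.isProbabilityMeasure_transition (hF : F.IsFinitary) {z : X}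
    (hz : F.preimageCount z = F.topDegree) (hd : 0 < F.topDegree) :
    IsProbabilityMeasure (F.transition z) := by
  refine ⟨?_⟩
  rw [transition_apply z MeasurableSet.univ]
  simp only [indicator_univ, Pi.one_apply, mul_one]
  rw [← ENNReal.ofReal_sum_of_nonneg fun _ _ => by positivity, ← Finset.sum_div, ← Nat.cast_sum,
    ← hF.preimageCount_eq, hz, div_self (by positivity), ENNReal.ofReal_one]

theorem IsFinitary.integral_transition [MeasurableSingletonClass X] (hF : F.IsFinitary)
    (g : X → ℝ) (z : X) :
    ∫ w, g w ∂F.transition z = F.koopman g z := by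
  rw [transition, integral_finsetSum_measure, koopman, hF.preimageSum_eq, Finset.mul_sum]
  · refine Finset.sum_congr rfl fun w _ => ?_
    rw [integral_smul_measure, integral_dirac, ENNReal.toReal_ofReal (by positivity), smul_eq_mul]
    ring
  · intro w _
    exact (integrable_dirac (by simp)).smul_measure ENNReal.ofReal_ne_top

/-- All point masses on the fibre are positive, so almost everywhere means at every preimage. This
links `κ` to the pointwise notion of almost invariance. -/
theorem IsFinitary.ae_transition_iff [MeasurableSingletonClass X] (hF : F.IsFinitary)
    (hd : 0 < F.topDegree)
    (z : X) (p : X → Prop) :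
    (∀ᵐ w ∂F.transition z, p w) ↔ ∀ w, (w, z) ∈ F.carrier → p w := by
  rw [ae_iff, transition, Measure.finsetSum_apply, Finset.sum_eq_zero_iff]
  refine forall_congr' fun w => ?_
  rw [mem_fiberFinset (hF.finite_carrier z)]
  refine imp_congr_right fun hw => ?_
  have h1 : 0 < F.weight w z := Nat.pos_of_ne_zero (hF.mem_carrier_iff.1 hw)
  have h2 : ENNReal.ofReal ((F.weight w z : ℝ) / F.topDegree) ≠ 0 := by
    rw [Ne, ENNReal.ofReal_eq_zero, not_le]
    positivity
  rw [Measure.smul_apply, smul_eq_mul, mul_eq_zero, or_iff_right h2, Measure.dirac_apply]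
  by_cases hp : p w <;> simp [hp]

open ProbabilityTheory

/-- The kernel `κ` leaves `ν` invariant and is `ν`-almost everywhere the transition kernel of `G`. -/
structure Represents (κ : Kernel X X) (F : FormalCorr X) (ν : Measure X) : Prop where
  comp_eq : κ ∘ₘ ν = ν
  ae_eq : ∀ᵐ z ∂ν, κ z = F.transition z

/-- Closed sets form a generating π-system, and their indicators are limits of continuous functions.
-/
theorem measurable_of_continuousMap {Z : Type*} [MeasurableSpace Z] [HasOuterApproxClosed X]
    [BorelSpace X]
    {κ : Z → Measure X} [∀ z, IsProbabilityMeasure (κ z)]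
    (h : ∀ f : BoundedContinuousFunction X NNReal, Measurable fun z => ∫⁻ x, f x ∂κ z) : Measurable κ := by
  refine Measurable.measure_of_isPiSystem_of_isProbabilityMeasure
    (S := {s | IsClosed s}) ?_ isPiSystem_isClosed fun s hs => ?_
  · rw [BorelSpace.measurable_eq (α := X), borel_eq_generateFrom_isClosed]
  · exact measurable_of_tendsto_metrizable (fun n => h (hs.apprSeq n))
      (tendsto_pi_nhds.2 fun z => HasOuterApproxClosed.tendsto_lintegral_apprSeq hs (κ z))

/-- The transition measure is known to be a probability measure only where the count equals the
degree. Off a measurable conull set `Z` of such points it is replaced by a Dirac mass; on `Z`,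
measurability follows from continuity of `preimageSum`. -/
theorem IsBranched.exists_represents [Nonempty X] [CompactSpace X] [T2Space X]
    [HasOuterApproxClosed X] [BorelSpace X]
    {s : Set (X × X) → ℕ} {V : Set X} (hF : F.IsBranched s V) {μ : Measure X} [IsProbabilityMeasure μ]
    (hμ : F.IsInvariant μ) : ∃ κ : Kernel X X, IsMarkovKernel κ ∧ Represents κ F μ := by
  classical
  have hfin := hF.isFinitary
  have hd := hF.topDegree_pos
  obtain ⟨Z, hZ, hZm, hZμ⟩ := (hF.ae_preimageCount_eq hμ).exists_measurable_mem
  have hZc : ∀ z ∈ Z, F.preimageCount z = F.topDegree := hZμ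
  set κ₀ : X → Measure X := fun z => if z ∈ Z then F.transition z else Measure.dirac z with hκ₀
  have hpos : ∀ z ∈ Z, κ₀ z = F.transition z := fun z hz => if_pos hz
  have hneg : ∀ z ∉ Z, κ₀ z = Measure.dirac z := fun z hz => if_neg hz
  have hprob : ∀ z, IsProbabilityMeasure (κ₀ z) := fun z => by
    by_cases hz : z ∈ Z
    · rw [hpos z hz]
      exact hfin.isProbabilityMeasure_transition (hZc z hz) hd
    · rw [hneg z hz]
      infer_instance
  have hmeas : Measurable κ₀ := by
    refine measurable_of_continuousMap fun f => ?_
    have hfc : Continuous fun x => (f x : ℝ) := NNReal.continuous_coe.comp f.continuous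
    have h1 : (fun z => ∫⁻ x, f x ∂κ₀ z) =
        Z.piecewise (fun z => ENNReal.ofReal (F.koopman (fun x => (f x : ℝ)) z)) (fun z => (f z : ENNReal)) := by
      ext z
      by_cases hz : z ∈ Z
      · rw [Set.piecewise_eq_of_mem _ _ _ hz, hpos z hz, ← hfin.integral_transition,
          ofReal_integral_eq_lintegral_ofReal]
        · simp
        · have := hfin.isProbabilityMeasure_transition (hZc z hz) hd
          exact BoundedContinuousFunction.integrable_of_nnreal _ f
        · exact Eventually.of_forall fun x => NNReal.coe_nonneg _
      · rw [Set.piecewise_eq_of_notMem _ _ _ hz, hneg z hz, lintegral_dirac]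
    rw [h1]
    refine measurable_of_restrict_of_restrict_compl hZm ?_ ?_
    · rw [Set.domRestrict_piecewise]
      refine ENNReal.measurable_ofReal.comp ((Continuous.measurable ?_).const_mul _)
      exact continuousOn_iff_continuous_domRestrict.1 ((hF.continuousOn_preimageSum hfc).mono hZc)
    · rw [Set.domRestrict_piecewise_compl]
      exact (f.continuous.measurable.coe_nnreal_ennreal).comp measurable_subtype_coe
  refine ⟨⟨κ₀, hmeas⟩, ⟨hprob⟩, ?_, ?_⟩
  · have hM : IsMarkovKernel (⟨κ₀, hmeas⟩ : Kernel X X) := ⟨hprob⟩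
    refine ext_of_forall_integral_eq_of_IsFiniteMeasure fun f => ?_
    rw [integral_kernel_comp (f.integrable _)]
    have h1 := hμ f.toContinuousMap
    have h2 : ∫ z, (∫ y, f y ∂κ₀ z) ∂μ = ∫ z, F.koopman f z ∂μ := by
      refine integral_congr_ae ?_
      filter_upwards [hZ] with z hz
      rw [hpos z hz, hfin.integral_transition]
    refine h2.trans ?_
    simp only [koopman]
    rw [integral_const_mul]
    rw [show ∫ z, F.preimageSum f z ∂μ = _ from h1, ← mul_assoc, one_div_mul_cancel (by positivity), one_mul]
    rfl
  · filter_upwards [hZ] with z hz using hpos z hz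

theorem IsBranched.transition_product [Nonempty X] [SecondCountableTopology X] [BorelSpace X]
    {s : Set (X × X) → ℕ} {V : Set X} (hF : F.IsBranched s V) {z : X × X}
    (h₁ : F.preimageCount z.1 = F.topDegree) (h₂ : F.preimageCount z.2 = F.topDegree) :
    (F.product F).transition z = (F.transition z.1).prod (F.transition z.2) := by
  have i1 := hF.isFinitary.isProbabilityMeasure_transition h₁ hF.topDegree_pos
  have i2 := hF.isFinitary.isProbabilityMeasure_transition h₂ hF.topDegree_pos
  refine (Measure.prod_eq fun B C hB hC => ?_).symm
  rw [transition_apply z (hB.prod hC), transition_apply _ hB, transition_apply _ hC,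
    hF.fiberFinset_product, Finset.sum_mul_sum, Finset.sum_product]
  refine Finset.sum_congr rfl fun w₁ _ => Finset.sum_congr rfl fun w₂ _ => ?_
  rw [hF.weight_product, hF.topDegree_product, mul_mul_mul_comm, ← ENNReal.ofReal_mul (by positivity)]
  congr 1
  · congr 1
    push_cast
    rw [div_mul_div_comm]
  · by_cases hw₁ : w₁ ∈ B <;> by_cases hw₂ : w₂ ∈ C <;> simp [hw₁, hw₂]

theorem IsBranched.represents_product [Nonempty X] [CompactSpace X] [T2Space X]
    [SecondCountableTopology X] [BorelSpace X]
    {s : Set (X × X) → ℕ} {V : Set X} (hF : F.IsBranched s V) {μ : Measure X} [IsProbabilityMeasure μ]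
    (hμ : F.IsInvariant μ) {κ : Kernel X X} [IsMarkovKernel κ] (hκ : Represents κ F μ) :
    Represents (κ ∥ₖ κ) (F.product F) (μ.prod μ) where
  comp_eq := by
    rw [← Kernel.id_parallelComp_comp_parallelComp_id, ← Measure.comp_assoc,
      ← Measure.prod_comp_left, hκ.comp_eq, ← Measure.prod_comp_right, hκ.comp_eq]
  ae_eq := by
    have h := (hκ.ae_eq).and (hF.ae_preimageCount_eq hμ)
    filter_upwards [Measure.quasiMeasurePreserving_fst.ae h, Measure.quasiMeasurePreserving_snd.ae h]
      with z h1 h2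
    rw [Kernel.parallelComp_apply, h1.1, h2.1, hF.transition_product h1.2 h2.2]

end Transition

end FormalCorr

/-! ### The Markov operator on L². -/

section Transfer

open ProbabilityTheory
open scoped RealInnerProductSpace

variable {Y : Type*} [MeasurableSpace Y] {ν : Measure Y} [IsProbabilityMeasure ν] {κ : Kernel Y Y}
  [IsMarkovKernel κ]

theorem measurePreserving_fst_compProd (ν : Measure Y) [IsProbabilityMeasure ν] (κ : Kernel Y Y)
    [IsMarkovKernel κ] : MeasurePreserving Prod.fst (ν ⊗ₘ κ) ν :=
  ⟨measurable_fst, Measure.fst_compProd ν κ⟩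

theorem measurePreserving_snd_compProd (hκ : κ ∘ₘ ν = ν) : MeasurePreserving Prod.snd (ν ⊗ₘ κ) ν :=
  ⟨measurable_snd, (Measure.snd_compProd ν κ).trans hκ⟩

/-- Composition with the first projection, as an isometry of `L²(ν)` into `L²(ν ⊗ₘ κ)`. -/
noncomputable def liftFst (ν : Measure Y) [IsProbabilityMeasure ν] (κ : Kernel Y Y)
    [IsMarkovKernel κ] :
    Lp ℝ 2 ν →ₗᵢ[ℝ] Lp ℝ 2 (ν ⊗ₘ κ) :=
  Lp.compMeasurePreservingₗᵢ ℝ Prod.fst (measurePreserving_fst_compProd ν κ)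

/-- Composition with the second projection, as an isometry of `L²(ν)` into `L²(ν ⊗ₘ κ)`. -/
noncomputable def liftSnd (hκ : κ ∘ₘ ν = ν) : Lp ℝ 2 ν →ₗᵢ[ℝ] Lp ℝ 2 (ν ⊗ₘ κ) :=
  Lp.compMeasurePreservingₗᵢ ℝ Prod.snd (measurePreserving_snd_compProd hκ)

/-- The Markov operator of `κ` on `L²(ν)`. -/
noncomputable def markovOp (hκ : κ ∘ₘ ν = ν) : Lp ℝ 2 ν →L[ℝ] Lp ℝ 2 ν :=
  (ContinuousLinearMap.adjoint (liftFst ν κ).toContinuousLinearMap).comp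
    (liftSnd hκ).toContinuousLinearMap

theorem inner_markovOp (hκ : κ ∘ₘ ν = ν) (g f : Lp ℝ 2 ν) :
    ⟪g, markovOp hκ f⟫ = ⟪liftFst ν κ g, liftSnd hκ f⟫ :=
  ContinuousLinearMap.adjoint_inner_right (liftFst ν κ).toContinuousLinearMap g (liftSnd hκ f)

theorem norm_markovOp_le (hκ : κ ∘ₘ ν = ν) : ‖markovOp hκ‖ ≤ 1 := by
  refine (ContinuousLinearMap.opNorm_comp_le _ _).trans ?_
  refine mul_le_one₀ ?_ (norm_nonneg _) (LinearIsometry.norm_toContinuousLinearMap_le _)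
  rw [LinearIsometryEquiv.norm_map]
  exact LinearIsometry.norm_toContinuousLinearMap_le _

theorem coeFn_liftFst (f : Lp ℝ 2 ν) : liftFst ν κ f =ᵐ[ν ⊗ₘ κ] fun p => f p.1 :=
  Lp.coeFn_compMeasurePreserving f (measurePreserving_fst_compProd ν κ)

theorem coeFn_liftSnd (hκ : κ ∘ₘ ν = ν) (f : Lp ℝ 2 ν) : liftSnd hκ f =ᵐ[ν ⊗ₘ κ] fun p => f p.2 :=
  Lp.coeFn_compMeasurePreserving f (measurePreserving_snd_compProd hκ)

/-- Both sides have the same integral over each measurable `S`, namely that of `f p.2` over `S ×ˢ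
univ` against `ν ⊗ₘ κ`. -/
theorem coeFn_markovOp (hκ : κ ∘ₘ ν = ν) (f : Lp ℝ 2 ν) :
    markovOp hκ f =ᵐ[ν] fun z => ∫ w, f w ∂κ z := by
  have hf : Integrable f ν := (Lp.memLp f).integrable (by norm_num)
  have hf2 : Integrable (fun p : Y × Y => f p.2) (ν ⊗ₘ κ) :=
    (measurePreserving_snd_compProd hκ).integrable_comp_of_integrable hf
  refine Integrable.ae_eq_of_forall_setIntegral_eq _ _ ((Lp.memLp _).integrable (by norm_num))
    (MeasureTheory.Integrable.integral_compProd (κ := Kernel.const Unit ν)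
      (η := Kernel.prodMkLeft Unit κ) (a := ()) hf2) fun S hS _ => ?_
  rw [← L2.inner_indicatorConstLp_one (𝕜 := ℝ) hS (measure_ne_top _ _), inner_markovOp, liftFst]
  have h1 : (Lp.compMeasurePreservingₗᵢ ℝ Prod.fst (measurePreserving_fst_compProd ν κ))
      (indicatorConstLp 2 hS (measure_ne_top ν S) (1 : ℝ)) = _ :=
    Lp.indicatorConstLp_compMeasurePreserving hS (measure_ne_top _ _) (1 : ℝ)
      (measurePreserving_fst_compProd ν κ)
  rw [h1, L2.inner_indicatorConstLp_one (𝕜 := ℝ), setIntegral_congr_ae₀ (g := fun p => f p.2)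
    (measurable_fst hS).nullMeasurableSet ((coeFn_liftSnd hκ f).mono fun p hp _ => hp)]
  have h2 := Measure.setIntegral_compProd hS MeasurableSet.univ (hf2.integrableOn (s := S ×ˢ univ))
  simpa [Set.prod_univ] using h2

/-- Both lifts have norm `‖f‖` and their inner product is `⟪f, T f⟫ = ‖f‖²`, so their difference has
norm zero. -/
theorem liftSnd_eq_liftFst_of_fixed (hκ : κ ∘ₘ ν = ν) {f : Lp ℝ 2 ν} (hf : markovOp hκ f = f) :
    liftSnd hκ f = liftFst ν κ f := by
  rw [← sub_eq_zero, ← norm_eq_zero, ← sq_eq_zero_iff, norm_sub_sq_real, real_inner_comm,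
    ← inner_markovOp, hf, LinearIsometry.norm_map, LinearIsometry.norm_map, real_inner_self_eq_norm_sq]
  ring

theorem ae_ae_eq_of_fixed (hκ : κ ∘ₘ ν = ν) {f : Lp ℝ 2 ν} (hf : markovOp hκ f = f) :
    ∀ᵐ z ∂ν, ∀ᵐ w ∂κ z, f w = f z := by
  refine Measure.ae_ae_of_ae_compProd (p := fun p : Y × Y => f p.2 = f p.1) ?_
  have h1 := coeFn_liftSnd hκ f
  rw [liftSnd_eq_liftFst_of_fixed hκ hf] at h1
  filter_upwards [h1, coeFn_liftFst (κ := κ) f] with p h2 h3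
  rw [← h2, h3]

theorem integral_markovOp (hκ : κ ∘ₘ ν = ν)
    (f : Lp ℝ 2 ν) : ∫ z, markovOp hκ f z ∂ν = ∫ z, f z ∂ν := by
  have hf : Integrable f (κ ∘ₘ ν) := by
    rw [hκ]
    exact (Lp.memLp f).integrable (by norm_num)
  rw [integral_congr_ae (coeFn_markovOp hκ f), ← integral_kernel_comp hf, hκ]

theorem ae_ae_of_ae_of_comp_eq (hκ : κ ∘ₘ ν = ν) {p : Y → Prop} (hp : ∀ᵐ z ∂ν, p z) :
    ∀ᵐ z ∂ν, ∀ᵐ w ∂κ z, p w :=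
  Measure.ae_ae_of_ae_compProd (p := fun q : Y × Y => p q.2)
    ((measurePreserving_snd_compProd hκ).quasiMeasurePreserving.ae hp)

end Transfer

/-! ### Cesàro null sequences. -/

section Cesaro

/-- The Cesàro means of `|c|` tend to zero. -/
def CesaroZero (c : ℕ → ℝ) : Prop :=
  Tendsto (fun n : ℕ => (1 / (n : ℝ)) * ∑ j ∈ Finset.range n, |c j|) atTop (𝓝 0)

namespace CesaroZero

variable {c c' : ℕ → ℝ}

theorem of_le_const_mul (h : CesaroZero c) (C : ℝ)
    (hc : ∀ j, |c' j| ≤ C * |c j|) : CesaroZero c' := by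
  have h0 := Tendsto.const_mul C h
  rw [mul_zero] at h0
  refine squeeze_zero (fun n => by positivity) (fun n => ?_) h0
  rw [← mul_assoc, mul_comm C, mul_assoc, Finset.mul_sum (a := C)]
  exact mul_le_mul_of_nonneg_left (Finset.sum_le_sum fun j _ => hc j)
    (by positivity : (0 : ℝ) ≤ 1 / (n : ℝ))

theorem add (h : CesaroZero c) (h' : CesaroZero c') : CesaroZero (c + c') := by
  have h0 := Tendsto.add h h'
  rw [add_zero] at h0
  refine squeeze_zero (fun n => by positivity) (fun n => ?_) h0
  rw [← mul_add, ← Finset.sum_add_distrib]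
  exact mul_le_mul_of_nonneg_left (Finset.sum_le_sum fun j _ => abs_add_le (c j) (c' j))
    (by positivity : (0 : ℝ) ≤ 1 / (n : ℝ))

theorem zero : CesaroZero 0 := by
  simp [CesaroZero]

theorem const_smul (h : CesaroZero c) (a : ℝ) : CesaroZero (a • c) :=
  h.of_le_const_mul |a| fun j => by simp [abs_mul]

theorem mul_bounded (h : CesaroZero c) {C : ℝ} (hC : ∀ j, |c' j| ≤ C) : CesaroZero (c * c') :=
  h.of_le_const_mul C fun j => by
    rw [Pi.mul_apply, abs_mul, mul_comm]
    gcongr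
    exact hC j

theorem of_approx (h : ∀ ε > 0, ∃ c', CesaroZero c' ∧ ∀ j, |c j - c' j| ≤ ε) : CesaroZero c := by
  rw [CesaroZero, Metric.tendsto_nhds]
  intro ε hε
  obtain ⟨c', hc', hcc⟩ := h (ε / 2) (half_pos hε)
  filter_upwards [hc'.eventually_lt_const (half_pos hε)] with n hn
  have hnn : 0 ≤ (1 / (n : ℝ)) * ∑ j ∈ Finset.range n, |c j| := by positivity
  rw [Real.dist_eq, sub_zero, abs_of_nonneg hnn]
  have h1 : ∑ j ∈ Finset.range n, |c j| ≤ ∑ j ∈ Finset.range n, |c' j| + n * (ε / 2) := by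
    rw [← nsmul_eq_mul, ← Finset.card_range n, ← Finset.sum_const, Finset.card_range,
      ← Finset.sum_add_distrib]
    refine Finset.sum_le_sum fun j _ => ?_
    have := abs_add_le (c' j) (c j - c' j)
    rw [add_sub_cancel] at this
    linarith [hcc j]
  have h2 : (1 / (n : ℝ)) * (n * (ε / 2)) ≤ ε / 2 := by
    rcases eq_or_ne (n : ℝ) 0 with h0 | h0
    · rw [h0]
      simpa using (half_pos hε).le
    · rw [← mul_assoc, one_div_mul_cancel h0, one_mul]
  calc (1 / (n : ℝ)) * ∑ j ∈ Finset.range n, |c j|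
      ≤ (1 / (n : ℝ)) * (∑ j ∈ Finset.range n, |c' j| + n * (ε / 2)) := by gcongr
    _ = (1 / (n : ℝ)) * ∑ j ∈ Finset.range n, |c' j| + (1 / (n : ℝ)) * (n * (ε / 2)) := mul_add _ _ _
    _ < ε := by linarith

theorem eq_zero_of_const {a : ℝ} (h : CesaroZero fun _ => a) : a = 0 := by
  have h1 : Tendsto (fun n : ℕ => (1 / (n : ℝ)) * ∑ j ∈ Finset.range n, |a|) atTop (𝓝 |a|) := by
    refine tendsto_const_nhds.congr' ?_
    filter_upwards [eventually_ne_atTop 0] with n hn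
    have : (n : ℝ) ≠ 0 := by exact_mod_cast hn
    rw [Finset.sum_const, Finset.card_range, nsmul_eq_mul, ← mul_assoc, one_div_mul_cancel this, one_mul]
  exact abs_eq_zero.1 (tendsto_nhds_unique h1 h)

/-- A sequence whose squares have Cesàro means tending to zero. -/
theorem of_sq (h : Tendsto (fun n : ℕ => (1 / (n : ℝ)) * ∑ j ∈ Finset.range n, c j ^ 2) atTop (𝓝 0)) :
    CesaroZero c := by
  have h1 : Tendsto (fun n : ℕ => √((1 / (n : ℝ)) * ∑ j ∈ Finset.range n, c j ^ 2)) atTop (𝓝 0) := by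
    simpa using h.sqrt
  refine squeeze_zero (fun n => by positivity) (fun n => Real.le_sqrt_of_sq_le ?_) h1
  rcases eq_or_ne (n : ℝ) 0 with h0 | h0
  · simp [h0]
  have h2 := sq_sum_le_card_mul_sum_sq (s := Finset.range n) (f := fun j => |c j|)
  simp only [sq_abs, Finset.card_range] at h2
  calc ((1 / (n : ℝ)) * ∑ j ∈ Finset.range n, |c j|) ^ 2
      = (1 / (n : ℝ)) ^ 2 * (∑ j ∈ Finset.range n, |c j|) ^ 2 := mul_pow _ _ _
    _ ≤ (1 / (n : ℝ)) ^ 2 * (n * ∑ j ∈ Finset.range n, c j ^ 2) := by gcongr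
    _ = (1 / (n : ℝ)) * ∑ j ∈ Finset.range n, c j ^ 2 := by field_simp

/-- Uniformly bounded linear families of sequences are Cesàro null if they are so on a total
set. -/
theorem of_span_dense {H : Type*} [NormedAddCommGroup H] [NormedSpace ℝ H] (c : H →ₗ[ℝ] (ℕ → ℝ))
    {C : ℝ}
    (hC : ∀ f j, |c f j| ≤ C * ‖f‖) {S : Set H} (hS : Dense (Submodule.span ℝ S : Set H))
    (h : ∀ f ∈ S, CesaroZero (c f)) (f : H) : CesaroZero (c f) := by
  have hspan : ∀ f ∈ Submodule.span ℝ S, CesaroZero (c f) := by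
    intro f hf
    induction hf using Submodule.span_induction with
    | mem f hf => exact h f hf
    | zero => rw [map_zero]; exact zero
    | add f g _ _ hf hg => rw [map_add]; exact hf.add hg
    | smul a f _ hf => rw [map_smul]; exact hf.const_smul a
  refine of_approx fun ε hε => ?_
  have hε' : 0 < ε / (|C| + 1) := by positivity
  obtain ⟨g, hg, hfg⟩ := Metric.mem_closure_iff.1 (hS f) _ hε'
  refine ⟨c g, hspan g hg, fun j => ?_⟩
  rw [← Pi.sub_apply, ← map_sub]
  calc |c (f - g) j| ≤ C * ‖f - g‖ := hC _ _
    _ ≤ (|C| + 1) * (ε / (|C| + 1)) := by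
        rw [dist_eq_norm] at hfg
        gcongr
        linarith [le_abs_self C]
    _ = ε := by field_simp

end CesaroZero

end Cesaro

/-! ### The mean ergodic theorem. -/

section MeanErgodic

open scoped RealInnerProductSpace

/-- The mean ergodic theorem for a contraction whose fixed vectors are the multiples of `e`. -/
theorem tendsto_cesaro_inner {H : Type*} [NormedAddCommGroup H] [InnerProductSpace ℝ H]
    [CompleteSpace H]
    {T : H →L[ℝ] H} (hT : ‖T‖ ≤ 1) {e : H} (he : ∀ f, T f = f → ∃ a : ℝ, f = a • e)
    (hTe : ∀ f, ⟪e, T f⟫ = ⟪e, f⟫) {f : H} (hf : ⟪e, f⟫ = 0) (g : H) :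
    Tendsto (fun n : ℕ => (1 / (n : ℝ)) * ∑ j ∈ Finset.range n, ⟪(T ^ j) f, g⟫) atTop (𝓝 0) := by
  have h1 := T.tendsto_birkhoffAverage_orthogonalProjection hT f
  set P : H := ((T.eqLocus (1 : H →L[ℝ] H)).orthogonalProjectionOnto f : H) with hP
  have hPT : T P = P := ((T.eqLocus (1 : H →L[ℝ] H)).orthogonalProjectionOnto f).2
  have hiter : ∀ j, T^[j] f = (T ^ j) f := fun j => by
    induction j with
    | zero => rfl
    | succ j ih => rw [Function.iterate_succ_apply', ih, pow_succ']; rfl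
  have hav : ∀ (n : ℕ) (g : H), ⟪birkhoffAverage ℝ T id n f, g⟫ =
      (1 / (n : ℝ)) * ∑ j ∈ Finset.range n, ⟪(T ^ j) f, g⟫ := by
    intro n g
    rw [birkhoffAverage, birkhoffSum, real_inner_smul_left, sum_inner, one_div]
    simp only [id, hiter]
  have h2 : ∀ g, Tendsto (fun n : ℕ => (1 / (n : ℝ)) * ∑ j ∈ Finset.range n, ⟪(T ^ j) f, g⟫) atTop
      (𝓝 ⟪P, g⟫) := by
    intro g
    have := h1.inner (𝕜 := ℝ) (tendsto_const_nhds (x := g))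
    exact this.congr fun n => hav n g
  have h3 : ∀ j, ⟪(T ^ j) f, e⟫ = 0 := by
    intro j
    induction j with
    | zero => simpa [real_inner_comm] using hf
    | succ j ih =>
      rw [real_inner_comm, pow_succ', mul_apply_eq_comp, hTe, real_inner_comm, ih]
  have h4 : ⟪P, e⟫ = 0 := by
    refine tendsto_nhds_unique (h2 e) ?_
    simp only [h3, Finset.sum_const_zero, mul_zero]
    exact tendsto_const_nhds
  -- The limit `P` is fixed, hence a multiple of `e`, and it is orthogonal to `e` because all the
  -- iterates of `f` are.
  obtain ⟨a, ha⟩ := he P hPT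
  have h5 : P = 0 := by
    rw [← inner_self_eq_zero (𝕜 := ℝ)]
    nth_rewrite 2 [ha]
    rw [real_inner_smul_right, h4, mul_zero]
  simpa [h5] using h2 g

end MeanErgodic

/-! ### Correlations of a contraction as a bounded bilinear map. -/

section Gap

open scoped RealInnerProductSpace

variable {H : Type*} [NormedAddCommGroup H] [InnerProductSpace ℝ H]

/-- A contraction `T` fixes `f` if `⟪f, T f⟫ = ⟪f, f⟫`. -/
theorem fixed_of_inner_eq {T : H →L[ℝ] H} (hT : ‖T‖ ≤ 1) {f : H}
    (h : ⟪f, T f⟫ = ⟪f, f⟫) : T f = f := by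
  rw [← sub_eq_zero, ← norm_eq_zero, ← sq_eq_zero_iff]
  refine le_antisymm ?_ (sq_nonneg _)
  rw [norm_sub_sq_real, real_inner_comm, h, real_inner_self_eq_norm_sq]
  have h1 : ‖T f‖ ≤ ‖f‖ := (T.le_of_opNorm_le hT f).trans_eq (one_mul _)
  nlinarith [norm_nonneg (T f), norm_nonneg f]

theorem norm_pow_apply_le {T : H →L[ℝ] H} (hT : ‖T‖ ≤ 1) (j : ℕ) (f : H) : ‖(T ^ j) f‖ ≤ ‖f‖ := by
  induction j with
  | zero => simp
  | succ j ih =>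
    rw [pow_succ', mul_apply_eq_comp]
    exact ((T.le_of_opNorm_le hT _).trans_eq (one_mul _)).trans ih

theorem pow_apply_of_fixed {T : H →L[ℝ] H} {f : H} (hf : T f = f) (j : ℕ) : (T ^ j) f = f := by
  induction j with
  | zero => simp
  | succ j ih => rw [pow_succ', mul_apply_eq_comp, ih, hf]

/-- The correlations `⟪T ^ j f, g⟫ - ⟪e, f⟫ ⟪e, g⟫` of `T`, as a bilinear map with values in sequences. -/
noncomputable def gap (T : H →L[ℝ] H) (e : H) : H →ₗ[ℝ] H →ₗ[ℝ] (ℕ → ℝ) :=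
  LinearMap.mk₂ ℝ (fun f g j => ⟪(T ^ j) f, g⟫ - ⟪e, f⟫ * ⟪e, g⟫)
    (fun f f' g => by
      ext j
      simp only [map_add, inner_add_left, inner_add_right, Pi.add_apply]
      ring)
    (fun a f g => by
      ext j
      simp only [map_smul, real_inner_smul_left, real_inner_smul_right, Pi.smul_apply, smul_eq_mul]
      ring)
    (fun f g g' => by
      ext j
      simp only [inner_add_right, Pi.add_apply]
      ring)
    (fun a f g => by
      ext j
      simp only [real_inner_smul_right, Pi.smul_apply, smul_eq_mul]
      ring)

theorem gap_apply (T : H →L[ℝ] H) (e f g : H) (j : ℕ) :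
    gap T e f g j = ⟪(T ^ j) f, g⟫ - ⟪e, f⟫ * ⟪e, g⟫ := rfl

theorem abs_gap_le {T : H →L[ℝ] H} (hT : ‖T‖ ≤ 1) {e : H} (he : ‖e‖ ≤ 1) (f g : H) (j : ℕ) :
    |gap T e f g j| ≤ 2 * ‖f‖ * ‖g‖ := by
  have h1 : |⟪(T ^ j) f, g⟫| ≤ ‖f‖ * ‖g‖ := (abs_real_inner_le_norm _ _).trans
    (mul_le_mul_of_nonneg_right (norm_pow_apply_le hT j f) (norm_nonneg g))
  have h2 : ∀ f, |⟪e, f⟫| ≤ ‖f‖ := fun f => (abs_real_inner_le_norm _ _).trans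
    (mul_le_of_le_one_left (norm_nonneg f) he)
  have h3 : |⟪e, f⟫ * ⟪e, g⟫| ≤ ‖f‖ * ‖g‖ := by
    rw [abs_mul]
    exact mul_le_mul (h2 f) (h2 g) (abs_nonneg _) (norm_nonneg _)
  rw [gap_apply]
  linarith [abs_sub ⟪(T ^ j) f, g⟫ (⟪e, f⟫ * ⟪e, g⟫)]

/-- The bound of `abs_gap_le` is uniform in `j`, so density can be used in one variable at a time.
-/
theorem cesaroZero_gap_of_span_dense {T : H →L[ℝ] H} (hT : ‖T‖ ≤ 1) {e : H} (he : ‖e‖ ≤ 1)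
    {S S' : Set H}
    (hS : Dense (Submodule.span ℝ S : Set H)) (hS' : Dense (Submodule.span ℝ S' : Set H))
    (h : ∀ f ∈ S, ∀ g ∈ S', CesaroZero (gap T e f g)) (f g : H) : CesaroZero (gap T e f g) := by
  have h1 : ∀ g ∈ S', ∀ f, CesaroZero (gap T e f g) := fun g hg =>
    CesaroZero.of_span_dense ((gap T e).flip g) (C := 2 * ‖g‖) (fun f j => by
      rw [LinearMap.flip_apply]
      exact (abs_gap_le hT he f g j).trans_eq (by ring)) hS fun f hf => h f hf g hg
  exact CesaroZero.of_span_dense (gap T e f) (C := 2 * ‖f‖) (fun g j => abs_gap_le hT he f g j) hS'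
    (fun g hg => h1 g hg f) g

end Gap

/-! ### Density of tensors. -/

section Tensor

variable {X : Type*} [TopologicalSpace X]

/-- The function `z ↦ φ₁ z.1 * φ₂ z.2`. -/
def ContinuousMap.tensor (φ₁ φ₂ : C(X, ℝ)) : C(X × X, ℝ) := φ₁.comp .fst * φ₂.comp .snd

theorem ContinuousMap.tensor_apply (φ₁ φ₂ : C(X, ℝ)) (z : X × X) :
    φ₁.tensor φ₂ z = φ₁ z.1 * φ₂ z.2 := rfl

/-- Stone–Weierstrass: tensors are closed under multiplication, so their span is the algebra they
generate, and Urysohn functions in one variable separate points. -/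
theorem ContinuousMap.dense_span_tensor [CompactSpace X] [T2Space X] :
    Dense (Submodule.span ℝ {Φ | ∃ φ₁ φ₂ : C(X, ℝ), Φ = φ₁.tensor φ₂} : Set C(X × X, ℝ)) := by
  let M : Submonoid C(X × X, ℝ) :=
    { carrier := {Φ | ∃ φ₁ φ₂ : C(X, ℝ), Φ = φ₁.tensor φ₂}
      mul_mem' := by
        rintro _ _ ⟨φ₁, φ₂, rfl⟩ ⟨ψ₁, ψ₂, rfl⟩
        refine ⟨φ₁ * ψ₁, φ₂ * ψ₂, ?_⟩
        ext z
        simp only [ContinuousMap.mul_apply, tensor_apply]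
        ring
      one_mem' := ⟨1, 1, by ext z; simp [tensor_apply]⟩ }
  have hM : Subalgebra.toSubmodule (Algebra.adjoin ℝ (M : Set C(X × X, ℝ))) =
      Submodule.span ℝ {Φ | ∃ φ₁ φ₂ : C(X, ℝ), Φ = φ₁.tensor φ₂} := by
    rw [Algebra.adjoin_eq_span, Submonoid.closure_eq]
    rfl
  have hsep : (Algebra.adjoin ℝ (M : Set C(X × X, ℝ))).SeparatesPoints := by
    intro z z' hne
    have hury : ∀ x x' : X, x ≠ x' → ∃ φ : C(X, ℝ), φ x ≠ φ x' := by
      intro x x' hxx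
      obtain ⟨φ, h0, h1, -⟩ := exists_continuous_zero_one_of_isClosed (isClosed_singleton (x := x))
        (isClosed_singleton (x := x')) (by simpa using hxx)
      refine ⟨φ, ?_⟩
      rw [h0 rfl, h1 rfl]
      simp
    by_cases h1 : z.1 = z'.1
    · obtain ⟨φ, hφ⟩ := hury z.2 z'.2 fun h2 => hne (Prod.ext h1 h2)
      refine ⟨_, ⟨tensor 1 φ, Algebra.subset_adjoin ⟨1, φ, rfl⟩, rfl⟩, ?_⟩
      simpa [tensor_apply] using hφ
    · obtain ⟨φ, hφ⟩ := hury z.1 z'.1 h1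
      refine ⟨_, ⟨tensor φ 1, Algebra.subset_adjoin ⟨φ, 1, rfl⟩, rfl⟩, ?_⟩
      simpa [tensor_apply] using hφ
  have := ContinuousMap.subalgebra_topologicalClosure_eq_top_of_separatesPoints _ hsep
  rw [← hM, ← dense_closure]
  have h2 : closure ((Subalgebra.toSubmodule (Algebra.adjoin ℝ (M : Set C(X × X, ℝ))) :
      Submodule ℝ C(X × X, ℝ)) : Set C(X × X, ℝ)) = univ := by
    have h3 := congrArg (fun A : Subalgebra ℝ C(X × X, ℝ) => (A : Set C(X × X, ℝ))) this
    simpa using h3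
  rw [h2]
  exact dense_univ

end Tensor

/-! ### The constant function in L². -/

section MeanValue

open scoped RealInnerProductSpace

variable {Y : Type*} [MeasurableSpace Y] (ν : Measure Y) [IsProbabilityMeasure ν]

/-- The constant function `1` as an element of `L²`. -/
noncomputable def oneLp : Lp ℝ 2 ν := indicatorConstLp 2 MeasurableSet.univ (measure_ne_top ν _)
    (1 : ℝ)

theorem inner_oneLp (f : Lp ℝ 2 ν) : ⟪oneLp ν, f⟫ = ∫ z, f z ∂ν := by
  rw [oneLp, L2.inner_indicatorConstLp_one (𝕜 := ℝ), setIntegral_univ]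

theorem coeFn_oneLp : oneLp ν =ᵐ[ν] fun _ => (1 : ℝ) := by
  filter_upwards [indicatorConstLp_coeFn (p := 2) (hs := MeasurableSet.univ)
    (hμs := measure_ne_top ν _) (c := (1 : ℝ))] with z hz
  rw [oneLp, hz]
  simp

theorem norm_oneLp : ‖oneLp ν‖ = 1 := by
  have : ‖oneLp ν‖ ^ 2 = 1 := by
    rw [← real_inner_self_eq_norm_sq, inner_oneLp, integral_congr_ae (coeFn_oneLp ν)]
    simp
  exact (pow_eq_one_iff_of_nonneg (norm_nonneg _) two_ne_zero).1 this

end MeanValue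

namespace FormalCorr

open ProbabilityTheory
open scoped RealInnerProductSpace

/-! ### Ergodicity and mixing through the Markov operator. -/

section Operator

variable {Y : Type*} [TopologicalSpace Y] [MeasurableSpace Y] [MeasurableSingletonClass Y]
  {G : FormalCorr Y} {ν : Measure Y} [IsProbabilityMeasure ν] {κ : Kernel Y Y} [IsMarkovKernel κ]

theorem Represents.ae_koopman_eq (hκ : Represents κ G ν) (hG : G.IsFinitary) :
    ∀ᵐ z ∂ν, ∀ g : Y → ℝ, G.koopman g z = ∫ w, g w ∂κ z := by
  filter_upwards [hκ.ae_eq] with z hz g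
  rw [hz, hG.integral_transition]

/-- Invariance makes a `ν`-null set null for `κ z` for almost every `z`, so the pointwise operator
respects almost everywhere equality. -/
theorem Represents.koopman_ae_eq (hκ : Represents κ G ν) (hG : G.IsFinitary) {g : Y → ℝ}
    {f : Lp ℝ 2 ν}
    (h : g =ᵐ[ν] f) : G.koopman g =ᵐ[ν] markovOp hκ.comp_eq f := by
  filter_upwards [hκ.ae_koopman_eq hG, ae_ae_of_ae_of_comp_eq hκ.comp_eq h, coeFn_markovOp hκ.comp_eq f]
    with z h1 h2 h3
  rw [h1, h3, integral_congr_ae h2]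

theorem Represents.koopman_iterate_ae_eq (hκ : Represents κ G ν) (hG : G.IsFinitary) {g : Y → ℝ}
    {f : Lp ℝ 2 ν}
    (h : g =ᵐ[ν] f) (j : ℕ) : G.koopman^[j] g =ᵐ[ν] (markovOp hκ.comp_eq ^ j) f := by
  induction j with
  | zero => simpa using h
  | succ j ih =>
    rw [Function.iterate_succ_apply', pow_succ', mul_apply_eq_comp]
    exact hκ.koopman_ae_eq hG ih

theorem Represents.correlation_eq (hκ : Represents κ G ν) (hG : G.IsFinitary) {φ ψ : Y → ℝ}
    {f g : Lp ℝ 2 ν}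
    (hf : φ =ᵐ[ν] f) (hg : ψ =ᵐ[ν] g) (j : ℕ) :
    G.correlation ν j φ ψ = ⟪(markovOp hκ.comp_eq ^ j) f, g⟫ := by
  rw [correlation, L2.inner_def]
  refine integral_congr_ae ?_
  filter_upwards [hκ.koopman_iterate_ae_eq hG hf j, hg] with z h1 h2
  rw [h1, h2]
  simp [mul_comm]

theorem Represents.gap_eq (hκ : Represents κ G ν) (hG : G.IsFinitary) {φ ψ : Y → ℝ} {f g : Lp ℝ 2 ν}
    (hf : φ =ᵐ[ν] f) (hg : ψ =ᵐ[ν] g) :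
    gap (markovOp hκ.comp_eq) (oneLp ν) f g =
      fun j => G.correlation ν j φ ψ - (∫ z, φ z ∂ν) * ∫ z, ψ z ∂ν := by
  ext j
  rw [gap_apply, hκ.correlation_eq hG hf hg, inner_oneLp, inner_oneLp, integral_congr_ae hf,
    integral_congr_ae hg]

theorem Represents.inner_one (hκ : Represents κ G ν) (f : Lp ℝ 2 ν) :
    ⟪oneLp ν, markovOp hκ.comp_eq f⟫ = ⟪oneLp ν, f⟫ := by
  rw [inner_oneLp, inner_oneLp, integral_markovOp]

theorem Represents.markovOp_one (hκ : Represents κ G ν) :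
    markovOp hκ.comp_eq (oneLp ν) = oneLp ν :=
  fixed_of_inner_eq (norm_markovOp_le _) (hκ.inner_one _)

/-- The Markov operator is weakly mixing. -/
def Represents.Mixing (hκ : Represents κ G ν) : Prop :=
  ∀ f g : Lp ℝ 2 ν, CesaroZero (gap (markovOp hκ.comp_eq) (oneLp ν) f g)

/-- If `G` is ergodic, then the fixed vectors of the Markov operator are constant. -/
theorem Represents.exists_eq_smul_one (hκ : Represents κ G ν) (hG : G.IsFinitary)
    (hd : 0 < G.topDegree)
    (herg : G.IsErgodic ν) {f : Lp ℝ 2 ν} (hf : markovOp hκ.comp_eq f = f) :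
    ∃ a : ℝ, f = a • oneLp ν := by
  have h1 : ∀ᵐ z ∂ν, ∀ w, (w, z) ∈ G.carrier → f w = f z := by
    filter_upwards [ae_ae_eq_of_fixed hκ.comp_eq hf, hκ.ae_eq] with z h2 h3
    rw [h3] at h2
    exact (hG.ae_transition_iff hd z _).1 h2
  obtain ⟨Z, hZ, hZm, hZf⟩ := h1.exists_measurable_mem
  have hfm : Measurable f := (Lp.stronglyMeasurable f).measurable
  -- A function all of whose measurable preimages are null or conull is almost everywhere constant.
  -- Here each `f ⁻¹' U` is almost invariant, with `f ⁻¹' U ∩ Z` as the smaller set.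
  obtain ⟨a, ha⟩ := Filter.exists_eventuallyEq_const_of_forall_separating (l := ae ν) (f := f)
    MeasurableSet fun U hU => by
      have hinv : G.IsAlmostInvariant ν (f ⁻¹' U) := by
        refine ⟨hfm hU, f ⁻¹' U ∩ Z, (hfm hU).inter hZm, inter_subset_left,
          (measure_inter_conull hZ).symm, ?_⟩
        rintro _ ⟨⟨w, z⟩, ⟨hz, hwz⟩, rfl⟩
        show f w ∈ U
        rw [hZf z hz.2 w hwz]
        exact hz.1
      rcases herg _ hinv with h0 | h1
      · exact Or.inr (measure_eq_zero_iff_ae_notMem.1 h0)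
      · exact Or.inl ((prob_compl_eq_zero_iff (hfm hU)).2 h1)
  refine ⟨a, Lp.ext ?_⟩
  filter_upwards [ha, Lp.coeFn_smul a (oneLp ν), coeFn_oneLp ν] with z h2 h3 h4
  rw [h2, h3, Pi.smul_apply, h4]
  simp

/-- For almost invariant `B`, all preimages of almost every point of `B` lie in `B`, so `T 1_B = 1`
almost everywhere on `B` and `fixed_of_inner_eq` makes `1_B` fixed. Its correlation gap is the
constant `ν(B) - ν(B)²`, which mixing forces to be zero. -/
theorem Represents.Mixing.isErgodic {hκ : Represents κ G ν} (h : hκ.Mixing) (hG : G.IsFinitary)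
    (hd : 0 < G.topDegree) : G.IsErgodic ν := by
  rintro B ⟨hB, B', hB', hBB', hνB, hpre⟩
  set f : Lp ℝ 2 ν := indicatorConstLp 2 hB (measure_ne_top ν B) (1 : ℝ) with hf
  have hff : ⟪f, f⟫ = ν.real B := by
    rw [hf, L2.real_inner_indicatorConstLp_one_indicatorConstLp_one, inter_self]
  have hef : ⟪oneLp ν, f⟫ = ν.real B := by
    rw [hf, oneLp, L2.real_inner_indicatorConstLp_one_indicatorConstLp_one, univ_inter]
  have hBB : ∀ᵐ z ∂ν, z ∈ B → z ∈ B' := by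
    have : ν (B \ B') = 0 := by
      rw [measure_sdiff hBB' hB'.nullMeasurableSet (measure_ne_top _ _), hνB, tsub_self]
    filter_upwards [measure_eq_zero_iff_ae_notMem.1 this] with z hz hzB
    by_contra hne
    exact hz ⟨hzB, hne⟩
  have hind : ∀ᵐ z ∂ν, f z = B.indicator (fun _ => (1 : ℝ)) z := indicatorConstLp_coeFn
  have hfT : markovOp hκ.comp_eq f = f := by
    refine fixed_of_inner_eq (norm_markovOp_le _) ?_
    rw [hff]
    nth_rewrite 1 [hf]
    rw [L2.inner_indicatorConstLp_one (𝕜 := ℝ), ← integral_indicator_one hB, ← integral_indicator hB]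
    refine integral_congr_ae ?_
    filter_upwards [coeFn_markovOp hκ.comp_eq f, hBB, hκ.ae_eq, ae_ae_of_ae_of_comp_eq hκ.comp_eq hind]
      with z h1 h2 h3 h4
    by_cases hz : z ∈ B
    · rw [indicator_of_mem hz, indicator_of_mem hz, h1, integral_congr_ae h4]
      have h5 : ∀ᵐ w ∂κ z, w ∈ B := by
        rw [h3, hG.ae_transition_iff hd]
        exact fun w hw => hpre ⟨(w, z), ⟨h2 hz, hw⟩, rfl⟩
      rw [integral_congr_ae (g := fun _ => (1 : ℝ)) (h5.mono fun w hw => indicator_of_mem hw _)]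
      simp
    · rw [indicator_of_notMem hz, indicator_of_notMem hz]
  have h1 := h f f
  have h2 : gap (markovOp hκ.comp_eq) (oneLp ν) f f = fun _ => ν.real B - ν.real B * ν.real B := by
    ext j
    rw [gap_apply, pow_apply_of_fixed hfT, hff, hef]
  rw [h2] at h1
  have h3 := h1.eq_zero_of_const
  have h4 : ν.real B * (1 - ν.real B) = 0 := by linarith
  rcases mul_eq_zero.1 h4 with h5 | h5
  · exact Or.inl ((measureReal_eq_zero_iff).1 h5)
  · right
    rw [← ENNReal.ofReal_toReal (measure_ne_top ν B)]
    rw [show (ν B).toReal = 1 from (sub_eq_zero.1 h5).symm, ENNReal.ofReal_one]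

/-- The iterates of a bounded function under the Koopman operator are bounded. -/
theorem Represents.ae_abs_koopman_iterate_le (hκ : Represents κ G ν) (hG : G.IsFinitary)
    {φ : Y → ℝ} {C : ℝ}
    (hC : ∀ z, |φ z| ≤ C) (j : ℕ) : ∀ᵐ z ∂ν, |(G.koopman^[j] φ) z| ≤ C := by
  induction j with
  | zero => exact Eventually.of_forall hC
  | succ j ih =>
    filter_upwards [hκ.ae_koopman_eq hG, ae_ae_of_ae_of_comp_eq hκ.comp_eq ih] with z h1 h2
    rw [Function.iterate_succ_apply', h1]
    simpa using norm_integral_le_of_norm_le_const (μ := κ z) (f := G.koopman^[j] φ) h2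

end Operator

/-! ### From continuous test functions to L² and L¹. -/

section Compact

theorem coeFn_toLp_two {Y : Type*} [TopologicalSpace Y] [CompactSpace Y] [MeasurableSpace Y]
    [BorelSpace Y]
    [SecondCountableTopologyEither Y ℝ] (ν : Measure Y) [IsProbabilityMeasure ν] (φ : C(Y, ℝ)) :
    φ =ᵐ[ν] ContinuousMap.toLp 2 ν ℝ φ := (ContinuousMap.coeFn_toLp (p := 2) (𝕜 := ℝ) ν φ).symm

variable {Y : Type*} [TopologicalSpace Y] [CompactSpace Y] [TopologicalSpace.MetrizableSpace Y]
  [SecondCountableTopology Y] [MeasurableSpace Y] [BorelSpace Y]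
  {G : FormalCorr Y} {ν : Measure Y} [IsProbabilityMeasure ν] {κ : Kernel Y Y} [IsMarkovKernel κ]

theorem dense_span_toLp_image (ν : Measure Y) [IsProbabilityMeasure ν] {S : Set C(Y, ℝ)}
    (hS : Dense (Submodule.span ℝ S : Set C(Y, ℝ))) :
    Dense (Submodule.span ℝ (ContinuousMap.toLp 2 ν ℝ '' S) : Set (Lp ℝ 2 ν)) := by
  have h1 := (ContinuousMap.toLp_denseRange ℝ ν ℝ (p := 2) (by norm_num)).dense_image
    (ContinuousMap.toLp 2 ν ℝ : C(Y, ℝ) →L[ℝ] Lp ℝ 2 ν).continuous hS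
  refine h1.mono ?_
  rintro _ ⟨φ, hφ, rfl⟩
  have := Submodule.mem_map_of_mem (f := (ContinuousMap.toLp 2 ν ℝ : C(Y, ℝ) →L[ℝ] Lp ℝ 2 ν).toLinearMap) hφ
  rw [Submodule.map_span] at this
  exact this

theorem Represents.mixing_of_span_dense (hκ : Represents κ G ν) (hG : G.IsFinitary)
    {S : Set C(Y, ℝ)}
    (hS : Dense (Submodule.span ℝ S : Set C(Y, ℝ)))
    (h : ∀ φ ∈ S, ∀ ψ ∈ S, CesaroZero fun j =>
      G.correlation ν j φ ψ - (∫ z, φ z ∂ν) * ∫ z, ψ z ∂ν) : hκ.Mixing := by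
  intro f g
  refine cesaroZero_gap_of_span_dense (norm_markovOp_le _) (norm_oneLp ν).le
    (dense_span_toLp_image ν hS) (dense_span_toLp_image ν hS) ?_ f g
  rintro _ ⟨φ, hφ, rfl⟩ _ ⟨ψ, hψ, rfl⟩
  rw [hκ.gap_eq hG (coeFn_toLp_two ν φ) (coeFn_toLp_two ν ψ)]
  exact h φ hφ ψ hψ

theorem Represents.Mixing.cesaroZero {hκ : Represents κ G ν} (h : hκ.Mixing) (hG : G.IsFinitary)
    (φ ψ : C(Y, ℝ)) :
    CesaroZero fun j => G.correlation ν j φ ψ - (∫ z, φ z ∂ν) * ∫ z, ψ z ∂ν := by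
  rw [← hκ.gap_eq hG (coeFn_toLp_two ν φ) (coeFn_toLp_two ν ψ)]
  exact h _ _

theorem Represents.mixing_of_isWeaklyMixing (hκ : Represents κ G ν) (hG : G.IsFinitary)
    (h : G.IsWeaklyMixing ν) :
    hκ.Mixing :=
  hκ.mixing_of_span_dense hG (S := univ) (by simp) fun φ _ ψ _ =>
    h φ ψ (ψ.continuous.integrable_of_hasCompactSupport (HasCompactSupport.of_compactSpace _))

/-- The function `ψ` is only in `L¹`, beyond the reach of the `L²` statement. The iterates of the
continuous `φ` are almost everywhere bounded by `‖φ‖`, so the gap is a bounded linear function of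
`ψ` in `L¹`, where continuous functions are dense. -/
theorem Represents.Mixing.isWeaklyMixing {hκ : Represents κ G ν} (h : hκ.Mixing)
    (hG : G.IsFinitary) :
    G.IsWeaklyMixing ν := by
  intro φ ψ hψ
  have hbdd : ∀ z, |φ z| ≤ ‖φ‖ := fun z => φ.norm_coe_le_norm z
  have hmeas : ∀ j, AEStronglyMeasurable (G.koopman^[j] φ) ν := fun j =>
    (Lp.aestronglyMeasurable _).congr (hκ.koopman_iterate_ae_eq hG (coeFn_toLp_two ν φ) j).symm
  have hb := hκ.ae_abs_koopman_iterate_le hG hbdd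
  have hint : ∀ (j : ℕ) (ψ : Y → ℝ), Integrable ψ ν → Integrable (fun z => (G.koopman^[j] φ) z * ψ z) ν :=
    fun j ψ hψ => hψ.bdd_mul (hmeas j) (hb j)
  let c : Lp ℝ 1 ν →ₗ[ℝ] (ℕ → ℝ) :=
    { toFun := fun ψ j => G.correlation ν j φ ψ - (∫ z, φ z ∂ν) * ∫ z, ψ z ∂ν
      map_add' := fun f g => by
        ext j
        have hf := L1.integrable_coeFn f
        have hg := L1.integrable_coeFn g
        have e1 : ∫ z, (f + g) z ∂ν = ∫ z, f z ∂ν + ∫ z, g z ∂ν := by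
          rw [integral_congr_ae (Lp.coeFn_add f g), ← integral_add hf hg]
          rfl
        have e2 : G.correlation ν j φ (f + g : Lp ℝ 1 ν) = G.correlation ν j φ f + G.correlation ν j φ g := by
          simp only [correlation]
          rw [← integral_add (hint j f hf) (hint j g hg)]
          refine integral_congr_ae ((Lp.coeFn_add f g).mono fun z hz => ?_)
          simp only [hz, Pi.add_apply, mul_add]
        rw [e1, e2, Pi.add_apply]
        ring
      map_smul' := fun a f => by
        ext j
        have e1 : ∫ z, (a • f) z ∂ν = a * ∫ z, f z ∂ν := by
          rw [integral_congr_ae (Lp.coeFn_smul a f), ← integral_const_mul]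
          rfl
        have e2 : G.correlation ν j φ (a • f : Lp ℝ 1 ν) = a * G.correlation ν j φ f := by
          simp only [correlation]
          rw [← integral_const_mul]
          refine integral_congr_ae ((Lp.coeFn_smul a f).mono fun z hz => ?_)
          simp only [hz, Pi.smul_apply, smul_eq_mul]
          ring
        rw [e1, e2, Pi.smul_apply, RingHom.id_apply, smul_eq_mul]
        ring }
  have hbound : ∀ f j, |c f j| ≤ 2 * ‖φ‖ * ‖f‖ := by
    intro f j
    have hf := L1.integrable_coeFn f
    have h0 : ‖f‖ = ∫ z, |f z| ∂ν := by
      rw [L1.norm_eq_integral_norm]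
      rfl
    have h1 : |G.correlation ν j φ f| ≤ ‖φ‖ * ‖f‖ := by
      rw [h0, ← integral_const_mul]
      refine (abs_integral_le_integral_abs).trans (integral_mono_ae (hint j f hf).abs (hf.abs.const_mul _) ?_)
      filter_upwards [hb j] with z hz
      simp only [abs_mul]
      exact mul_le_mul_of_nonneg_right hz (abs_nonneg _)
    have h2 : |∫ z, φ z ∂ν| ≤ ‖φ‖ := by
      simpa using norm_integral_le_of_norm_le_const (μ := ν) (f := φ) (Eventually.of_forall hbdd)
    have h3 : |∫ z, f z ∂ν| ≤ ‖f‖ := by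
      rw [h0]
      exact abs_integral_le_integral_abs
    have h4 : |(∫ z, φ z ∂ν) * ∫ z, f z ∂ν| ≤ ‖φ‖ * ‖f‖ := by
      rw [abs_mul]
      exact mul_le_mul h2 h3 (abs_nonneg _) (norm_nonneg _)
    have h5 := abs_sub (G.correlation ν j φ f) ((∫ z, φ z ∂ν) * ∫ z, f z ∂ν)
    show |G.correlation ν j φ f - (∫ z, φ z ∂ν) * ∫ z, f z ∂ν| ≤ _
    linarith
  have hdense : Dense (Submodule.span ℝ (range (ContinuousMap.toLp 1 ν ℝ : C(Y, ℝ) →L[ℝ] Lp ℝ 1 ν)) :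
      Set (Lp ℝ 1 ν)) :=
    Dense.mono Submodule.subset_span (ContinuousMap.toLp_denseRange ℝ ν ℝ (p := 1) (by norm_num))
  have hc : ∀ (f : Lp ℝ 1 ν) (ψ : Y → ℝ), ψ =ᵐ[ν] f →
      c f = fun j => G.correlation ν j φ ψ - (∫ z, φ z ∂ν) * ∫ z, ψ z ∂ν := by
    intro f ψ hψ
    ext j
    show G.correlation ν j φ f - (∫ z, φ z ∂ν) * ∫ z, f z ∂ν = _
    rw [integral_congr_ae hψ]
    simp only [correlation]
    rw [integral_congr_ae (hψ.mono fun z hz => by simp only [hz] :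
      (fun z => (G.koopman^[j] φ) z * ψ z) =ᵐ[ν] fun z => (G.koopman^[j] φ) z * f z)]
  have key := CesaroZero.of_span_dense c hbound hdense (by
    rintro _ ⟨χ, rfl⟩
    rw [hc _ χ (ContinuousMap.coeFn_toLp ν χ).symm]
    exact h.cesaroZero hG φ χ) (hψ.toL1 ψ)
  rw [hc _ ψ hψ.coeFn_toL1.symm] at key
  exact key

end Compact

/-! ### Mixing of the product. -/

section Product

theorem integral_tensor {X : Type*} [TopologicalSpace X] [MeasurableSpace X] (μ : Measure X)
    [IsProbabilityMeasure μ] (φ₁ φ₂ : C(X, ℝ)) :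
    ∫ z, φ₁.tensor φ₂ z ∂μ.prod μ = (∫ z, φ₁ z ∂μ) * ∫ z, φ₂ z ∂μ :=
  integral_prod_mul _ _

variable {X : Type*} [TopologicalSpace X] [Nonempty X] {F : FormalCorr X} {s : Set (X × X) → ℕ} {V : Set X}

theorem IsBranched.koopman_product (hF : F.IsBranched s V) (φ₁ φ₂ : X → ℝ) :
    (F.product F).koopman (fun z => φ₁ z.1 * φ₂ z.2) = fun z => F.koopman φ₁ z.1 * F.koopman φ₂ z.2 := by
  ext z
  simp only [koopman]
  rw [hF.isFinitary_product.preimageSum_eq, hF.isFinitary.preimageSum_eq, hF.isFinitary.preimageSum_eq,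
    hF.topDegree_product, hF.fiberFinset_product, mul_mul_mul_comm, Finset.sum_mul_sum, Finset.sum_product]
  congr 1
  · push_cast
    rw [one_div_mul_one_div]
  · refine Finset.sum_congr rfl fun w₁ _ => Finset.sum_congr rfl fun w₂ _ => ?_
    rw [hF.weight_product]
    push_cast
    ring

theorem IsBranched.koopman_iterate_product (hF : F.IsBranched s V) (φ₁ φ₂ : X → ℝ) (j : ℕ) :
    (F.product F).koopman^[j] (fun z => φ₁ z.1 * φ₂ z.2) =
      fun z => (F.koopman^[j] φ₁) z.1 * (F.koopman^[j] φ₂) z.2 := by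
  induction j with
  | zero => rfl
  | succ j ih => rw [Function.iterate_succ_apply', ih, hF.koopman_product, Function.iterate_succ_apply',
      Function.iterate_succ_apply']

theorem IsBranched.correlation_product [MeasurableSpace X] (hF : F.IsBranched s V) (μ : Measure X)
    [IsProbabilityMeasure μ] (j : ℕ) (φ₁ φ₂ ψ₁ ψ₂ : C(X, ℝ)) :
    (F.product F).correlation (μ.prod μ) j (φ₁.tensor φ₂) (ψ₁.tensor ψ₂) =
      F.correlation μ j φ₁ ψ₁ * F.correlation μ j φ₂ ψ₂ := by
  have h := hF.koopman_iterate_product φ₁ φ₂ j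
  rw [correlation, correlation, correlation, ← integral_prod_mul]
  refine integral_congr_ae (Eventually.of_forall fun z => ?_)
  have h1 : ((F.product F).koopman^[j] (φ₁.tensor φ₂)) z = _ := congrFun h z
  simp only [h1, ContinuousMap.tensor_apply]
  ring

variable [CompactSpace X] [TopologicalSpace.MetrizableSpace X] [SecondCountableTopology X] [MeasurableSpace X]
  [BorelSpace X] {μ : Measure X} [IsProbabilityMeasure μ] {κ : Kernel X X} [IsMarkovKernel κ]
  {η : Kernel (X × X) (X × X)} [IsMarkovKernel η]

/-- Correlations of tensors factor, and `c₁ c₂ - a b = (c₁ - a) c₂ + a (c₂ - b)` with `c₂` bounded.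
-/
theorem Represents.Mixing.product {hκ : Represents κ F μ} (h : hκ.Mixing) (hF : F.IsBranched s V)
    (hη : Represents η (F.product F) (μ.prod μ)) : hη.Mixing := by
  refine hη.mixing_of_span_dense hF.isFinitary_product ContinuousMap.dense_span_tensor ?_
  rintro _ ⟨φ₁, φ₂, rfl⟩ _ ⟨ψ₁, ψ₂, rfl⟩
  set a := (∫ z, φ₁ z ∂μ) * ∫ z, ψ₁ z ∂μ
  set b := (∫ z, φ₂ z ∂μ) * ∫ z, ψ₂ z ∂μ
  have h1 := h.cesaroZero hF.isFinitary φ₁ ψ₁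
  have h2 := h.cesaroZero hF.isFinitary φ₂ ψ₂
  obtain ⟨C, hC⟩ : ∃ C, ∀ j, |F.correlation μ j φ₂ ψ₂| ≤ C :=
    ⟨‖ContinuousMap.toLp 2 μ ℝ φ₂‖ * ‖ContinuousMap.toLp 2 μ ℝ ψ₂‖, fun j => by
      rw [hκ.correlation_eq hF.isFinitary (coeFn_toLp_two μ φ₂) (coeFn_toLp_two μ ψ₂)]
      exact (abs_real_inner_le_norm _ _).trans
        (mul_le_mul_of_nonneg_right (norm_pow_apply_le (norm_markovOp_le _) j _) (norm_nonneg _))⟩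
  convert (h1.mul_bounded hC).add (h2.const_smul a) using 1
  ext j
  rw [hF.correlation_product, integral_tensor, integral_tensor]
  simp only [Pi.add_apply, Pi.mul_apply, Pi.smul_apply, smul_eq_mul, a]
  ring

/-- For `φ₀` of mean zero, the correlation of `φ₀ ⊗ φ₀` with `ψ ⊗ ψ` is the square of that of `φ₀`
with `ψ`; this is how a signed ergodic average controls absolute values. -/
theorem Represents.mixing_of_isErgodic_product (hκ : Represents κ F μ) (hF : F.IsBranched s V)
    (hη : Represents η (F.product F) (μ.prod μ)) (h : (F.product F).IsErgodic (μ.prod μ)) : hκ.Mixing := by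
  have hG := hF.isFinitary
  refine hκ.mixing_of_span_dense hG (S := univ) (by simp) fun φ _ ψ _ => ?_
  set a := ∫ z, φ z ∂μ with ha
  set φ₀ : C(X, ℝ) := φ - ContinuousMap.const X a with hφ₀
  have hφi : Integrable φ μ :=
    φ.continuous.integrable_of_hasCompactSupport (HasCompactSupport.of_compactSpace _)
  have hzero : ∫ z, φ₀ z ∂μ = 0 := by
    simp only [hφ₀, ContinuousMap.sub_apply, ContinuousMap.const_apply]
    rw [integral_sub hφi (integrable_const _)]
    simp [ha]
  -- Subtracting the mean from `φ` subtracts exactly the product of integrals, since the operator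
  -- fixes constants.
  have hcorr : (fun j => F.correlation μ j φ ψ - a * ∫ z, ψ z ∂μ) = fun j => F.correlation μ j φ₀ ψ := by
    ext j
    have e1 : φ₀ =ᵐ[μ] (ContinuousMap.toLp 2 μ ℝ φ - a • oneLp μ : Lp ℝ 2 μ) := by
      filter_upwards [coeFn_toLp_two μ φ, Lp.coeFn_sub (ContinuousMap.toLp 2 μ ℝ φ) (a • oneLp μ),
        Lp.coeFn_smul a (oneLp μ), coeFn_oneLp μ] with z h1 h2 h3 h4
      rw [h2, Pi.sub_apply, h3, Pi.smul_apply, h4, ← h1]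
      simp [hφ₀]
    rw [hκ.correlation_eq hG (coeFn_toLp_two μ φ) (coeFn_toLp_two μ ψ),
      hκ.correlation_eq hG e1 (coeFn_toLp_two μ ψ), map_sub, map_smul,
      pow_apply_of_fixed hκ.markovOp_one, inner_sub_left, real_inner_smul_left, inner_oneLp,
      ← integral_congr_ae (coeFn_toLp_two μ ψ)]
  rw [hcorr]
  refine CesaroZero.of_sq ?_
  have hd : 0 < (F.product F).topDegree := by
    rw [hF.topDegree_product]
    exact Nat.mul_pos hF.topDegree_pos hF.topDegree_pos
  have key := tendsto_cesaro_inner (norm_markovOp_le hη.comp_eq) (e := oneLp (μ.prod μ))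
    (fun f hf => hη.exists_eq_smul_one hF.isFinitary_product hd h hf) hη.inner_one
    (f := ContinuousMap.toLp 2 (μ.prod μ) ℝ (φ₀.tensor φ₀)) (by
      rw [inner_oneLp, ← integral_congr_ae (coeFn_toLp_two _ _), integral_tensor, hzero, zero_mul])
    (ContinuousMap.toLp 2 (μ.prod μ) ℝ (ψ.tensor ψ))
  refine key.congr fun n => ?_
  congr 1
  refine Finset.sum_congr rfl fun j _ => ?_
  rw [← hη.correlation_eq hF.isFinitary_product (coeFn_toLp_two _ _) (coeFn_toLp_two _ _),
    hF.correlation_product, sq]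

end Product

end FormalCorr

/-! ### The equivalence. -/

theorem theorem6 (k : ℕ) {X : Type*} [TopologicalSpace X] [T2Space X] [CompactSpace X]
    [ConnectedSpace X] [ChartedSpace (EuclideanSpace ℂ (Fin k)) X]
    [IsManifold 𝓘(ℂ, EuclideanSpace ℂ (Fin k)) ω X] [MeasurableSpace X] [BorelSpace X]
    (F : FormalCorr X) (hF : F.IsHolomorphic 𝓘(ℂ, EuclideanSpace ℂ (Fin k)))
    (μ : Measure X) [IsProbabilityMeasure μ] (hμ : F.IsInvariant μ) :
    List.TFAE [F.IsWeaklyMixing μ,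
      (F.product F).IsErgodic (μ.prod μ),
      (F.product F).IsWeaklyMixing (μ.prod μ)] := by
  -- Second countability makes the product σ-algebra on `X × X` the Borel one; together with
  -- metrizability it makes continuous functions available as dense test functions.
  have : SecondCountableTopology X :=
    ChartedSpace.secondCountable_of_sigmaCompact (EuclideanSpace ℂ (Fin k)) X
  have : TopologicalSpace.MetrizableSpace X := TopologicalSpace.metrizableSpace_of_t3_secondCountable X
  obtain ⟨s, V, hB⟩ := hF.exists_isBranched
  obtain ⟨κ, hM, hκ⟩ := hB.exists_represents hμ
  have hη := hB.represents_product hμ hκ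
  have hd : 0 < (F.product F).topDegree := by
    rw [hB.topDegree_product]
    exact Nat.mul_pos hB.topDegree_pos hB.topDegree_pos
  tfae_have 1 → 3 := fun h =>
    ((hκ.mixing_of_isWeaklyMixing hB.isFinitary h).product hB hη).isWeaklyMixing hB.isFinitary_product
  tfae_have 3 → 2 := fun h =>
    (hη.mixing_of_isWeaklyMixing hB.isFinitary_product h).isErgodic hB.isFinitary_product hd
  tfae_have 2 → 1 := fun h =>
    (hκ.mixing_of_isErgodic_product hB hη h).isWeaklyMixing hB.isFinitary
  tfae_finish
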